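/- **Setting.** Let $n\ge 0$ be an integer, $\mathbb T^n=\mathbb R^n/2\pi\mathbb Z^n$. For $D\subseteq\mathbb R^n$ and $r,s>0$ let $D_r\subseteq\mathbb C^n$ be the set of points at Euclidean distance $<r$ from some point of $D$, and $\mathbb T^n_s=\{x\in\mathbb C^n:|\operatorname{Im}x_j|<s\ \forall j\}/2\pi\mathbb Z^n$. "Real-analytic" on $D_r$ or $D_r\times\mathbb T^n_s$ means holomorphic there and real at real points. For $k\in\mathbb Z^n$ put $|k|_1=\sum_i|k_i|$, and for $f(y,x)=\sum_{k\in\mathbb Z^n}f_k(y)e^{ik\cdot x}$ (Fourier expansion in $x$) put $$\|f\|_{r,s}=\sup_{y\in D_r}\sum_{k\in\mathbb Z^n}|f_k(y)|e^{|k|_1s}.$$ For a lattice (subgroup) $\Lambda\subseteq\mathbb Z^n$ and $N\in\mathbb N$ let $P_\Lambda f,\ P_\Lambda^\perp f,\ T_Nf,\ T_N^\perp f$ be the sums of $f_k(y)e^{ik\cdot x}$ over $k\in\Lambda$, $k\notin\Lambda$, $|k|_1\le N$, $|k|_1>N$ respectively. For $\alpha>0$, $K\in\mathbb N$, the set $D_r$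 is $(\alpha,K)$-non-resonant modulo $\Lambda$ (with respect to $h$) if $|h'(y)\cdot k|\ge\alpha$ for all $y\in D_r$ and all $k\in\mathbb Z^n\setminus\Lambda$ with $|k|_1\le K$. Symplectic refers to the form $dy\wedge dx$. **Proposition 4.1 (Normal form with small analyticity loss).** Let $r,s,\alpha>0$, $K\in\mathbb N$, $K\ge2$, $D\subseteq\mathbb R^n$, and let $\Lambda$ be a lattice of $\mathbb Z^n$. Let $H(y,x)=h(y)+f(y,x)$ with $h$ and $f$ real-analytic on $D_r$ and $D_r\times\mathbb T^n_s$ respectively, and $\|f\|_{r,s}<\infty$. Assume that $D_r$ is $(\alpha,K)$-non-resonant modulo $\Lambda$ and that $$\vartheta_*:=\frac{2^{11}K^2}{\alpha rs}\|f\|_{r,s}<1 .$$ Then there exists a real-analytic symplectic change of variables (injective onto its image) $$\Psi:(y',x')\in D_{r_*}\times\mathbb T^n_{s_*}\mapsto(y,x)\in D_r\times\mathbb T^n_s,\qquad r_*:=\tfrac r2,\quad s_*:=s\Big(1-\frac1K\Big),$$ satisfying $$|y-y'|_1\le\frac{\vartheta_*}{2^7K}r,\qquad \max_{1\le i\le n}|x_i-x_i'|\le\frac{\vartheta_*}{16K^2}s,$$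 and such that $$H\circ\Psi=h+f^\flat+f_*,\qquad f^\flat:=P_\Lambda f+T_K^\perp P_\Lambda^\perp f,$$ with $f_*$ real-analytic on $D_{r_*}\times\mathbb T^n_{s_*}$ and $$\|f_*\|_{r_*,s_*}\le\frac1K\vartheta_*\|f\|_{r,s},\qquad \|T_KP_\Lambda^\perp f_*\|_{r_*,s_*}\le\Big(\frac{\vartheta_*}8\Big)^K\frac{8}{eK}\|f\|_{r,s}.$$ Moreover, $H\circ\Psi$ can be rewritten as $H\circ\Psi=h+g+f_{**}$ with $g,f_{**}$ real-analytic on $D_{r_*}\times\mathbb T^n_{s_*}$, $P_\Lambda g=g$, $P_\Lambda f_{**}=0$, and $$\|g-P_\Lambda f\|_{r_*,s_*}\le\frac1K\vartheta_*\|f\|_{r,s},\qquad \|f_{**}\|_{r_*,s/2}\le 2e^{-(K-2)\bar s}\|f\|_{r,s},\qquad \bar s:=\min\Big\{\frac s2,\ \log\frac8{\vartheta_*}\Big\}$$ (if $f=0$ on $D_r\times\mathbb T^n_s$, so that $\vartheta_*=0$, the last bound reads $\|f_{**}\|_{r_*,s/2}=0$). -/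

import Mathlib

open scoped BigOperators ENNReal

noncomputable section

namespace AnalyticNormalForm

/-- The complex phase space `ℂⁿ × ℂⁿ`, with points `(y, x)` (actions, angles). Functions and maps on
`D_r × 𝕋ⁿ_s` are represented by their lifts to `D_r × {|Im x_j| < s}`. -/
abbrev Phase (n : ℕ) : Type := (Fin n → ℂ) × (Fin n → ℂ)

/-- The open complex neighbourhood `D_r` of `D ⊆ ℝⁿ`: all `z ∈ ℂⁿ` at Euclidean distance less than
`r` from some point of `D`. -/
def actionDomain {n : ℕ} (D : Set (Fin n → ℝ)) (r : ℝ) : Set (Fin n → ℂ) :=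
  {z | ∃ y ∈ D, ‖WithLp.toLp 2 (fun i => z i - (y i : ℂ))‖ < r}

/-- The strip `{x ∈ ℂⁿ : |Im x_j| < s}`, whose quotient by `2πℤⁿ` is `𝕋ⁿ_s`. -/
def angleStrip (n : ℕ) (s : ℝ) : Set (Fin n → ℂ) :=
  {x | ∀ i, |(x i).im| < s}

/-- The (lifted) domain `D_r × 𝕋ⁿ_s`. -/
def phaseDomain {n : ℕ} (D : Set (Fin n → ℝ)) (r s : ℝ) : Set (Phase n) :=
  actionDomain D r ×ˢ angleStrip n s

/-- Vectors of `ℂⁿ` all of whose coordinates are real. -/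
def IsRealVec {n : ℕ} (z : Fin n → ℂ) : Prop := ∀ i, (z i).im = 0

/-- The translation vector `2πk`, for `k ∈ ℤⁿ`. -/
def period {n : ℕ} (k : Fin n → ℤ) : Fin n → ℂ :=
  fun i => 2 * (Real.pi : ℂ) * (k i : ℂ)

/-- `h` is real-analytic on `D_r`: holomorphic on `D_r` and real at real points. -/
structure RealAnalyticAction {n : ℕ} (D : Set (Fin n → ℝ)) (r : ℝ)
    (h : (Fin n → ℂ) → ℂ) : Prop where
  holomorphic : DifferentiableOn ℂ h (actionDomain D r)
  real : ∀ y ∈ actionDomain D r, IsRealVec y → (h y).im = 0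

/-- `f` is real-analytic on `D_r × 𝕋ⁿ_s`: holomorphic, `2π`-periodic in each angle, and real at
real points. -/
structure RealAnalyticPhase {n : ℕ} (D : Set (Fin n → ℝ)) (r s : ℝ)
    (f : Phase n → ℂ) : Prop where
  holomorphic : DifferentiableOn ℂ f (phaseDomain D r s)
  periodic : ∀ p ∈ phaseDomain D r s, ∀ k : Fin n → ℤ, f (p.1, p.2 + period k) = f p
  real : ∀ p ∈ phaseDomain D r s, IsRealVec p.1 → IsRealVec p.2 → (f p).im = 0

/-- The 1-norm `|k|₁ = ∑ |k_i|` on `ℤⁿ`. -/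
def oneNorm {n : ℕ} (k : Fin n → ℤ) : ℕ := ∑ i, (k i).natAbs

/-- The bilinear product `k · x`. -/
def intDot {n : ℕ} (k : Fin n → ℤ) (x : Fin n → ℂ) : ℂ := ∑ i, (k i : ℂ) * x i

/-- The Fourier coefficient
`f_k(y) = (2π)⁻ⁿ ∫_{[0,2π]ⁿ} f(y,x) e^{-i k·x} dx`. -/
def coeff {n : ℕ} (f : Phase n → ℂ) (k : Fin n → ℤ) (y : Fin n → ℂ) : ℂ :=
  ((2 * (Real.pi : ℂ)) ^ n)⁻¹ *
    ∫ x in Set.Icc (0 : Fin n → ℝ) (fun _ => 2 * Real.pi),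
      f (y, fun i => (x i : ℂ)) * Complex.exp (-(Complex.I * intDot k (fun i => (x i : ℂ))))

/-- The weighted Fourier norm `sup_{y ∈ D_r} ∑_k |f_k(y)| e^{|k|₁ s}`, with values in `[0,∞]`. -/
def fourierNorm {n : ℕ} (D : Set (Fin n → ℝ)) (r s : ℝ) (f : Phase n → ℂ) : ℝ≥0∞ :=
  ⨆ y ∈ actionDomain D r,
    ∑' k : Fin n → ℤ, ENNReal.ofReal (‖coeff f k y‖ * Real.exp ((oneNorm k : ℝ) * s))

/-- The projection of `f` onto the Fourier modes in `S`: `∑_{k ∈ S} f_k(y) e^{i k·x}`. -/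
def modeProj {n : ℕ} (S : Set (Fin n → ℤ)) (f : Phase n → ℂ) : Phase n → ℂ :=
  fun p => ∑' k : S, coeff f (k : Fin n → ℤ) p.1 * Complex.exp (Complex.I * intDot k p.2)

/-- `P_Λ`. -/
def latticeProj {n : ℕ} (L : AddSubgroup (Fin n → ℤ)) (f : Phase n → ℂ) : Phase n → ℂ :=
  modeProj {k | k ∈ L} f

/-- `P_Λ^⊥`. -/
def latticeProjPerp {n : ℕ} (L : AddSubgroup (Fin n → ℤ)) (f : Phase n → ℂ) : Phase n → ℂ :=
  modeProj {k | k ∉ L} f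

/-- The truncation `T_N`, onto the modes with `|k|₁ ≤ N`. -/
def trunc {n : ℕ} (N : ℕ) (f : Phase n → ℂ) : Phase n → ℂ :=
  modeProj {k | oneNorm k ≤ N} f

/-- The high-mode operator `T_N^⊥`, onto the modes with `|k|₁ > N`. -/
def truncPerp {n : ℕ} (N : ℕ) (f : Phase n → ℂ) : Phase n → ℂ :=
  modeProj {k | N < oneNorm k} f

/-- `U` is `(α,K)` non-resonant modulo `Λ` with respect to `h`:
`|h'(y)·k| ≥ α` for all `y ∈ U` and all `k ∈ ℤⁿ \ Λ` with `|k|₁ ≤ K`. -/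
def NonResonant {n : ℕ} (h : (Fin n → ℂ) → ℂ) (α : ℝ) (K : ℕ) (L : AddSubgroup (Fin n → ℤ))
    (U : Set (Fin n → ℂ)) : Prop :=
  ∀ y ∈ U, ∀ k : Fin n → ℤ, k ∉ L → oneNorm k ≤ K → α ≤ ‖fderiv ℂ h y (fun i => (k i : ℂ))‖

/-- The standard symplectic form `dy ∧ dx = ∑ dy_i ∧ dx_i`. -/
def symplForm {n : ℕ} (u v : Phase n) : ℂ := ∑ i, (u.1 i * v.2 i - u.2 i * v.1 i)

/-- `Ψ : D_{r'} × 𝕋ⁿ_{s'} → D_r × 𝕋ⁿ_s` is a real-analytic symplectic change of variables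
(given by a lift). Since the derivative of `Ψ` preserves a nondegenerate form it is invertible, so
`Ψ`, being injective, is a biholomorphic map onto its (open) image. -/
structure SymplecticChange {n : ℕ} (D : Set (Fin n → ℝ)) (r' s' r s : ℝ)
    (Ψ : Phase n → Phase n) : Prop where
  mapsTo : Set.MapsTo Ψ (phaseDomain D r' s') (phaseDomain D r s)
  holomorphic : DifferentiableOn ℂ Ψ (phaseDomain D r' s')
  /-- `Ψ` is the lift of a map between the quotients by `2πℤⁿ`, homotopic to the identity in the
  angles. -/
  equivariant : ∀ p ∈ phaseDomain D r' s', ∀ k : Fin n → ℤ,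
    Ψ (p.1, p.2 + period k) = ((Ψ p).1, (Ψ p).2 + period k)
  real : ∀ p ∈ phaseDomain D r' s', IsRealVec p.1 → IsRealVec p.2 →
    IsRealVec (Ψ p).1 ∧ IsRealVec (Ψ p).2
  /-- By equivariance, injectivity of the lift is the same as injectivity on the quotient. -/
  injective : Set.InjOn Ψ (phaseDomain D r' s')
  symplectic : ∀ p ∈ phaseDomain D r' s', ∀ u v : Phase n,
    symplForm (fderiv ℂ Ψ p u) (fderiv ℂ Ψ p v) = symplForm u v

end AnalyticNormalForm

end

open AnalyticNormalForm

/-! The map `Ψ` is a composition of K + 1 time-one Hamiltonian flows. Each generator solves a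
homological equation: the part w of the perturbation with modes k ∉ Λ, |k|₁ ≤ K is divided mode by
mode by i h'(y)·k, of modulus at least α. To first order the flow then removes w, and what remains
are brackets of the generator with everything present: with f♭, with the remainders already
produced, and with w itself.

The small loss of analyticity comes from treating f♭ separately. A first flow is allowed to lose r/4
and s/(2K), and brings the remainder from ε = ‖f‖ down to θε/(8K). After that f♭ is never altered
and remains known on the original domain. Its brackets with later generators can therefore be
estimated with the fixed margins r/4 and s/(2K), although each later flow loses only r/(4K) and
s/(2K²). This saves a factor 1/K in the dangerous term, the bracket with the large function f♭, so
every later flow multiplies the non-resonant low part by at most θ/8. After K of them the losses add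
up to r/2 and s/K.

All estimates are made on families of Fourier coefficients a_k(y) in the weighted norm
(`FourierBdd`); Fourier inversion (`ev_coeff`) and orthogonality (`FourierBdd.coeff_ev`) translate
between families and functions. `FourierBdd.lie` estimates one bracket and `FourierBdd.lie_iterate`
its j-th iterate by j! times a geometric term, so Lie series converge. The flow is handled in two
ways, identified by `Generator.lieFlow_eq_curve`: as a Lie series it is visibly holomorphic,
periodic and real; as the solution of an ODE it has controlled range and displacement and is
injective, and its variational equation makes it symplectic. `Generator.comp_step` is the algebra of
one step, `IsNormalForm.step` its estimate, `exists_isNormalForm` the induction.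

The second form of the conclusion sorts modes by membership in Λ. The modes off Λ with |k|₁ ≤ K are
already of order (θ/8)^K, and those with |k|₁ > K become exponentially small on the strip of width
s/2. -/

noncomputable section

namespace AnalyticNormalForm

open Metric Set Filter Topology

/-! ### Holomorphic maps between normed spaces: Cauchy estimates, series, second derivatives. -/

section ComplexAnalysis

variable {E F : Type*} [NormedAddCommGroup E] [NormedSpace ℂ E] [NormedAddCommGroup F]
  [NormedSpace ℂ F]

theorem norm_fderiv_le_of_bound {f : E → F} {c : E} {R M : ℝ} (hR : 0 < R)
    (hd : DifferentiableOn ℂ f (ball c R)) (hM : ∀ z ∈ ball c R, ‖f z‖ ≤ M) :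
    ‖fderiv ℂ f c‖ ≤ 2 * M / R := by
  refine Complex.norm_fderiv_le_div_of_mapsTo_ball hd (fun z hz => ?_) hR
  rw [mem_closedBall, dist_eq_norm]
  have h1 := hM z hz
  have h2 := hM c (mem_ball_self hR)
  linarith [norm_sub_le (f z) (f c)]

/-- Cauchy estimates on balls of half the radius turn a summable bound on the functions into a
summable bound on their derivatives, which permits termwise differentiation. -/
theorem hasFDerivAt_tsum_of_bound [CompleteSpace F] {ι : Type*} {U : Set E} (hU : IsOpen U)
    {f : ι → E → F} {M : ι → ℝ} (hM : Summable M) (hf : ∀ i, DifferentiableOn ℂ (f i) U)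
    (hb : ∀ i, ∀ x ∈ U, ‖f i x‖ ≤ M i) {x : E} (hx : x ∈ U) :
    Summable (fun i => fderiv ℂ (f i) x) ∧
      HasFDerivAt (fun y => ∑' i, f i y) (∑' i, fderiv ℂ (f i) x) x := by
  obtain ⟨R, hR, hRU⟩ := Metric.isOpen_iff.1 hU x hx
  have hR2 : 0 < R / 2 := by linarith
  have hsub : ∀ y ∈ ball x (R / 2), ball y (R / 2) ⊆ U := fun y hy =>
    (ball_subset_ball' (by rw [mem_ball] at hy; linarith)).trans hRU
  have hbound : ∀ i, ∀ y ∈ ball x (R / 2), ‖fderiv ℂ (f i) y‖ ≤ 2 * M i / (R / 2) := fun i y hy =>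
    norm_fderiv_le_of_bound hR2 ((hf i).mono (hsub y hy)) fun z hz => hb i z (hsub y hy hz)
  have hs : Summable fun i => 2 * M i / (R / 2) := (hM.mul_left 2).div_const _
  have hx2 : x ∈ ball x (R / 2) := mem_ball_self hR2
  refine ⟨Summable.of_norm_bounded hs fun i => hbound i x hx2, ?_⟩
  let : NormedSpace ℝ E := NormedSpace.restrictScalars ℝ ℂ E
  refine hasFDerivAt_tsum_of_isPreconnected hs isOpen_ball
    ((convex_ball x (R / 2)).isPreconnected)
    (fun i y hy => (((hf i).differentiableAt (hU.mem_nhds ?_))).hasFDerivAt) hbound hx2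
    (Summable.of_norm_bounded hM fun i => hb i x hx) hx2
  exact hsub y hy (mem_ball_self hR2)

theorem differentiableOn_tsum_of_bound [CompleteSpace F] {ι : Type*} {U : Set E} (hU : IsOpen U)
    {f : ι → E → F} {M : ι → ℝ} (hM : Summable M) (hf : ∀ i, DifferentiableOn ℂ (f i) U)
    (hb : ∀ i, ∀ x ∈ U, ‖f i x‖ ≤ M i) : DifferentiableOn ℂ (fun y => ∑' i, f i y) U :=
  fun _ hx => (hasFDerivAt_tsum_of_bound hU hM hf hb hx).2.differentiableAt.differentiableWithinAt

/-- Schwarz lemma of second order for `f` minus its linear part. The constant 4 is an oscillation 2M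
of `f` plus 2M for the linear part, by Cauchy. -/
theorem norm_sub_fderiv_le {f : E → F} {c z : E} {R M : ℝ} (hR : 0 < R)
    (hd : DifferentiableOn ℂ f (ball c R)) (hM : ∀ z ∈ ball c R, ‖f z‖ ≤ M) (hz : z ∈ ball c R) :
    ‖f z - f c - fderiv ℂ f c (z - c)‖ ≤ 4 * M * (‖z - c‖ / R) ^ 2 := by
  set g : E → F := fun w => f w - fderiv ℂ f c (w - c) with hg
  have hc := mem_ball_self (x := c) hR
  have hfd := hd.differentiableAt (isOpen_ball.mem_nhds hc)
  have h1 : DifferentiableOn ℂ g (ball c R) := by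
    refine hd.sub ?_
    fun_prop
  have hmaps : MapsTo g (ball c R) (closedBall (g c) (4 * M)) := by
    intro w hw
    rw [mem_closedBall, dist_eq_norm]
    have e : g w - g c = (f w - f c) - fderiv ℂ f c (w - c) := by simp [hg]; abel
    rw [e]
    have h2 : ‖fderiv ℂ f c (w - c)‖ ≤ 2 * M / R * R := by
      refine (ContinuousLinearMap.le_opNorm _ _).trans ?_
      have h3 := norm_fderiv_le_of_bound hR hd hM
      have h4 : ‖w - c‖ ≤ R := by rw [← dist_eq_norm]; exact (mem_ball.1 hw).le
      have := norm_nonneg (fderiv ℂ f c)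
      gcongr
      linarith
    rw [div_mul_cancel₀ _ hR.ne'] at h2
    have := norm_sub_le (f w - f c) (fderiv ℂ f c (w - c))
    have := norm_sub_le (f w) (f c)
    have := hM w hw
    have := hM c hc
    linarith
  have hlit : (g · - g c) =o[𝓝 c] (fun w ↦ ‖w - c‖ ^ 1) := by
    have := hfd.hasFDerivAt.isLittleO
    simp only [pow_one]
    refine (this.norm_right).congr_left fun w => ?_
    simp [hg]; abel
  have key := Complex.dist_le_mul_div_pow_of_mapsTo_ball_of_isLittleO h1 hmaps hlit hz
  rw [dist_eq_norm, dist_eq_norm] at key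
  have e : g z - g c = f z - f c - fderiv ℂ f c (z - c) := by simp [hg]; abel
  rwa [e] at key

/-- A directional derivative is a locally uniform limit of difference quotients, the error at step t
being O(t) by `norm_sub_fderiv_le`. With the steps t0·2⁻ᵐ the limit becomes a telescoping series of
holomorphic maps with a summable bound. -/
theorem differentiableOn_fderiv_apply [CompleteSpace F] {U : Set E} (hU : IsOpen U) {f : E → F}
    (hf : DifferentiableOn ℂ f U) (v : E) :
    DifferentiableOn ℂ (fun y => fderiv ℂ f y v) U := by
  intro x hx
  refine DifferentiableAt.differentiableWithinAt ?_
  have hcont : ContinuousAt f x := (hf.differentiableAt (hU.mem_nhds hx)).continuousAt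
  have hev : ∀ᶠ z in 𝓝 x, z ∈ U ∧ ‖f z‖ < ‖f x‖ + 1 :=
    (hU.eventually_mem hx).and (hcont.norm.eventually_lt_const (by linarith))
  obtain ⟨d, hd, hdU⟩ := Metric.eventually_nhds_iff_ball.1 hev
  set δ := d / 3 with hδ
  have hδ0 : 0 < δ := by positivity
  set M := ‖f x‖ + 1
  have hsub : ∀ y ∈ ball x (2 * δ), ball y δ ⊆ ball x d := fun y hy =>
    ball_subset_ball' (by rw [mem_ball] at hy; linarith)
  have hdiff : DifferentiableOn ℂ f (ball x d) := hf.mono fun z hz => (hdU z hz).1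
  set t0 : ℝ := δ / (2 * (‖v‖ + 1)) with ht0
  have hv1 : 0 < ‖v‖ + 1 := by positivity
  have ht0p : 0 < t0 := by positivity
  set t : ℕ → ℝ := fun m => t0 * (1 / 2) ^ m with ht
  have htp : ∀ m, 0 < t m := fun m => by positivity
  have htle : ∀ m, t m * ‖v‖ < δ := by
    intro m
    have h1 : t m ≤ t0 := by
      have : ((1 : ℝ) / 2) ^ m ≤ 1 := pow_le_one₀ (by norm_num) (by norm_num)
      simp only [ht]; nlinarith
    calc t m * ‖v‖ ≤ t0 * ‖v‖ := by gcongr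
      _ ≤ t0 * (‖v‖ + 1) := by gcongr; linarith
      _ = δ / 2 := by rw [ht0]; field_simp
      _ < δ := by linarith
  have hmem : ∀ m, ∀ y, y + (t m : ℂ) • v ∈ ball y δ := by
    intro m y
    rw [mem_ball, dist_eq_norm, add_sub_cancel_left, norm_smul, Complex.norm_real,
      Real.norm_of_nonneg (htp m).le]
    exact htle m
  set G : ℕ → E → F := fun m y => (t m : ℂ)⁻¹ • (f (y + (t m : ℂ) • v) - f y) with hG
  have hGd : ∀ m, DifferentiableOn ℂ (G m) (ball x δ) := by
    intro m
    refine DifferentiableOn.const_smul (DifferentiableOn.sub ?_ ?_) _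
    · refine hdiff.comp (by fun_prop) fun y hy => ?_
      exact hsub y (ball_subset_ball (by linarith) hy) (hmem m y)
    · exact hdiff.mono (ball_subset_ball (by linarith))
  set Cc := 4 * M * (‖v‖ / δ) ^ 2 with hCc
  have hM0 : 0 ≤ M := by positivity
  have hC0 : 0 ≤ Cc := by positivity
  have hGlim : ∀ m, ∀ y ∈ ball x δ, ‖G m y - fderiv ℂ f y v‖ ≤ Cc * t m := by
    intro m y hy
    have hy2 := ball_subset_ball (by linarith : δ ≤ 2 * δ) hy
    have h1 := norm_sub_fderiv_le hδ0 (hdiff.mono (hsub y hy2))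
      (fun z hz => (hdU z (hsub y hy2 hz)).2.le) (hmem m y)
    have hne : (t m : ℂ) ≠ 0 := by exact_mod_cast (htp m).ne'
    have e : G m y - fderiv ℂ f y v = (t m : ℂ)⁻¹ • (f (y + (t m : ℂ) • v) - f y -
        fderiv ℂ f y (y + (t m : ℂ) • v - y)) := by
      rw [add_sub_cancel_left, map_smul, smul_sub, smul_smul, inv_mul_cancel₀ hne, one_smul]
    rw [e, norm_smul, norm_inv, Complex.norm_real, Real.norm_of_nonneg (htp m).le,
      add_sub_cancel_left]
    rw [add_sub_cancel_left, norm_smul, Complex.norm_real, Real.norm_of_nonneg (htp m).le] at h1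
    calc (t m)⁻¹ * _ ≤ (t m)⁻¹ * (4 * M * (t m * ‖v‖ / δ) ^ 2) := by
          have := (inv_pos.2 (htp m)).le
          gcongr
      _ = Cc * t m := by
          have := (htp m).ne'
          rw [hCc]; field_simp
  have hts : Summable fun m => Cc * t m + Cc * t m := by
    have : Summable t := (summable_geometric_of_lt_one (by norm_num) (by norm_num)).mul_left t0
    exact (this.mul_left Cc).add (this.mul_left Cc)
  have hdb : ∀ m, ∀ y ∈ ball x δ, ‖G (m + 1) y - G m y‖ ≤ Cc * t m + Cc * t m := by
    intro m y hy
    have h1 := hGlim m y hy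
    have h2 := hGlim (m + 1) y hy
    have h3 : t (m + 1) ≤ t m := by
      have := htp m
      simp only [ht] at this ⊢
      rw [pow_succ]; linarith
    have h4 : Cc * t (m + 1) ≤ Cc * t m := by gcongr
    calc ‖G (m + 1) y - G m y‖
        = ‖(G (m + 1) y - fderiv ℂ f y v) - (G m y - fderiv ℂ f y v)‖ := by congr 1; abel
      _ ≤ _ := (norm_sub_le _ _).trans (by linarith)
  have hsumd := differentiableOn_tsum_of_bound isOpen_ball hts
    (fun m => (hGd (m + 1)).sub (hGd m)) hdb
  have heq : ∀ y ∈ ball x δ, G 0 y + ∑' m, (G (m + 1) y - G m y) = fderiv ℂ f y v := by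
    intro y hy
    have hs : Summable fun m => G (m + 1) y - G m y :=
      Summable.of_norm_bounded hts fun m => hdb m y hy
    have hl := hs.hasSum.tendsto_sum_nat
    have ht2 : Tendsto (fun N => G N y) atTop (𝓝 (fderiv ℂ f y v)) := by
      rw [tendsto_iff_norm_sub_tendsto_zero]
      have hz : Tendsto (fun m => Cc * t m) atTop (𝓝 0) := by
        have := (tendsto_pow_atTop_nhds_zero_of_lt_one (r := (1 / 2 : ℝ)) (by norm_num)
          (by norm_num)).const_mul (Cc * t0)
        simpa [ht, mul_assoc] using this
      exact squeeze_zero (fun _ => norm_nonneg _) (fun m => hGlim m y hy) hz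
    have e : (fun N => ∑ m ∈ Finset.range N, (G (m + 1) y - G m y)) = fun N => G N y - G 0 y := by
      ext N; exact Finset.sum_range_sub (fun m => G m y) N
    rw [e] at hl
    have := tendsto_nhds_unique hl (ht2.sub_const _)
    rw [this]; abel
  have hfin : DifferentiableOn ℂ (fun y => fderiv ℂ f y v) (ball x δ) :=
    ((hGd 0).add hsumd).congr fun y hy => (heq y hy).symm
  exact hfin.differentiableAt (ball_mem_nhds x hδ0)

theorem contDiffOn_one_of_differentiableOn [FiniteDimensional ℂ E] [CompleteSpace F] {U : Set E}
    (hU : IsOpen U) {f : E → F} (hf : DifferentiableOn ℂ f U) : ContDiffOn ℂ 1 f U := by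
  rw [show (1 : WithTop ℕ∞) = 0 + 1 by simp, contDiffOn_succ_iff_fderiv_of_isOpen hU]
  refine ⟨hf, by simp, contDiffOn_clm_apply.2 fun v => ?_⟩
  exact contDiffOn_zero.2 (differentiableOn_fderiv_apply hU hf v).continuousOn

theorem contDiffOn_two_of_differentiableOn [FiniteDimensional ℂ E] [CompleteSpace F] {U : Set E}
    (hU : IsOpen U) {f : E → F} (hf : DifferentiableOn ℂ f U) : ContDiffOn ℂ 2 f U := by
  rw [show (2 : WithTop ℕ∞) = 1 + 1 by norm_num, contDiffOn_succ_iff_fderiv_of_isOpen hU]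
  refine ⟨hf, by simp, contDiffOn_clm_apply.2 fun v => ?_⟩
  exact contDiffOn_one_of_differentiableOn hU (differentiableOn_fderiv_apply hU hf v)

theorem fderiv_fderiv_apply_comm [FiniteDimensional ℂ E] [CompleteSpace F] {U : Set E}
    (hU : IsOpen U) {f : E → F} (hf : DifferentiableOn ℂ f U) {x : E} (hx : x ∈ U) (u v : E) :
    fderiv ℂ (fun y => fderiv ℂ f y u) x v = fderiv ℂ (fun y => fderiv ℂ f y v) x u := by
  have h2 : ContDiffAt ℂ 2 f x := (contDiffOn_two_of_differentiableOn hU hf).contDiffAt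
    (hU.mem_nhds hx)
  have hsym := h2.isSymmSndFDerivAt (by simp)
  have hd : DifferentiableAt ℂ (fderiv ℂ f) x :=
    (h2.fderiv_right (m := 1) (by norm_num)).differentiableAt (by simp)
  have e : ∀ w, fderiv ℂ (fun y => fderiv ℂ f y w) x = (fderiv ℂ (fderiv ℂ f) x).flip w := by
    intro w
    have := (hd.hasFDerivAt.clm_apply (hasFDerivAt_const w x)).fderiv
    rw [this]
    ext z; simp
  rw [e, e]
  simpa using hsym v u

/-- Cauchy's estimate on the unit-speed complex line through `y`, for a finite weighted sum of
moduli. -/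
theorem sum_mul_norm_fderiv_le {ι : Type*} (S : Finset ι) {U : Set E} (hU : IsOpen U)
    {a : ι → E → ℂ} (ha : ∀ k ∈ S, DifferentiableOn ℂ (a k) U) (w : ι → ℝ) (hw : ∀ k, 0 ≤ w k)
    {M ρ : ℝ} (hρ : 0 < ρ) {y v : E} (hyU : ∀ ζ : ℂ, ‖ζ‖ < ρ → y + ζ • v ∈ U)
    (hb : ∀ z ∈ U, ∑ k ∈ S, ‖a k z‖ * w k ≤ M) :
    ∑ k ∈ S, ‖fderiv ℂ (a k) y v‖ * w k ≤ M / ρ := by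
  have hy : y ∈ U := by simpa using hyU 0 (by simpa using hρ)
  have hunit : ∀ z : ℂ, ∃ c : ℂ, ‖c‖ ≤ 1 ∧ c * z = ‖z‖ := by
    intro z
    by_cases hz : z = 0
    · exact ⟨0, by simp, by simp [hz]⟩
    · refine ⟨(‖z‖ : ℂ) / z, ?_, by field_simp⟩
      rw [norm_div, Complex.norm_real, norm_norm, div_self (by simpa using hz)]
  choose c hc1 hc2 using hunit
  -- Multiplying each term by a phase that makes its derivative nonnegative turns the sum of moduli
  -- into the derivative at 0 of one scalar function, still bounded by M.
  set g : ℂ → ℂ := fun ζ => ∑ k ∈ S, c (fderiv ℂ (a k) y v) * (w k : ℂ) * a k (y + ζ • v) with hg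
  have hgd : DifferentiableOn ℂ g (ball 0 ρ) := by
    refine DifferentiableOn.fun_sum fun k hk => ?_
    refine DifferentiableOn.const_mul ((ha k hk).comp (by fun_prop) fun ζ hζ => ?_) _
    exact hyU ζ (by simpa using hζ)
  have hgb : ∀ ζ ∈ ball (0 : ℂ) ρ, ‖g ζ‖ ≤ M := by
    intro ζ hζ
    refine (norm_sum_le _ _).trans (le_trans (Finset.sum_le_sum fun k _ => ?_)
      (hb _ (hyU ζ (by simpa using hζ))))
    rw [norm_mul, norm_mul, Complex.norm_real, Real.norm_of_nonneg (hw k)]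
    have h1 := hc1 (fderiv ℂ (a k) y v)
    have h2 : 0 ≤ w k * ‖a k (y + ζ • v)‖ := mul_nonneg (hw k) (norm_nonneg _)
    nlinarith
  have hder : deriv g 0 = ((∑ k ∈ S, ‖fderiv ℂ (a k) y v‖ * w k : ℝ) : ℂ) := by
    have h1 : ∀ k ∈ S, HasDerivAt (fun ζ : ℂ => c (fderiv ℂ (a k) y v) * (w k : ℂ) *
        a k (y + ζ • v)) (c (fderiv ℂ (a k) y v) * (w k : ℂ) * fderiv ℂ (a k) y v) 0 := by
      intro k hk
      refine HasDerivAt.const_mul _ ?_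
      have h2 : HasFDerivAt (a k) (fderiv ℂ (a k) y) (y + (0 : ℂ) • v) := by
        simpa using ((ha k hk).differentiableAt (hU.mem_nhds hy)).hasFDerivAt
      have h3 : HasDerivAt (fun ζ : ℂ => y + ζ • v) v 0 := by
        simpa using ((hasDerivAt_id (0 : ℂ)).smul_const v).const_add y
      exact h2.comp_hasDerivAt 0 h3
    rw [(HasDerivAt.fun_sum h1).deriv]
    push_cast
    refine Finset.sum_congr rfl fun k _ => ?_
    rw [← hc2]; ring
  have hcauchy : ∀ R, 0 < R → R < ρ → ‖deriv g 0‖ ≤ M / R := by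
    intro R hR hRρ
    refine Complex.norm_deriv_le_of_forall_mem_sphere_norm_le hR ?_ fun z hz => hgb z ?_
    · exact (hgd.mono (closedBall_subset_ball hRρ)).diffContOnCl_ball Subset.rfl
    · exact closedBall_subset_ball hRρ (sphere_subset_closedBall hz)
  have hn : ‖deriv g 0‖ = ∑ k ∈ S, ‖fderiv ℂ (a k) y v‖ * w k := by
    rw [hder, Complex.norm_real, Real.norm_of_nonneg]
    exact Finset.sum_nonneg fun k _ => mul_nonneg (norm_nonneg _) (hw k)
  rw [← hn]
  have hlim : Tendsto (fun R => M / R) (𝓝[<] ρ) (𝓝 (M / ρ)) :=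
    ((continuousAt_const.div continuousAt_id hρ.ne').tendsto).mono_left nhdsWithin_le_nhds
  refine ge_of_tendsto hlim ?_
  filter_upwards [Ioo_mem_nhdsLT hρ] with R hR using hcauchy R hR.1 hR.2

end ComplexAnalysis

/-! ### Coefficient families, their weighted norm and the functions they define. -/

section Families

variable {n : ℕ}

/-- Families of Fourier coefficients `a_k(y)`. -/
abbrev Coeffs (n : ℕ) : Type := (Fin n → ℤ) → (Fin n → ℂ) → ℂ

/-- An integer vector as an element of `ℂⁿ`. -/
def intVec (k : Fin n → ℤ) : Fin n → ℂ := fun i => (k i : ℂ)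

/-- The function `∑_k a_k(y) e^{i k·x}`. -/
def ev (a : Coeffs n) : Phase n → ℂ :=
  fun p => ∑' k, a k p.1 * Complex.exp (Complex.I * intDot k p.2)

/-! ### Integer vectors and exponentials -/

theorem oneNorm_neg (k : Fin n → ℤ) : oneNorm (-k) = oneNorm k := by simp [oneNorm]

theorem oneNorm_add_le (k l : Fin n → ℤ) : oneNorm (k + l) ≤ oneNorm k + oneNorm l := by
  rw [oneNorm, oneNorm, oneNorm, ← Finset.sum_add_distrib]
  exact Finset.sum_le_sum fun i _ => Int.natAbs_add_le _ _

theorem sum_norm_intVec (k : Fin n → ℤ) : ∑ i, ‖(k i : ℂ)‖ = oneNorm k := by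
  simp [oneNorm, Complex.norm_intCast, Nat.cast_natAbs]

theorem norm_toLp_le_sum (v : Fin n → ℂ) : ‖WithLp.toLp 2 v‖ ≤ ∑ i, ‖v i‖ := by
  rw [EuclideanSpace.norm_eq, Real.sqrt_le_left (Finset.sum_nonneg fun i _ => norm_nonneg _)]
  exact Finset.sum_sq_le_sq_sum_of_nonneg fun i _ => norm_nonneg _

theorem norm_toLp_intVec_le (k : Fin n → ℤ) : ‖WithLp.toLp 2 (intVec k)‖ ≤ oneNorm k := by
  rw [← sum_norm_intVec]; exact norm_toLp_le_sum _

theorem intDot_add_left (k l : Fin n → ℤ) (x : Fin n → ℂ) :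
    intDot (k + l) x = intDot k x + intDot l x := by
  simp [intDot, add_mul, Finset.sum_add_distrib]

theorem intDot_neg_left (k : Fin n → ℤ) (x : Fin n → ℂ) : intDot (-k) x = -intDot k x := by
  simp [intDot]

theorem norm_exp_intDot_le {k : Fin n → ℤ} {x : Fin n → ℂ} {s : ℝ} (hx : ∀ i, |(x i).im| ≤ s) :
    ‖Complex.exp (Complex.I * intDot k x)‖ ≤ Real.exp (oneNorm k * s) := by
  rw [Complex.norm_exp, Real.exp_le_exp]
  have h1 : (Complex.I * intDot k x).re = -∑ i, (k i : ℝ) * (x i).im := by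
    simp [intDot]
  rw [h1, ← Finset.sum_neg_distrib, oneNorm, Nat.cast_sum, Finset.sum_mul]
  refine Finset.sum_le_sum fun i _ => ?_
  rw [Nat.cast_natAbs, Int.cast_abs]
  calc -((k i : ℝ) * (x i).im) ≤ |(k i : ℝ) * (x i).im| := neg_le_abs _
    _ = |(k i : ℝ)| * |(x i).im| := abs_mul _ _
    _ ≤ _ := by gcongr; exact hx i

theorem exp_intDot_period (k l : Fin n → ℤ) (x : Fin n → ℂ) :
    Complex.exp (Complex.I * intDot k (x + period l)) = Complex.exp (Complex.I * intDot k x) := by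
  rw [Complex.exp_eq_exp_iff_exists_int]
  refine ⟨∑ i, k i * l i, ?_⟩
  simp only [intDot, period, Pi.add_apply, mul_add, Finset.sum_add_distrib]
  push_cast
  rw [Finset.sum_mul, Finset.mul_sum (f := fun i => (k i : ℂ) * (2 * Real.pi * l i))]
  congr 1
  exact Finset.sum_congr rfl fun i _ => by ring

/-- The weight is a product of one-variable weights, so a finite sum, enlarged to a sum over a cube,
factors into geometric sums. -/
theorem summable_exp_neg_oneNorm {δ : ℝ} (hδ : 0 < δ) :
    Summable fun k : Fin n → ℤ => Real.exp (-(oneNorm k * δ)) := by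
  have h1 : Summable fun m : ℤ => Real.exp (-((m.natAbs : ℝ) * δ)) := by
    have hg : Summable fun m : ℕ => Real.exp (-((m : ℝ) * δ)) := by
      have := summable_geometric_of_lt_one (Real.exp_pos (-δ)).le
        (by rw [Real.exp_lt_one_iff]; linarith)
      refine this.congr fun m => ?_
      rw [← Real.exp_nat_mul]; congr 1; ring
    refine Summable.of_nat_of_neg ?_ ?_
    · simpa using hg
    · simpa using hg
  set S := ∑' m : ℤ, Real.exp (-((m.natAbs : ℝ) * δ))
  refine summable_of_sum_le (c := S ^ n) (fun k => (Real.exp_pos _).le) fun F => ?_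
  classical
  set B : Finset ℤ := F.biUnion fun k => Finset.univ.image k
  have hsub : F ⊆ Fintype.piFinset fun _ : Fin n => B := by
    intro k hk
    rw [Fintype.mem_piFinset]
    intro i
    exact Finset.mem_biUnion.2 ⟨k, hk, Finset.mem_image_of_mem _ (Finset.mem_univ i)⟩
  calc ∑ k ∈ F, Real.exp (-(oneNorm k * δ))
      ≤ ∑ k ∈ Fintype.piFinset fun _ : Fin n => B, Real.exp (-(oneNorm k * δ)) :=
        Finset.sum_le_sum_of_subset_of_nonneg hsub fun _ _ _ => (Real.exp_pos _).le
    _ = ∑ k ∈ Fintype.piFinset fun _ : Fin n => B, ∏ i, Real.exp (-(((k i).natAbs : ℝ) * δ)) := by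
        refine Finset.sum_congr rfl fun k _ => ?_
        rw [← Real.exp_sum, oneNorm]
        push_cast
        rw [Finset.sum_mul, Finset.sum_neg_distrib]
    _ = ∏ _i : Fin n, ∑ m ∈ B, Real.exp (-((m.natAbs : ℝ) * δ)) :=
        (Finset.prod_univ_sum (fun _ : Fin n => B)
          fun _ m => Real.exp (-((m.natAbs : ℝ) * δ))).symm
    _ ≤ S ^ n := by
        rw [Finset.prod_const, Finset.card_univ, Fintype.card_fin]
        refine pow_le_pow_left₀ (Finset.sum_nonneg fun _ _ => (Real.exp_pos _).le) ?_ n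
        exact h1.sum_le_tsum _ fun _ _ => (Real.exp_pos _).le

/-! ### Domains -/

theorem actionDomain_mono {D : Set (Fin n → ℝ)} {r r' : ℝ} (h : r' ≤ r) :
    actionDomain D r' ⊆ actionDomain D r := fun _ ⟨y, hy, hz⟩ => ⟨y, hy, hz.trans_le h⟩

theorem angleStrip_mono {s s' : ℝ} (h : s' ≤ s) : angleStrip n s' ⊆ angleStrip n s :=
  fun _ hx i => (hx i).trans_le h

theorem phaseDomain_mono {D : Set (Fin n → ℝ)} {r r' s s' : ℝ} (h : r' ≤ r) (h' : s' ≤ s) :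
    phaseDomain D r' s' ⊆ phaseDomain D r s :=
  prod_mono (actionDomain_mono h) (angleStrip_mono h')

theorem add_mem_actionDomain {D : Set (Fin n → ℝ)} {r r' ρ : ℝ} {y v : Fin n → ℂ}
    (hy : y ∈ actionDomain D r') (hv : ‖WithLp.toLp 2 v‖ ≤ ρ) (h : r' + ρ ≤ r) :
    y + v ∈ actionDomain D r := by
  obtain ⟨y0, hy0, hlt⟩ := hy
  refine ⟨y0, hy0, ?_⟩
  have e : WithLp.toLp 2 (fun i => (y + v) i - (y0 i : ℂ)) =
      WithLp.toLp 2 (fun i => y i - (y0 i : ℂ)) + WithLp.toLp 2 v := by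
    ext i; simp; ring
  rw [e]
  refine (norm_add_le _ _).trans_lt ?_
  linarith

theorem add_mem_angleStrip {s s' σ : ℝ} {x v : Fin n → ℂ}
    (hx : x ∈ angleStrip n s') (hv : ∀ i, ‖v i‖ ≤ σ) (h : s' + σ ≤ s) :
    x + v ∈ angleStrip n s := by
  intro i
  have h1 := hx i
  have h2 := (Complex.abs_im_le_norm (v i)).trans (hv i)
  rw [Pi.add_apply, Complex.add_im]
  refine (abs_add_le _ _).trans_lt ?_
  linarith

theorem isOpen_actionDomain (D : Set (Fin n → ℝ)) (r : ℝ) : IsOpen (actionDomain D r) := by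
  have : actionDomain D r = ⋃ y ∈ D,
      {z : Fin n → ℂ | ‖WithLp.toLp 2 (fun i => z i - (y i : ℂ))‖ < r} := by
    ext z; simp [actionDomain]
  rw [this]
  refine isOpen_biUnion fun y _ => isOpen_lt ?_ continuous_const
  refine Continuous.norm ?_
  exact (PiLp.continuous_toLp 2 _).comp (by fun_prop)

theorem isOpen_angleStrip (s : ℝ) : IsOpen (angleStrip n s) := by
  have : angleStrip n s = ⋂ i, {x : Fin n → ℂ | |(x i).im| < s} := by
    ext z; simp [angleStrip]
  rw [this]
  refine isOpen_iInter_of_finite fun i => isOpen_lt ?_ continuous_const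
  exact (Complex.continuous_im.comp (continuous_apply i)).abs

theorem isOpen_phaseDomain (D : Set (Fin n → ℝ)) (r s : ℝ) : IsOpen (phaseDomain D r s) :=
  (isOpen_actionDomain D r).prod (isOpen_angleStrip s)

theorem exists_lt_mem_angleStrip {s : ℝ} {x : Fin n → ℂ} (hs : 0 < s) (hx : x ∈ angleStrip n s) :
    ∃ s', 0 < s' ∧ s' < s ∧ x ∈ angleStrip n s' := by
  have h : ∀ᶠ s' in 𝓝[<] s, 0 < s' ∧ s' < s ∧ x ∈ angleStrip n s' := by
    refine (eventually_nhdsWithin_of_eventually_nhds (lt_mem_nhds hs)).and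
      ((eventually_mem_nhdsWithin).and ?_)
    have : ∀ i, ∀ᶠ s' in 𝓝[<] s, |(x i).im| < s' := fun i =>
      eventually_nhdsWithin_of_eventually_nhds (lt_mem_nhds (hx i))
    exact eventually_all.2 this
  exact h.exists

/-! ### Families bounded in the weighted norm -/

/-- `a` is holomorphic on `D_r` and `∑_k |a_k(y)| e^{|k|₁ s} ≤ M` for `y ∈ D_r`. -/
structure FourierBdd (D : Set (Fin n → ℝ)) (r s M : ℝ) (a : Coeffs n) : Prop where
  nonneg : 0 ≤ M
  holo : ∀ k, DifferentiableOn ℂ (a k) (actionDomain D r)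
  bound : ∀ y ∈ actionDomain D r, ∀ F : Finset (Fin n → ℤ),
    ∑ k ∈ F, ‖a k y‖ * Real.exp (oneNorm k * s) ≤ M

/-- Coefficients of functions that are real at real points. -/
def ConjSymm (D : Set (Fin n → ℝ)) (r : ℝ) (a : Coeffs n) : Prop :=
  ∀ y ∈ actionDomain D r, IsRealVec y → ∀ k, (starRingEnd ℂ) (a k y) = a (-k) y

open Classical in
/-- The part of a family with modes in `T`. -/
def restr (T : Set (Fin n → ℤ)) (a : Coeffs n) : Coeffs n := fun k y => if k ∈ T then a k y else 0

section Bdd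

variable {D : Set (Fin n → ℝ)} {r s M M' : ℝ} {a b : Coeffs n}

theorem FourierBdd.mono {r' s' : ℝ} (h : FourierBdd D r s M a) (hr : r' ≤ r) (hs : s' ≤ s)
    (hM : M ≤ M') : FourierBdd D r' s' M' a where
  nonneg := h.nonneg.trans hM
  holo k := (h.holo k).mono (actionDomain_mono hr)
  bound y hy F := by
    refine le_trans (Finset.sum_le_sum fun k _ => ?_)
      ((h.bound y (actionDomain_mono hr hy) F).trans hM)
    gcongr

theorem FourierBdd.add (ha : FourierBdd D r s M a) (hb : FourierBdd D r s M' b) :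
    FourierBdd D r s (M + M') (a + b) where
  nonneg := add_nonneg ha.nonneg hb.nonneg
  holo k := (ha.holo k).add (hb.holo k)
  bound y hy F := by
    refine le_trans ?_ (add_le_add (ha.bound y hy F) (hb.bound y hy F))
    rw [← Finset.sum_add_distrib]
    refine Finset.sum_le_sum fun k _ => ?_
    rw [← add_mul]
    gcongr
    exact norm_add_le _ _

theorem FourierBdd.neg (ha : FourierBdd D r s M a) : FourierBdd D r s M (-a) where
  nonneg := ha.nonneg
  holo k := (ha.holo k).neg
  bound y hy F := by simpa using ha.bound y hy F

theorem FourierBdd.sub (ha : FourierBdd D r s M a) (hb : FourierBdd D r s M' b) :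
    FourierBdd D r s (M + M') (a - b) := by
  rw [sub_eq_add_neg]; exact ha.add hb.neg

theorem FourierBdd.restr (ha : FourierBdd D r s M a) (T : Set (Fin n → ℤ)) :
    FourierBdd D r s M (restr T a) where
  nonneg := ha.nonneg
  holo k := by
    by_cases h : k ∈ T
    · have : AnalyticNormalForm.restr T a k = a k := by
        ext y; simp [AnalyticNormalForm.restr, h]
      rw [this]; exact ha.holo k
    · have : AnalyticNormalForm.restr T a k = fun _ => 0 := by
        ext y; simp [AnalyticNormalForm.restr, h]
      rw [this]; exact differentiableOn_const _
  bound y hy F := by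
    refine le_trans (Finset.sum_le_sum fun k _ => ?_) (ha.bound y hy F)
    gcongr
    rw [AnalyticNormalForm.restr]
    split_ifs
    · exact le_rfl
    · simp

theorem FourierBdd.norm_le (ha : FourierBdd D r s M a) {y : Fin n → ℂ} (hy : y ∈ actionDomain D r)
    (k : Fin n → ℤ) : ‖a k y‖ ≤ M * Real.exp (-(oneNorm k * s)) := by
  have := ha.bound y hy {k}
  rw [Finset.sum_singleton] at this
  rw [Real.exp_neg, ← div_eq_mul_inv, le_div_iff₀ (Real.exp_pos _)]
  exact this

theorem FourierBdd.norm_term_le (ha : FourierBdd D r s M a) {s' : ℝ} {p : Phase n}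
    (hp : p ∈ phaseDomain D r s') (k : Fin n → ℤ) :
    ‖a k p.1 * Complex.exp (Complex.I * intDot k p.2)‖ ≤
      M * Real.exp (-(oneNorm k * (s - s'))) := by
  rw [norm_mul]
  have h1 := ha.norm_le hp.1 k
  have h2 := norm_exp_intDot_le (k := k) fun i => (hp.2 i).le
  calc _ ≤ M * Real.exp (-(oneNorm k * s)) * Real.exp (oneNorm k * s') :=
        mul_le_mul h1 h2 (norm_nonneg _) ((norm_nonneg _).trans h1)
    _ = _ := by rw [mul_assoc, ← Real.exp_add]; congr 2; ring

theorem FourierBdd.summable_term (ha : FourierBdd D r s M a) {p : Phase n}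
    (hp : p ∈ phaseDomain D r s) :
    Summable (fun k => a k p.1 * Complex.exp (Complex.I * intDot k p.2)) := by
  refine Summable.of_norm (summable_of_sum_le (c := M) (fun _ => norm_nonneg _) fun F => ?_)
  refine le_trans (Finset.sum_le_sum fun k _ => ?_) (ha.bound p.1 hp.1 F)
  rw [norm_mul]
  gcongr
  exact norm_exp_intDot_le fun i => (hp.2 i).le

theorem FourierBdd.hasSum_ev (ha : FourierBdd D r s M a) {p : Phase n}
    (hp : p ∈ phaseDomain D r s) :
    HasSum (fun k => a k p.1 * Complex.exp (Complex.I * intDot k p.2)) (ev a p) :=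
  (ha.summable_term hp).hasSum

theorem FourierBdd.norm_ev_le (ha : FourierBdd D r s M a) {p : Phase n}
    (hp : p ∈ phaseDomain D r s) : ‖ev a p‖ ≤ M := by
  have h1 := (ha.hasSum_ev hp)
  refine le_of_tendsto h1.norm (Eventually.of_forall fun F => ?_)
  refine (norm_sum_le _ _).trans (le_trans (Finset.sum_le_sum fun k _ => ?_)
    (ha.bound p.1 hp.1 F))
  rw [norm_mul]
  gcongr
  exact norm_exp_intDot_le fun i => (hp.2 i).le

theorem hasFDerivAt_term {k : Fin n → ℤ} {p : Phase n} (ha : DifferentiableAt ℂ (a k) p.1) :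
    HasFDerivAt (fun q : Phase n => a k q.1 * Complex.exp (Complex.I * intDot k q.2))
      (a k p.1 • (Complex.exp (Complex.I * intDot k p.2) • (Complex.I •
        ∑ i, (k i : ℂ) • (ContinuousLinearMap.proj i).comp
          (ContinuousLinearMap.snd ℂ (Fin n → ℂ) (Fin n → ℂ)))) +
        Complex.exp (Complex.I * intDot k p.2) • (fderiv ℂ (a k) p.1).comp
          (ContinuousLinearMap.fst ℂ (Fin n → ℂ) (Fin n → ℂ))) p := by
  have h1 : HasFDerivAt (fun q : Phase n => a k q.1) _ p :=
    ha.hasFDerivAt.comp p hasFDerivAt_fst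
  have h2 : HasFDerivAt (fun q : Phase n => intDot k q.2)
      (∑ i, (k i : ℂ) • (ContinuousLinearMap.proj i).comp
          (ContinuousLinearMap.snd ℂ (Fin n → ℂ) (Fin n → ℂ))) p := by
    unfold intDot
    refine HasFDerivAt.fun_sum fun i _ => HasFDerivAt.const_mul ?_ _
    exact ((ContinuousLinearMap.proj i).comp
          (ContinuousLinearMap.snd ℂ (Fin n → ℂ) (Fin n → ℂ))).hasFDerivAt
  exact h1.mul ((h2.const_mul Complex.I).cexp)

theorem FourierBdd.differentiableOn_term (ha : FourierBdd D r s M a) (k : Fin n → ℤ) (s' : ℝ) :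
    DifferentiableOn ℂ (fun q : Phase n => a k q.1 * Complex.exp (Complex.I * intDot k q.2))
      (phaseDomain D r s') := fun p hp =>
  (hasFDerivAt_term ((ha.holo k).differentiableAt
    ((isOpen_actionDomain D r).mem_nhds hp.1))).differentiableAt.differentiableWithinAt

/-- Every point of the strip lies in a narrower strip of width s' < s, where the terms are dominated
by M e^(-|k|₁(s-s')); the series can be differentiated termwise there. -/
theorem FourierBdd.hasFDerivAt_ev (ha : FourierBdd D r s M a) (hs : 0 < s) {p : Phase n}
    (hp : p ∈ phaseDomain D r s) :
    DifferentiableAt ℂ (ev a) p ∧ ∀ u : Phase n,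
      HasSum (fun k => (fderiv ℂ (a k) p.1 u.1 + Complex.I * intDot k u.2 * a k p.1) *
        Complex.exp (Complex.I * intDot k p.2)) (fderiv ℂ (ev a) p u) := by
  obtain ⟨s', hs'0, hs', hps'⟩ := exists_lt_mem_angleStrip hs hp.2
  have hsum : Summable fun k : Fin n → ℤ => M * Real.exp (-(oneNorm k * (s - s'))) :=
    (summable_exp_neg_oneNorm (by linarith)).mul_left M
  obtain ⟨h1, h2⟩ := hasFDerivAt_tsum_of_bound (isOpen_phaseDomain D r s') hsum
    (fun k => ha.differentiableOn_term k s') (fun k _ hq => ha.norm_term_le hq k)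
    (x := p) ⟨hp.1, hps'⟩
  have h2' : HasFDerivAt (ev a) _ p := h2
  refine ⟨h2'.differentiableAt, fun u => ?_⟩
  rw [h2'.fderiv]
  have h3 := h1.hasSum.mapL (ContinuousLinearMap.apply ℂ ℂ u)
  simp only [ContinuousLinearMap.apply_apply] at h3
  convert! h3 using 2 with k
  rw [(hasFDerivAt_term ((ha.holo k).differentiableAt
    ((isOpen_actionDomain D r).mem_nhds hp.1))).fderiv]
  simp [intDot]
  ring

theorem FourierBdd.differentiableOn_ev (ha : FourierBdd D r s M a) (hs : 0 < s) :
    DifferentiableOn ℂ (ev a) (phaseDomain D r s) := fun _ hp =>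
  (ha.hasFDerivAt_ev hs hp).1.differentiableWithinAt

theorem ev_add_period (a : Coeffs n) (p : Phase n) (k : Fin n → ℤ) :
    ev a (p.1, p.2 + period k) = ev a p := by
  simp only [ev, exp_intDot_period]

theorem conj_exp_intDot {x : Fin n → ℂ} (hx : IsRealVec x) (k : Fin n → ℤ) :
    (starRingEnd ℂ) (Complex.exp (Complex.I * intDot k x)) =
      Complex.exp (Complex.I * intDot (-k) x) := by
  rw [← Complex.exp_conj, map_mul, Complex.conj_I, intDot_neg_left, intDot, map_sum]
  congr 1
  have : ∀ i, (starRingEnd ℂ) (x i) = x i := fun i => Complex.conj_eq_iff_im.2 (hx i)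
  simp [this]

theorem ConjSymm.ev_im (ha : ConjSymm D r a) {p : Phase n} (hp : p.1 ∈ actionDomain D r)
    (h1 : IsRealVec p.1) (h2 : IsRealVec p.2) : (ev a p).im = 0 := by
  rw [← Complex.conj_eq_iff_im, ev, Complex.conj_tsum, ← (Equiv.neg _).tsum_eq]
  refine tsum_congr fun k => ?_
  rw [map_mul, conj_exp_intDot h2, ha _ hp h1]
  simp

theorem FourierBdd.realAnalyticPhase (ha : FourierBdd D r s M a) (hs : 0 < s)
    (hc : ConjSymm D r a) : RealAnalyticPhase D r s (ev a) where
  holomorphic := ha.differentiableOn_ev hs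
  periodic _ _ _ := ev_add_period a _ _
  real _ hp h1 h2 := hc.ev_im hp.1 h1 h2

theorem ConjSymm.mono {r' : ℝ} (ha : ConjSymm D r a) (h : r' ≤ r) : ConjSymm D r' a :=
  fun y hy hr k => ha y (actionDomain_mono h hy) hr k

theorem ConjSymm.add (ha : ConjSymm D r a) (hb : ConjSymm D r b) : ConjSymm D r (a + b) :=
  fun y hy hr k => by simp [ha y hy hr k, hb y hy hr k]

theorem ConjSymm.sub (ha : ConjSymm D r a) (hb : ConjSymm D r b) : ConjSymm D r (a - b) :=
  fun y hy hr k => by simp [ha y hy hr k, hb y hy hr k]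

theorem ConjSymm.restr (ha : ConjSymm D r a) {T : Set (Fin n → ℤ)} (hT : ∀ k, -k ∈ T ↔ k ∈ T) :
    ConjSymm D r (restr T a) := fun y hy hr k => by
  by_cases h : k ∈ T
  · simp [AnalyticNormalForm.restr, h, (hT k).2 h, ha y hy hr k]
  · have h' : -k ∉ T := fun h' => h ((hT k).1 h')
    simp [AnalyticNormalForm.restr, h, h']

theorem FourierBdd.ev_add (ha : FourierBdd D r s M a) (hb : FourierBdd D r s M' b) {p : Phase n}
    (hp : p ∈ phaseDomain D r s) : ev (a + b) p = ev a p + ev b p := by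
  have := (ha.hasSum_ev hp).add (hb.hasSum_ev hp)
  rw [← this.tsum_eq]
  exact tsum_congr fun k => by simp [add_mul]

theorem ev_neg (a : Coeffs n) (p : Phase n) : ev (-a) p = -ev a p := by
  simp [ev, tsum_neg]

theorem FourierBdd.ev_sub (ha : FourierBdd D r s M a) (hb : FourierBdd D r s M' b) {p : Phase n}
    (hp : p ∈ phaseDomain D r s) : ev (a - b) p = ev a p - ev b p := by
  rw [sub_eq_add_neg, ha.ev_add hb.neg hp, ev_neg, sub_eq_add_neg]

theorem restr_add_restr_compl (T : Set (Fin n → ℤ)) (a : Coeffs n) :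
    restr T a + restr Tᶜ a = a := by
  ext k y
  by_cases h : k ∈ T <;> simp [restr, h]

/-! ### Series of families -/

/-- The coefficientwise sum of a series of families. -/
def sumFamily (c : ℕ → Coeffs n) : Coeffs n := fun k y => ∑' j, c j k y

variable {c : ℕ → Coeffs n} {m : ℕ → ℝ}

theorem FourierBdd.sumFamily (hc : ∀ j, FourierBdd D r s (m j) (c j)) (hm : Summable m) :
    FourierBdd D r s (∑' j, m j) (sumFamily c) where
  nonneg := tsum_nonneg fun j => (hc j).nonneg
  holo k := by
    refine differentiableOn_tsum_of_bound (isOpen_actionDomain D r)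
      (hm.mul_right (Real.exp (-(oneNorm k * s)))) (fun j => (hc j).holo k) fun j y hy => ?_
    exact (hc j).norm_le hy k
  bound y hy F := by
    have hsn : ∀ k, Summable fun j => ‖c j k y‖ := fun k =>
      Summable.of_nonneg_of_le (fun _ => norm_nonneg _) (fun j => (hc j).norm_le hy k)
        (hm.mul_right (Real.exp (-(oneNorm k * s))))
    calc ∑ k ∈ F, ‖∑' j, c j k y‖ * Real.exp (oneNorm k * s)
        ≤ ∑ k ∈ F, (∑' j, ‖c j k y‖) * Real.exp (oneNorm k * s) := by
          gcongr with k
          exact norm_tsum_le_tsum_norm (hsn k)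
      _ = ∑ k ∈ F, ∑' j, ‖c j k y‖ * Real.exp (oneNorm k * s) := by
          simp_rw [tsum_mul_right]
      _ = ∑' j, ∑ k ∈ F, ‖c j k y‖ * Real.exp (oneNorm k * s) :=
          (Summable.tsum_finsetSum fun k _ => (hsn k).mul_right _).symm
      _ ≤ ∑' j, m j := by
          refine Summable.tsum_le_tsum (fun j => (hc j).bound y hy F) ?_ hm
          exact summable_sum fun k _ => (hsn k).mul_right _

/-- Absolute summability over pairs (j, k) permits the interchange of the two sums. -/
theorem FourierBdd.hasSum_ev_sumFamily (hc : ∀ j, FourierBdd D r s (m j) (c j)) (hm : Summable m)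
    {p : Phase n} (hp : p ∈ phaseDomain D r s) :
    HasSum (fun j => ev (c j) p) (ev (AnalyticNormalForm.sumFamily c) p) := by
  set t : ℕ → (Fin n → ℤ) → ℂ := fun j k => c j k p.1 * Complex.exp (Complex.I * intDot k p.2)
  have hnorm : ∀ j, Summable fun k => ‖t j k‖ := fun j => ((hc j).summable_term hp).norm
  have hle : ∀ j, ∑' k, ‖t j k‖ ≤ m j := by
    intro j
    refine (hnorm j).tsum_le_of_sum_le fun F => ?_
    refine le_trans (Finset.sum_le_sum fun k _ => ?_) ((hc j).bound p.1 hp.1 F)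
    rw [norm_mul]
    gcongr
    exact norm_exp_intDot_le fun i => (hp.2 i).le
  have h2 : Summable fun x : ℕ × (Fin n → ℤ) => ‖t x.1 x.2‖ :=
    (summable_prod_of_nonneg fun _ => norm_nonneg _).2 ⟨hnorm, Summable.of_nonneg_of_le
      (fun j => tsum_nonneg fun _ => norm_nonneg _) hle hm⟩
  have h3 : Summable fun x : ℕ × (Fin n → ℤ) => t x.1 x.2 := h2.of_norm
  have h5 : HasSum (fun j => ∑' k, t j k) (∑' x : ℕ × (Fin n → ℤ), t x.1 x.2) :=
    h3.hasSum.prod_fiberwise fun j => (hnorm j).of_norm.hasSum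
  have h6 : ∑' x : ℕ × (Fin n → ℤ), t x.1 x.2 = ∑' k, ∑' j, t j k := by
    have h7 : Summable (Function.uncurry t) := h3
    rw [h3.tsum_prod, h7.tsum_comm]
  rw [h6] at h5
  convert! h5 using 1
  refine tsum_congr fun k => ?_
  rw [AnalyticNormalForm.sumFamily, ← tsum_mul_right]

theorem ConjSymm.sumFamily (hc : ∀ j, ConjSymm D r (c j)) : ConjSymm D r (sumFamily c) :=
  fun y hy hr k => by
    rw [AnalyticNormalForm.sumFamily, Complex.conj_tsum]
    exact tsum_congr fun j => hc j y hy hr k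

end Bdd

end Families

/-! ### Fourier integrals: orthogonality, norms, analyticity in the actions. -/

section FourierCoefficients

open MeasureTheory

variable {n : ℕ} {D : Set (Fin n → ℝ)} {r s M : ℝ}

/-! ### Fourier coefficients of absolutely convergent Fourier series -/

/-- A real vector as an element of `ℂⁿ`. -/
def ofRealVec (x : Fin n → ℝ) : Fin n → ℂ := fun i => (x i : ℂ)

/-- The cube `[0,2π]ⁿ`. -/
def cube (n : ℕ) : Set (Fin n → ℝ) := Icc (0 : Fin n → ℝ) (fun _ => 2 * Real.pi)

theorem cube_eq_pi : cube n = univ.pi fun _ => Icc (0 : ℝ) (2 * Real.pi) := by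
  rw [cube, ← pi_univ_Icc]; rfl

theorem isCompact_cube : IsCompact (cube n) := isCompact_Icc

theorem volume_cube_lt_top : volume (cube n) < ⊤ := isCompact_cube.measure_lt_top

theorem isRealVec_ofRealVec (x : Fin n → ℝ) : IsRealVec (ofRealVec x) := fun i => by
  simp [ofRealVec]

theorem ofRealVec_mem_angleStrip (hs : 0 < s) (x : Fin n → ℝ) : ofRealVec x ∈ angleStrip n s :=
  fun i => by simpa [ofRealVec] using hs

theorem continuous_ofRealVec : Continuous (ofRealVec : (Fin n → ℝ) → Fin n → ℂ) := by
  unfold ofRealVec; fun_prop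

theorem continuous_exp_intDot (k : Fin n → ℤ) :
    Continuous fun x : Fin n → ℝ => Complex.exp (Complex.I * intDot k (ofRealVec x)) := by
  unfold intDot ofRealVec; fun_prop

theorem norm_exp_intDot_ofRealVec (k : Fin n → ℤ) (x : Fin n → ℝ) :
    ‖Complex.exp (Complex.I * intDot k (ofRealVec x))‖ = 1 := by
  have : Complex.I * intDot k (ofRealVec x) = ((∑ i, (k i : ℝ) * x i : ℝ) : ℂ) * Complex.I := by
    simp [intDot, ofRealVec, mul_comm]
  rw [this, Complex.norm_exp_ofReal_mul_I]

theorem coeff_eq (f : Phase n → ℂ) (k : Fin n → ℤ) (y : Fin n → ℂ) :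
    coeff f k y = ((2 * (Real.pi : ℂ)) ^ n)⁻¹ * ∫ x in cube n, f (y, ofRealVec x) *
      Complex.exp (Complex.I * intDot (-k) (ofRealVec x)) := by
  simp only [coeff, intDot_neg_left, mul_neg]
  rfl

theorem coeff_congr {f g : Phase n → ℂ} {y : Fin n → ℂ}
    (h : ∀ x : Fin n → ℝ, f (y, ofRealVec x) = g (y, ofRealVec x)) (k : Fin n → ℤ) :
    coeff f k y = coeff g k y := by
  simp only [coeff_eq, h]

theorem integral_exp_intCast (m : ℤ) :
    ∫ t in Icc (0 : ℝ) (2 * Real.pi), Complex.exp (Complex.I * (m * (t : ℂ))) =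
      if m = 0 then 2 * (Real.pi : ℂ) else 0 := by
  rw [integral_Icc_eq_integral_Ioc, ← intervalIntegral.integral_of_le Real.two_pi_pos.le]
  split_ifs with h
  · simp [h]
  · have hc : Complex.I * m ≠ 0 := mul_ne_zero Complex.I_ne_zero (by exact_mod_cast h)
    have := integral_exp_mul_complex (a := 0) (b := 2 * Real.pi) hc
    simp only [← mul_assoc] at this ⊢
    rw [this]
    have e : Complex.exp (Complex.I * m * (2 * Real.pi : ℝ)) = 1 := by
      rw [Complex.exp_eq_one_iff]
      exact ⟨m, by push_cast; ring⟩
    push_cast at e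
    simp only [← mul_assoc] at e
    simp [e, ← mul_assoc]

theorem integral_cube_exp (k : Fin n → ℤ) :
    ∫ x in cube n, Complex.exp (Complex.I * intDot k (ofRealVec x)) =
      if k = 0 then (2 * (Real.pi : ℂ)) ^ n else 0 := by
  have h1 : ∀ x : Fin n → ℝ, Complex.exp (Complex.I * intDot k (ofRealVec x)) =
      ∏ i, Complex.exp (Complex.I * (k i * (x i : ℂ))) := fun x => by
    rw [← Complex.exp_sum, intDot, Finset.mul_sum]; rfl
  simp only [h1]
  rw [cube_eq_pi, volume_pi, Measure.restrict_pi_pi,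
    integral_fintype_prod_eq_prod (fun i (t : ℝ) => Complex.exp (Complex.I * (k i * (t : ℂ))))]
  simp only [integral_exp_intCast]
  split_ifs with h
  · simp [h]
  · obtain ⟨i, hi⟩ := Function.ne_iff.1 h
    exact Finset.prod_eq_zero (Finset.mem_univ i) (if_neg hi)

/-- Termwise integration and orthogonality of the exponentials. Because of this, a norm bound on a
family is a bound on the `fourierNorm` of its function, and mode projections act on the family. -/
theorem FourierBdd.coeff_ev {a : Coeffs n} (ha : FourierBdd D r s M a) (hs : 0 < s)
    {y : Fin n → ℂ} (hy : y ∈ actionDomain D r) (k : Fin n → ℤ) : coeff (ev a) k y = a k y := by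
  have hpi : (2 * (Real.pi : ℂ)) ^ n ≠ 0 := pow_ne_zero _ (by simp [Real.pi_ne_zero])
  rw [coeff_eq, inv_mul_eq_iff_eq_mul₀ hpi]
  set F : (Fin n → ℤ) → (Fin n → ℝ) → ℂ := fun l x =>
    a l y * Complex.exp (Complex.I * intDot (l + -k) (ofRealVec x)) with hF
  have hsum : ∀ x, HasSum (fun l => F l x) (ev a (y, ofRealVec x) *
      Complex.exp (Complex.I * intDot (-k) (ofRealVec x))) := fun x => by
    have := (ha.hasSum_ev (p := (y, ofRealVec x)) ⟨hy, ofRealVec_mem_angleStrip hs x⟩).mul_right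
      (Complex.exp (Complex.I * intDot (-k) (ofRealVec x)))
    convert! this using 2 with l
    rw [hF]
    simp only [intDot_add_left, mul_add, Complex.exp_add, mul_assoc]
  have hint : ∀ l, Integrable (F l) (volume.restrict (cube n)) := fun l =>
    ((continuous_const.mul (continuous_exp_intDot _)).continuousOn).integrableOn_compact
      isCompact_cube
  have hnorm : ∀ l x, ‖F l x‖ = ‖a l y‖ := fun l x => by
    rw [hF]; simp only [norm_mul, norm_exp_intDot_ofRealVec, mul_one]
  have hsn : Summable fun l => ‖a l y‖ := by
    refine Summable.of_nonneg_of_le (fun _ => norm_nonneg _) (fun l => ha.norm_le hy l) ?_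
    exact (summable_exp_neg_oneNorm hs).mul_left M
  have h2 := hasSum_integral_of_summable_integral_norm hint (by
    simp only [hnorm, integral_const, smul_eq_mul]
    exact hsn.mul_left _)
  have h3 : ∀ l, ∫ x in cube n, F l x = if l = k then (2 * (Real.pi : ℂ)) ^ n * a k y else 0 := by
    intro l
    rw [hF]
    simp only [integral_const_mul, integral_cube_exp]
    by_cases h : l = k
    · simp [h, mul_comm]
    · have : l + -k ≠ 0 := by rwa [← sub_eq_add_neg, sub_ne_zero]
      simp [h, this]
  simp only [h3] at h2
  have h4 := h2.unique (hasSum_ite_eq k _)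
  rw [← h4]
  exact integral_congr_ae (Eventually.of_forall fun x => ((hsum x).tsum_eq).symm)

theorem FourierBdd.coeff_eq_of_eqOn {a : Coeffs n} (ha : FourierBdd D r s M a) (hs : 0 < s)
    {F : Phase n → ℂ} (hF : ∀ p ∈ phaseDomain D r s, F p = ev a p)
    {y : Fin n → ℂ} (hy : y ∈ actionDomain D r) (k : Fin n → ℤ) : coeff F k y = a k y := by
  rw [← ha.coeff_ev hs hy k]
  exact coeff_congr (fun x => hF _ ⟨hy, ofRealVec_mem_angleStrip hs x⟩) k

theorem fourierNorm_le {F : Phase n → ℂ} {a : Coeffs n} (ha : FourierBdd D r s M a)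
    (hF : ∀ y ∈ actionDomain D r, ∀ k, coeff F k y = a k y) :
    fourierNorm D r s F ≤ ENNReal.ofReal M := by
  refine iSup₂_le fun y hy => ?_
  rw [ENNReal.tsum_eq_iSup_sum]
  refine iSup_le fun T => ?_
  rw [← ENNReal.ofReal_sum_of_nonneg fun k _ => by positivity]
  refine ENNReal.ofReal_le_ofReal ?_
  simpa only [hF y hy] using ha.bound y hy T

theorem modeProj_eq_ev (T : Set (Fin n → ℤ)) (F : Phase n → ℂ) (p : Phase n) :
    modeProj T F p = ev (restr T (coeff F)) p := by
  rw [modeProj, ev,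
    tsum_subtype T fun k => coeff F k p.1 * Complex.exp (Complex.I * intDot k p.2)]
  refine tsum_congr fun k => ?_
  by_cases h : k ∈ T <;> simp [restr, h]

theorem coeff_sum_le {f : Phase n → ℂ} (hfin : fourierNorm D r s f ≠ ⊤) {y : Fin n → ℂ}
    (hy : y ∈ actionDomain D r) (F : Finset (Fin n → ℤ)) :
    ∑ k ∈ F, ‖coeff f k y‖ * Real.exp (oneNorm k * s) ≤ (fourierNorm D r s f).toReal := by
  rw [← ENNReal.ofReal_le_iff_le_toReal hfin,
    ENNReal.ofReal_sum_of_nonneg fun k _ => by positivity]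
  refine (ENNReal.sum_le_tsum F).trans ?_
  exact le_iSup₂_of_le y hy le_rfl

/-! ### Fourier coefficients of analytic functions -/

/-- Differentiation under the integral; the derivative of `f` is continuous, hence bounded, on a
compact ball times the cube. -/
theorem differentiableOn_coeff {f : Phase n → ℂ} (hf : RealAnalyticPhase D r s f) (hs : 0 < s)
    (k : Fin n → ℤ) : DifferentiableOn ℂ (coeff f k) (actionDomain D r) := by
  intro y hy
  have hU := isOpen_phaseDomain D r s
  have hmem : ∀ z ∈ actionDomain D r, ∀ x : Fin n → ℝ, (z, ofRealVec x) ∈ phaseDomain D r s :=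
    fun z hz x => ⟨hz, ofRealVec_mem_angleStrip hs x⟩
  have hC1 := contDiffOn_one_of_differentiableOn hU hf.holomorphic
  have hfd : ContinuousOn (fderiv ℂ f) (phaseDomain D r s) :=
    hC1.continuousOn_fderiv_of_isOpen hU le_rfl
  obtain ⟨δ, hδ, hball⟩ := Metric.isOpen_iff.1 (isOpen_actionDomain D r) y hy
  have hball' : closedBall y (δ / 2) ⊆ actionDomain D r :=
    (closedBall_subset_ball (by linarith)).trans hball
  set ι : (Fin n → ℂ) →L[ℂ] Phase n := ContinuousLinearMap.inl ℂ (Fin n → ℂ) (Fin n → ℂ)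
  have hcomp : IsCompact (closedBall y (δ / 2) ×ˢ cube n) :=
    (isCompact_closedBall _ _).prod isCompact_cube
  have hcont : ContinuousOn (fun q : (Fin n → ℂ) × (Fin n → ℝ) =>
      (fderiv ℂ f (q.1, ofRealVec q.2)).comp ι) (closedBall y (δ / 2) ×ˢ cube n) := by
    refine ContinuousOn.clm_comp (hfd.comp ?_ ?_) continuousOn_const
    · exact (continuous_fst.prodMk (continuous_ofRealVec.comp continuous_snd)).continuousOn
    · exact fun q hq => hmem _ (hball' hq.1) _
  obtain ⟨B, hB⟩ := hcomp.exists_bound_of_continuousOn hcont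
  have key := hasFDerivAt_integral_of_dominated_of_fderiv_le (𝕜 := ℂ)
    (μ := volume.restrict (cube n)) (s := ball y (δ / 2)) (x₀ := y)
    (F := fun z x => f (z, ofRealVec x) * Complex.exp (Complex.I * intDot (-k) (ofRealVec x)))
    (F' := fun z x => Complex.exp (Complex.I * intDot (-k) (ofRealVec x)) •
      (fderiv ℂ f (z, ofRealVec x)).comp ι) (bound := fun _ => B)
    (ball_mem_nhds y (by linarith)) ?_ ?_ ?_ ?_ ?_ ?_
  · have e : coeff f k = fun z => ((2 * (Real.pi : ℂ)) ^ n)⁻¹ * ∫ x in cube n,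
        f (z, ofRealVec x) * Complex.exp (Complex.I * intDot (-k) (ofRealVec x)) :=
      funext fun z => coeff_eq f k z
    rw [e]
    exact (key.const_mul _).differentiableAt.differentiableWithinAt
  · filter_upwards [(isOpen_actionDomain D r).mem_nhds hy] with z hz
    refine ContinuousOn.aestronglyMeasurable ?_ isCompact_cube.measurableSet
    refine ContinuousOn.mul ?_ (continuous_exp_intDot _).continuousOn
    exact hf.holomorphic.continuousOn.comp
      (continuous_const.prodMk continuous_ofRealVec).continuousOn fun x _ => hmem z hz x
  · refine ContinuousOn.integrableOn_compact isCompact_cube ?_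
    refine ContinuousOn.mul ?_ (continuous_exp_intDot _).continuousOn
    exact hf.holomorphic.continuousOn.comp
      (continuous_const.prodMk continuous_ofRealVec).continuousOn fun x _ => hmem y hy x
  · refine ContinuousOn.aestronglyMeasurable ?_ isCompact_cube.measurableSet
    refine ContinuousOn.smul (continuous_exp_intDot _).continuousOn ?_
    refine ContinuousOn.clm_comp (hfd.comp ?_ fun x _ => hmem y hy x) continuousOn_const
    exact (continuous_const.prodMk continuous_ofRealVec).continuousOn
  · refine (ae_restrict_iff' isCompact_cube.measurableSet).2 (Eventually.of_forall ?_)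
    intro x hx z hz
    rw [norm_smul, norm_exp_intDot_ofRealVec, one_mul]
    exact hB (z, x) ⟨ball_subset_closedBall hz, hx⟩
  · exact integrableOn_const volume_cube_lt_top.ne
  · refine Eventually.of_forall fun x z hz => ?_
    have h1 : HasFDerivAt f (fderiv ℂ f (z, ofRealVec x)) (z, ofRealVec x) :=
      (hf.holomorphic.differentiableAt
        (hU.mem_nhds (hmem z (hball' (ball_subset_closedBall hz)) x))).hasFDerivAt
    have h2 : HasFDerivAt (fun z : Fin n → ℂ => (z, ofRealVec x)) ι z := by
      exact hasFDerivAt_prodMk_left z (ofRealVec x)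
    exact (h1.comp z h2).mul_const _

theorem conjSymm_coeff {f : Phase n → ℂ} (hf : RealAnalyticPhase D r s f) (hs : 0 < s) :
    ConjSymm D r (coeff f) := by
  intro y hy hyr k
  have h1 : ∀ x : Fin n → ℝ, (starRingEnd ℂ) (f (y, ofRealVec x)) = f (y, ofRealVec x) := fun x =>
    Complex.conj_eq_iff_im.2
      (hf.real _ ⟨hy, ofRealVec_mem_angleStrip hs x⟩ hyr (isRealVec_ofRealVec x))
  have h2 : (starRingEnd ℂ) ((2 * (Real.pi : ℂ)) ^ n)⁻¹ = ((2 * (Real.pi : ℂ)) ^ n)⁻¹ := by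
    rw [map_inv₀, map_pow, map_mul, Complex.conj_ofReal, map_ofNat]
  rw [coeff_eq, coeff_eq, map_mul, ← integral_conj, h2]
  congr 2
  ext x
  rw [map_mul, conj_exp_intDot (isRealVec_ofRealVec x), h1]

theorem fourierBdd_coeff {f : Phase n → ℂ} (hf : RealAnalyticPhase D r s f) (hs : 0 < s)
    (hfin : fourierNorm D r s f ≠ ⊤) :
    FourierBdd D r s (fourierNorm D r s f).toReal (coeff f) where
  nonneg := ENNReal.toReal_nonneg
  holo := differentiableOn_coeff hf hs
  bound _ hy F := coeff_sum_le hfin hy F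

end FourierCoefficients

/-! ### Recovering an analytic function from its coefficients, on the real torus and then on the
strip. -/

section FourierInversion

open MeasureTheory

variable {n : ℕ} {D : Set (Fin n → ℝ)} {r s M : ℝ}

/-! ### Fourier inversion -/

/-- A real point of the torus `ℝⁿ/ℤⁿ`. -/
def torusMk (x : Fin n → ℝ) : UnitAddTorus (Fin n) := fun i => (x i : UnitAddCircle)

theorem torusMk_surjective : Function.Surjective (torusMk : (Fin n → ℝ) → _) := fun θ =>
  ⟨fun i => (QuotientAddGroup.mk_surjective (θ i)).choose,
    funext fun i => (QuotientAddGroup.mk_surjective (θ i)).choose_spec⟩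

theorem isQuotientMap_torusMk : IsQuotientMap (torusMk : (Fin n → ℝ) → _) :=
  (IsOpenQuotientMap.piMap fun _ : Fin n =>
    QuotientAddGroup.isOpenQuotientMap_mk (N := AddSubgroup.zmultiples (1 : ℝ))).isQuotientMap

theorem mFourier_torusMk (k : Fin n → ℤ) (x : Fin n → ℝ) :
    UnitAddTorus.mFourier k (torusMk x) =
      Complex.exp (Complex.I * intDot k (ofRealVec ((2 * Real.pi) • x))) := by
  have h : UnitAddTorus.mFourier k (torusMk x) = ∏ i, fourier (k i) (x i : UnitAddCircle) := rfl
  rw [h, intDot, Finset.mul_sum, Complex.exp_sum]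
  refine Finset.prod_congr rfl fun i _ => ?_
  rw [fourier_coe_apply]
  congr 1
  simp [ofRealVec]
  ring

/-- A periodic function descends to ℝⁿ/ℤⁿ after rescaling by 2π, and the descent is continuous
because `torusMk` is a quotient map. -/
theorem exists_torus_function {g : (Fin n → ℝ) → ℂ} (hg : Continuous g)
    (hper : ∀ x (k : Fin n → ℤ), g (x + fun i => 2 * Real.pi * k i) = g x) :
    ∃ T : C(UnitAddTorus (Fin n), ℂ), ∀ x, T (torusMk x) = g ((2 * Real.pi) • x) := by
  set G : UnitAddTorus (Fin n) → ℂ := fun θ => g ((2 * Real.pi) • (torusMk_surjective θ).choose)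
  have hG : ∀ x, G (torusMk x) = g ((2 * Real.pi) • x) := by
    intro x
    have h := (torusMk_surjective (torusMk x)).choose_spec
    set x' := (torusMk_surjective (torusMk x)).choose
    have h1 : ∀ i, ∃ m : ℤ, x' i = x i + m := by
      intro i
      have h2 : ((x' i : ℝ) : AddCircle (1 : ℝ)) = (x i : ℝ) := congrFun h i
      have h3 : ((x' i - x i : ℝ) : AddCircle (1 : ℝ)) = 0 := by
        rw [AddCircle.coe_sub, h2, sub_self]
      obtain ⟨m, hm⟩ := (AddCircle.coe_eq_zero_iff _).1 h3
      refine ⟨m, ?_⟩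
      simp only [zsmul_eq_mul, mul_one] at hm
      linarith
    choose m hm using h1
    rw [← hper _ m]
    change g ((2 * Real.pi) • x') = _
    congr 1
    ext i
    simp [hm i]
    ring
  refine ⟨⟨G, isQuotientMap_torusMk.continuous_iff.2 ?_⟩, hG⟩
  have : G ∘ torusMk = fun x => g ((2 * Real.pi) • x) := funext hG
  rw [this]
  fun_prop

open scoped Pointwise in
theorem smul_Ioc_ae_eq_cube :
    ((2 * Real.pi) • {x : Fin n → ℝ | ∀ i, x i ∈ Ioc ((0 : Fin n → ℝ) i) ((0 : Fin n → ℝ) i + 1)} :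
      Set (Fin n → ℝ)) =ᵐ[volume] cube n := by
  have h : ((2 * Real.pi) • {x : Fin n → ℝ |
      ∀ i, x i ∈ Ioc ((0 : Fin n → ℝ) i) ((0 : Fin n → ℝ) i + 1)} : Set (Fin n → ℝ)) =
      univ.pi fun i => Ioc ((0 : Fin n → ℝ) i) (2 * Real.pi) := by
    ext x
    rw [mem_smul_set_iff_inv_smul_mem₀ Real.two_pi_pos.ne']
    simp only [mem_ofPred_eq, Set.mem_pi, mem_univ, true_imp_iff, Pi.smul_apply, smul_eq_mul, mem_Ioc,
      Pi.zero_apply, zero_add]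
    refine forall_congr' fun i => and_congr ?_ ?_
    · rw [inv_mul_eq_div, lt_div_iff₀ Real.two_pi_pos, zero_mul]
    · rw [inv_mul_eq_div, div_le_one Real.two_pi_pos]
  rw [h, cube]
  exact Measure.univ_pi_Ioc_ae_eq_Icc

-- Transport to the unit torus, where summable coefficients imply pointwise convergence. The
-- Jacobian of the rescaling produces the normalisation (2π)⁻ⁿ.
open scoped Pointwise in
theorem hasSum_fourier_of_periodic {g : (Fin n → ℝ) → ℂ} (hg : Continuous g)
    (hper : ∀ x (k : Fin n → ℤ), g (x + fun i => 2 * Real.pi * k i) = g x)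
    {c : (Fin n → ℤ) → ℂ}
    (hc : ∀ k, c k = ((2 * (Real.pi : ℂ)) ^ n)⁻¹ * ∫ x in cube n, g x *
      Complex.exp (Complex.I * intDot (-k) (ofRealVec x)))
    (hsum : Summable c) (x : Fin n → ℝ) :
    HasSum (fun k => c k * Complex.exp (Complex.I * intDot k (ofRealVec x))) (g x) := by
  obtain ⟨T, hT⟩ := exists_torus_function hg hper
  have hcoef : UnitAddTorus.mFourierCoeff T = c := by
    ext k
    rw [UnitAddTorus.mFourierCoeff_eq_integral T k 0, hc k]
    have h1 : ∀ z : Fin n → ℝ, UnitAddTorus.mFourier (-k) (fun i => (z i : UnitAddCircle)) •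
        T (fun i => (z i : UnitAddCircle)) = (fun z => g z *
          Complex.exp (Complex.I * intDot (-k) (ofRealVec z))) ((2 * Real.pi) • z) := by
      intro z
      rw [smul_eq_mul, mul_comm]
      exact congrArg₂ (· * ·) (hT z) (mFourier_torusMk (-k) z)
    simp only [h1]
    rw [Measure.setIntegral_comp_smul_of_pos volume (fun z : Fin n → ℝ => g z *
          Complex.exp (Complex.I * intDot (-k) (ofRealVec z))) _ Real.two_pi_pos,
      setIntegral_congr_set smul_Ioc_ae_eq_cube, Module.finrank_fin_fun, Complex.real_smul]
    push_cast
    rfl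
  have h := UnitAddTorus.hasSum_mFourier_series_apply_of_summable (f := T)
    (by rw [hcoef]; exact hsum) (torusMk ((2 * Real.pi)⁻¹ • x))
  rw [hT, smul_smul, mul_inv_cancel₀ Real.two_pi_pos.ne', one_smul] at h
  convert! h using 2 with k
  rw [mFourier_torusMk, smul_smul, mul_inv_cancel₀ Real.two_pi_pos.ne', one_smul, hcoef,
    smul_eq_mul]

theorem ev_coeff_real {f : Phase n → ℂ} (hf : RealAnalyticPhase D r s f) (hs : 0 < s)
    (hb : FourierBdd D r s M (coeff f)) {y : Fin n → ℂ} (hy : y ∈ actionDomain D r)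
    (x : Fin n → ℝ) : ev (coeff f) (y, ofRealVec x) = f (y, ofRealVec x) := by
  refine (hasSum_fourier_of_periodic (g := fun x => f (y, ofRealVec x)) ?_ ?_
    (fun k => coeff_eq f k y) ?_ x).tsum_eq
  · refine hf.holomorphic.continuousOn.comp_continuous
      (continuous_const.prodMk continuous_ofRealVec) fun x => ⟨hy, ofRealVec_mem_angleStrip hs x⟩
  · intro x k
    have e : ofRealVec (x + fun i => 2 * Real.pi * k i) = ofRealVec x + period k :=
      funext fun i => by simp [ofRealVec, period]
    rw [e]
    exact hf.periodic (y, ofRealVec x) ⟨hy, ofRealVec_mem_angleStrip hs x⟩ k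
  · exact Summable.of_norm (Summable.of_nonneg_of_le (fun _ => norm_nonneg _)
      (fun l => hb.norm_le hy l) ((summable_exp_neg_oneNorm hs).mul_left M))

/-- Functions that are analytic on a strip and agree at real angles are equal. -/
theorem eqOn_phaseDomain_of_real {f g : Phase n → ℂ} (hs : 0 < s)
    (hf : DifferentiableOn ℂ f (phaseDomain D r s)) (hg : DifferentiableOn ℂ g (phaseDomain D r s))
    (h : ∀ y ∈ actionDomain D r, ∀ x : Fin n → ℝ, f (y, ofRealVec x) = g (y, ofRealVec x)) :
    EqOn f g (phaseDomain D r s) := by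
  rintro ⟨y, x⟩ ⟨hy, hx⟩
  set a : Fin n → ℝ := fun i => (x i).re
  set b : Fin n → ℝ := fun i => (x i).im
  set U : Set ℂ := ⋂ i, {ζ : ℂ | |ζ.im * b i| < s}
  -- The complex line ζ ↦ Re x + ζ Im x has real angles for real ζ and reaches x at ζ = i. The set
  -- `U` of admissible ζ is convex, so the one-variable identity theorem applies.
  set γ : ℂ → Phase n := fun ζ => (y, ofRealVec a + ζ • ofRealVec b)
  have hγ : Differentiable ℂ γ := by
    refine (differentiable_const _).prodMk ((differentiable_const _).add ?_)
    exact differentiable_id.smul_const _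
  have hUo : IsOpen U := isOpen_iInter_of_finite fun i =>
    isOpen_lt ((Complex.continuous_im.mul continuous_const).abs) continuous_const
  have hUc : Convex ℝ U := by
    refine convex_iInter fun i => ?_
    intro z hz w hw p q hp hq hpq
    simp only [mem_ofPred_eq, Complex.add_im, Complex.real_smul, Complex.mul_im, Complex.ofReal_re,
      Complex.ofReal_im, zero_mul, add_zero] at hz hw ⊢
    have h1 := Convex.min_le_combo (|z.im * b i|) (|w.im * b i|) hp hq hpq
    calc |(p * z.im + q * w.im) * b i| = |p * (z.im * b i) + q * (w.im * b i)| := by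
          congr 1; ring
      _ ≤ p * |z.im * b i| + q * |w.im * b i| := by
          refine (abs_add_le _ _).trans ?_
          rw [abs_mul p, abs_mul q, abs_of_nonneg hp, abs_of_nonneg hq]
      _ < s := by
          rcases eq_or_lt_of_le hp with hp0 | hp0
          · have : q = 1 := by linarith
            rw [← hp0, this, zero_mul, zero_add, one_mul]; exact hw
          · nlinarith
  have hmaps : MapsTo γ U (phaseDomain D r s) := by
    intro ζ hζ
    refine ⟨hy, fun i => ?_⟩
    have := mem_iInter.1 hζ i
    simpa [γ, ofRealVec] using this
  have hf' : AnalyticOnNhd ℂ (f ∘ γ) U :=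
    (hf.comp hγ.differentiableOn hmaps).analyticOnNhd hUo
  have hg' : AnalyticOnNhd ℂ (g ∘ γ) U :=
    (hg.comp hγ.differentiableOn hmaps).analyticOnNhd hUo
  have h0 : (0 : ℂ) ∈ U := mem_iInter.2 fun i => by simpa using hs
  have hreal : ∀ t : ℝ, (f ∘ γ) t = (g ∘ γ) t := by
    intro t
    have e : ofRealVec a + (t : ℂ) • ofRealVec b = ofRealVec (a + t • b) := by
      ext i; simp [ofRealVec]
    simp only [Function.comp_apply, γ, e]
    exact h y hy _
  have hfreq : ∃ᶠ z in 𝓝[≠] (0 : ℂ), (f ∘ γ) z = (g ∘ γ) z := by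
    have ht : Tendsto (fun t : ℝ => (t : ℂ)) (𝓝[≠] 0) (𝓝[≠] 0) := by
      refine tendsto_nhdsWithin_of_tendsto_nhds_of_eventually_within _ ?_ ?_
      · exact (Complex.continuous_ofReal.tendsto' 0 0 Complex.ofReal_zero).mono_left
          nhdsWithin_le_nhds
      · filter_upwards [self_mem_nhdsWithin] with t ht
        simpa using ht
    exact ht.frequently (Eventually.of_forall hreal).frequently
  have hI : Complex.I ∈ U := mem_iInter.2 fun i => by simpa using hx i
  have := hf'.eqOn_of_preconnected_of_frequently_eq hg' hUc.isPreconnected h0 hfreq hI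
  have e : γ Complex.I = (y, x) := by
    refine Prod.ext rfl (funext fun i => ?_)
    change ((x i).re : ℂ) + Complex.I * ((x i).im : ℂ) = x i
    rw [mul_comm, Complex.re_add_im]
  simpa only [Function.comp_apply, e] using this

theorem ev_coeff {f : Phase n → ℂ} (hf : RealAnalyticPhase D r s f) (hs : 0 < s)
    (hb : FourierBdd D r s M (coeff f)) : EqOn (ev (coeff f)) f (phaseDomain D r s) :=
  eqOn_phaseDomain_of_real hs (hb.differentiableOn_ev hs) hf.holomorphic fun _ hy x =>
    ev_coeff_real hf hs hb hy x

end FourierInversion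

/-! ### Poisson brackets of coefficient families and their weighted estimates. -/

section LieDerivative

variable {n : ℕ} {D : Set (Fin n → ℝ)}

/-! ### Weighted estimates -/

/-- The maximum over t of t e^(-tσ) is 1/(eσ): a factor |k|₁ costs 1/(eσ) when the strip shrinks by
σ. -/
theorem mul_exp_le {t s' s σ : ℝ} (ht : 0 ≤ t) (hσ : 0 < σ) (h : s' + σ ≤ s) :
    t * Real.exp (t * s') ≤ Real.exp (t * s) / (Real.exp 1 * σ) := by
  rw [le_div_iff₀ (by positivity)]
  have h1 : t * σ ≤ Real.exp (t * σ - 1) := by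
    linarith [Real.add_one_le_exp (t * σ - 1)]
  calc t * Real.exp (t * s') * (Real.exp 1 * σ)
      = (t * σ) * (Real.exp (t * s') * Real.exp 1) := by ring
    _ ≤ Real.exp (t * σ - 1) * (Real.exp (t * s') * Real.exp 1) := by gcongr
    _ = Real.exp (t * (s' + σ)) := by
        rw [← Real.exp_add, ← Real.exp_add]; congr 1; ring
    _ ≤ _ := by gcongr

theorem FourierBdd.sum_oneNorm_le {r s s' σ M : ℝ} {a : Coeffs n} (ha : FourierBdd D r s M a)
    (hσ : 0 < σ) (h : s' + σ ≤ s) {y : Fin n → ℂ} (hy : y ∈ actionDomain D r)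
    (F : Finset (Fin n → ℤ)) :
    ∑ k ∈ F, oneNorm k * (‖a k y‖ * Real.exp (oneNorm k * s')) ≤ M / (Real.exp 1 * σ) := by
  calc _ ≤ ∑ k ∈ F, ‖a k y‖ * Real.exp (oneNorm k * s) / (Real.exp 1 * σ) := by
        refine Finset.sum_le_sum fun k _ => ?_
        have := mul_exp_le (Nat.cast_nonneg (oneNorm k)) hσ h
        calc _ = ‖a k y‖ * (oneNorm k * Real.exp (oneNorm k * s')) := by ring
          _ ≤ ‖a k y‖ * (Real.exp (oneNorm k * s) / (Real.exp 1 * σ)) := by gcongr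
          _ = _ := by ring
    _ ≤ _ := by
        rw [← Finset.sum_div]
        gcongr
        exact ha.bound y hy F

/-- Cauchy on the complex line in direction `v`, which stays in the larger domain for parameters of
modulus below ρ divided by the Euclidean norm of `v`. -/
theorem FourierBdd.sum_fderiv_le {r r' ρ s M : ℝ} {a : Coeffs n} (ha : FourierBdd D r s M a)
    (hρ : 0 < ρ) (h : r' + ρ ≤ r) {y : Fin n → ℂ} (hy : y ∈ actionDomain D r')
    (v : Fin n → ℂ) (F : Finset (Fin n → ℤ)) :
    ∑ k ∈ F, ‖fderiv ℂ (a k) y v‖ * Real.exp (oneNorm k * s) ≤ M * ‖WithLp.toLp 2 v‖ / ρ := by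
  by_cases hv : v = 0
  · subst hv
    simp
  have hv' : 0 < ‖WithLp.toLp 2 v‖ := by
    rw [norm_pos_iff]
    simpa using hv
  have := sum_mul_norm_fderiv_le F (isOpen_actionDomain D r) (fun k _ => ha.holo k)
    (fun k => Real.exp (oneNorm k * s)) (fun k => (Real.exp_pos _).le) (M := M)
    (ρ := ρ / ‖WithLp.toLp 2 v‖) (div_pos hρ hv') (y := y) (v := v) ?_
    (fun z hz => ha.bound z hz F)
  · rwa [div_div_eq_mul_div] at this
  · intro ζ hζ
    refine add_mem_actionDomain hy ?_ h
    rw [WithLp.toLp_smul, norm_smul]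
    exact ((lt_div_iff₀ hv').1 hζ).le

/-! ### The Lie derivative on coefficient families -/

/-- The Fourier coefficients of the derivative of `ev b` along the Hamiltonian vector field of
`ev c`, the modes of `c` being in `S`. -/
def lie (S : Finset (Fin n → ℤ)) (c b : Coeffs n) : Coeffs n := fun m y =>
  ∑ k ∈ S, Complex.I * (fderiv ℂ (c k) y (intVec (m - k)) * b (m - k) y -
    c k y * fderiv ℂ (b (m - k)) y (intVec k))

/-- The coefficients of the action component `-∂χ/∂x_i` of the Hamiltonian vector field. -/
def hamY (c : Coeffs n) (i : Fin n) : Coeffs n := fun k y => -(Complex.I * (k i : ℂ) * c k y)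

/-- The coefficients of the angle component `∂χ/∂y_i` of the Hamiltonian vector field. -/
def hamX (c : Coeffs n) (i : Fin n) : Coeffs n := fun k y => fderiv ℂ (c k) y (Pi.single i 1)

/-- The Hamiltonian vector field of `ev c`. -/
def hamVec (c : Coeffs n) (p : Phase n) : Phase n :=
  (fun i => ev (hamY c i) p, fun i => ev (hamX c i) p)

/-- In each product one factor is differentiated in y, at cost 1/ρ and in an integer direction of
length at most the |·|₁ of the other factor's mode; that length is absorbed by the strip margin of
the other factor. The weights multiply because |m|₁ ≤ |k|₁ + |m-k|₁. The margins of `c` and `b` are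
kept independent so that a `b` known on a larger domain gives a better bound. -/
theorem FourierBdd.lie {S : Finset (Fin n → ℤ)} {c b : Coeffs n}
    {R S₀ C rb sb B r' s' ρc σc ρb σb : ℝ} (hc : FourierBdd D R S₀ C c)
    (hb : FourierBdd D rb sb B b) (hρc : 0 < ρc) (hσc : 0 < σc) (hρb : 0 < ρb) (hσb : 0 < σb)
    (hs' : 0 ≤ s') (h1 : r' + ρc ≤ R) (h2 : s' + σc ≤ S₀) (h3 : r' + ρb ≤ rb) (h4 : s' + σb ≤ sb) :
    FourierBdd D r' s'
      (C / ρc * (B / (Real.exp 1 * σb)) + B / ρb * (C / (Real.exp 1 * σc))) (lie S c b) where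
  nonneg := by
    have := hc.nonneg
    have := hb.nonneg
    positivity
  holo m := by
    have i1 : actionDomain D r' ⊆ actionDomain D R := actionDomain_mono (by linarith)
    have i2 : actionDomain D r' ⊆ actionDomain D rb := actionDomain_mono (by linarith)
    refine DifferentiableOn.fun_sum fun k _ => DifferentiableOn.const_mul (DifferentiableOn.sub
      (DifferentiableOn.mul ?_ ((hb.holo _).mono i2))
      (DifferentiableOn.mul ((hc.holo _).mono i1) ?_)) _
    · exact (differentiableOn_fderiv_apply (isOpen_actionDomain D R) (hc.holo k) _).mono i1
    · exact (differentiableOn_fderiv_apply (isOpen_actionDomain D rb) (hb.holo _) _).mono i2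
  bound y hy F := by
    classical
    have hyR : y ∈ actionDomain D R := actionDomain_mono (by linarith) hy
    have hyb : y ∈ actionDomain D rb := actionDomain_mono (by linarith) hy
    have hc' : FourierBdd D R s' C c := hc.mono le_rfl (by linarith) le_rfl
    have hb' : FourierBdd D rb s' B b := hb.mono le_rfl (by linarith) le_rfl
    set w : (Fin n → ℤ) → ℝ := fun k => Real.exp (oneNorm k * s') with hw
    have hw0 : ∀ k, 0 < w k := fun k => Real.exp_pos _
    -- All differences m - k that occur, so that the sum over (k, m) is dominated by one over the
    -- product `S` × `F2`.
    set F2 : Finset (Fin n → ℤ) := S.biUnion fun k => F.image (fun m => m - k) with hF2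
    set A : (Fin n → ℤ) → (Fin n → ℤ) → ℝ := fun k l =>
      ‖fderiv ℂ (c k) y (intVec l)‖ * w k * (‖b l y‖ * w l) +
        ‖c k y‖ * w k * (‖fderiv ℂ (b l) y (intVec k)‖ * w l) with hA
    have hA0 : ∀ k l, 0 ≤ A k l := fun k l => by
      have := hw0 k
      have := hw0 l
      positivity
    have hww : ∀ m k, w m ≤ w k * w (m - k) := by
      intro m k
      rw [hw, ← Real.exp_add, Real.exp_le_exp, ← add_mul]
      gcongr
      have := oneNorm_add_le k (m - k)
      rw [add_sub_cancel] at this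
      exact_mod_cast this
    calc ∑ m ∈ F, ‖AnalyticNormalForm.lie S c b m y‖ * w m
        ≤ ∑ m ∈ F, ∑ k ∈ S, A k (m - k) := by
          refine Finset.sum_le_sum fun m _ => ?_
          refine (mul_le_mul_of_nonneg_right (norm_sum_le _ _) (hw0 m).le).trans ?_
          rw [Finset.sum_mul]
          refine Finset.sum_le_sum fun k _ => ?_
          rw [norm_mul, Complex.norm_I, one_mul]
          refine (mul_le_mul (norm_sub_le _ _) (hww m k) (hw0 m).le (by positivity)).trans_eq ?_
          rw [norm_mul, norm_mul]
          simp only [hA]; ring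
      _ = ∑ k ∈ S, ∑ m ∈ F, A k (m - k) := Finset.sum_comm
      _ ≤ ∑ k ∈ S, ∑ l ∈ F2, A k l := by
          refine Finset.sum_le_sum fun k hk => ?_
          rw [← Finset.sum_image (f := fun l => A k l) (s := F) (g := fun m => m - k)
            (fun x _ y _ h => sub_left_injective h)]
          exact Finset.sum_le_sum_of_subset_of_nonneg
            (Finset.subset_biUnion_of_mem (fun k => F.image fun m => m - k) hk)
            fun l _ _ => hA0 k l
      _ = ∑ l ∈ F2, (∑ k ∈ S, ‖fderiv ℂ (c k) y (intVec l)‖ * w k) * (‖b l y‖ * w l) +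
          ∑ k ∈ S, (‖c k y‖ * w k) * ∑ l ∈ F2, ‖fderiv ℂ (b l) y (intVec k)‖ * w l := by
          simp only [hA, Finset.sum_add_distrib, Finset.mul_sum, Finset.sum_mul]
          congr 1
          exact Finset.sum_comm
      _ ≤ ∑ l ∈ F2, (C / ρc) * (oneNorm l * (‖b l y‖ * w l)) +
          ∑ k ∈ S, (B / ρb) * (oneNorm k * (‖c k y‖ * w k)) := by
          have hC := hc.nonneg
          have hB := hb.nonneg
          refine add_le_add (Finset.sum_le_sum fun l _ => ?_) (Finset.sum_le_sum fun k _ => ?_)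
          · have e1 := hc'.sum_fderiv_le hρc h1 hy (intVec l) S
            have e2 := norm_toLp_intVec_le l
            have e3 : C * ‖WithLp.toLp 2 (intVec l)‖ / ρc ≤ C * oneNorm l / ρc := by gcongr
            have := (hw0 l).le
            calc _ ≤ (C * oneNorm l / ρc) * (‖b l y‖ * w l) := by
                  gcongr
                  exact e1.trans e3
              _ = _ := by ring
          · have e1 := hb'.sum_fderiv_le hρb h3 hy (intVec k) F2
            have e2 := norm_toLp_intVec_le k
            have e3 : B * ‖WithLp.toLp 2 (intVec k)‖ / ρb ≤ B * oneNorm k / ρb := by gcongr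
            have := (hw0 k).le
            calc _ ≤ (‖c k y‖ * w k) * (B * oneNorm k / ρb) := by
                  gcongr
                  exact e1.trans e3
              _ = _ := by ring
      _ ≤ _ := by
          have hC := hc.nonneg
          have hB := hb.nonneg
          rw [← Finset.mul_sum, ← Finset.mul_sum]
          gcongr
          · exact hb.sum_oneNorm_le hσb h4 hyb F2
          · exact hc.sum_oneNorm_le hσc h2 hyR S

/-- The margin given to `b` is divided into j equal pieces, while `c` always keeps the full margins
ρ and σ. Each bracket costs 2jC/(eρσ), and (j/e)^j ≤ j!. -/
theorem FourierBdd.lie_iterate {S : Finset (Fin n → ℤ)} {c b : Coeffs n} {R S₀ C B ρ σ : ℝ}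
    (hc : FourierBdd D R S₀ C c) (hb : FourierBdd D (R - ρ) (S₀ - σ) B b) (hρ : 0 < ρ)
    (hσ : 0 < σ) (hS : 0 ≤ S₀ - 2 * σ) (j : ℕ) :
    FourierBdd D (R - 2 * ρ) (S₀ - 2 * σ) (B * (2 * C / (ρ * σ)) ^ j * (j.factorial : ℝ))
      ((AnalyticNormalForm.lie S c)^[j] b) := by
  have hC := hc.nonneg
  have hB := hb.nonneg
  rcases Nat.eq_zero_or_pos j with rfl | hj
  · simpa using hb.mono (by linarith) (by linarith) le_rfl
  have hj' : (0 : ℝ) < j := by exact_mod_cast hj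
  have key : ∀ i : ℕ, i ≤ j → FourierBdd D (R - ρ - i * (ρ / j)) (S₀ - σ - i * (σ / j))
      (B * (2 * j * C / (Real.exp 1 * (ρ * σ))) ^ i) ((AnalyticNormalForm.lie S c)^[i] b) := by
    intro i
    induction i with
    | zero => intro _; simpa using hb
    | succ i ih =>
      intro hi
      have hi' : ((i : ℝ) + 1) ≤ j := by exact_mod_cast hi
      have h1 : (i + 1) * (ρ / j) ≤ ρ := by
        rw [mul_div_assoc', div_le_iff₀ hj']; nlinarith
      have h2 : (i + 1) * (σ / j) ≤ σ := by
        rw [mul_div_assoc', div_le_iff₀ hj']; nlinarith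
      have h3 : 0 < ρ / j := by positivity
      have h4 : 0 < σ / j := by positivity
      rw [Function.iterate_succ_apply']
      push_cast
      refine (hc.lie (ih (by omega)) hρ hσ h3 h4 (r' := R - ρ - (i + 1) * (ρ / j))
        (s' := S₀ - σ - (i + 1) * (σ / j)) ?_ ?_ ?_ ?_ ?_).mono le_rfl le_rfl (le_of_eq ?_)
      · linarith
      · have : 0 < (i + 1) * (ρ / j) := by positivity
        linarith
      · have : 0 < (i + 1) * (σ / j) := by positivity
        linarith
      · linarith
      · linarith
      · rw [pow_succ]
        field_simp
        ring
  have h5 := key j le_rfl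
  have e1 : R - ρ - j * (ρ / j) = R - 2 * ρ := by field_simp; ring
  have e2 : S₀ - σ - j * (σ / j) = S₀ - 2 * σ := by field_simp; ring
  rw [e1, e2] at h5
  refine h5.mono le_rfl le_rfl ?_
  have h6 : (j : ℝ) ^ j ≤ Real.exp 1 ^ j * j.factorial := by
    have := Real.pow_div_factorial_le_exp (j : ℝ) hj'.le j
    rw [div_le_iff₀ (by positivity)] at this
    rwa [← Real.exp_nat_mul, mul_one]
  have h7 : (2 * j * C / (Real.exp 1 * (ρ * σ))) ^ j =
      (2 * C / (ρ * σ)) ^ j * ((j : ℝ) ^ j / Real.exp 1 ^ j) := by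
    rw [← div_pow, ← mul_pow]
    congr 1
    field_simp
  have h8 : (j : ℝ) ^ j / Real.exp 1 ^ j ≤ j.factorial := by
    rw [div_le_iff₀ (by positivity)]; linarith
  rw [h7, ← mul_assoc]
  gcongr

theorem FourierBdd.hamX {c : Coeffs n} {R r' ρ S₀ C : ℝ} (hc : FourierBdd D R S₀ C c) (hρ : 0 < ρ)
    (h : r' + ρ ≤ R) (i : Fin n) : FourierBdd D r' S₀ (C / ρ) (hamX c i) where
  nonneg := div_nonneg hc.nonneg hρ.le
  holo k := (differentiableOn_fderiv_apply (isOpen_actionDomain D R) (hc.holo k) _).mono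
    (actionDomain_mono (by linarith))
  bound y hy F := by
    have := hc.sum_fderiv_le hρ h hy (Pi.single i 1) F
    have e : ‖WithLp.toLp 2 (Pi.single i 1 : Fin n → ℂ)‖ = 1 := by
      simp
    rwa [e, mul_one] at this

theorem norm_intCast_le_oneNorm (k : Fin n → ℤ) (i : Fin n) : ‖(k i : ℂ)‖ ≤ oneNorm k := by
  rw [← sum_norm_intVec]
  exact Finset.single_le_sum (f := fun i => ‖(k i : ℂ)‖) (fun _ _ => norm_nonneg _)
    (Finset.mem_univ i)

theorem FourierBdd.hamY {c : Coeffs n} {R S₀ s' σ C : ℝ} (hc : FourierBdd D R S₀ C c) (hσ : 0 < σ)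
    (h : s' + σ ≤ S₀) (i : Fin n) : FourierBdd D R s' (C / (Real.exp 1 * σ)) (hamY c i) where
  nonneg := by have := hc.nonneg; positivity
  holo k := ((hc.holo k).const_mul _).neg
  bound y hy F := by
    refine le_trans (Finset.sum_le_sum fun k _ => ?_) (hc.sum_oneNorm_le hσ h hy F)
    rw [AnalyticNormalForm.hamY, norm_neg, norm_mul, norm_mul, Complex.norm_I, one_mul, mul_assoc]
    gcongr
    exact norm_intCast_le_oneNorm k i

theorem ev_eq_sum {S : Finset (Fin n → ℤ)} {a : Coeffs n} (hS : ∀ k ∉ S, a k = 0) (p : Phase n) :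
    ev a p = ∑ k ∈ S, a k p.1 * Complex.exp (Complex.I * intDot k p.2) :=
  tsum_eq_sum fun k hk => by simp [hS k hk]

theorem hamY_eq_zero {S : Finset (Fin n → ℤ)} {c : Coeffs n} (hS : ∀ k ∉ S, c k = 0) (i : Fin n) :
    ∀ k ∉ S, hamY c i k = 0 := fun k hk => by
  ext y; simp [hamY, hS k hk]

theorem hamX_eq_zero {S : Finset (Fin n → ℤ)} {c : Coeffs n} (hS : ∀ k ∉ S, c k = 0) (i : Fin n) :
    ∀ k ∉ S, hamX c i k = 0 := fun k hk => by
  ext y; simp [hamX, hS k hk]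

/-- Since the sum of the |k_i| is |k|₁, the whole ℓ¹ norm satisfies the bound available for a single
component, with no factor n. -/
theorem FourierBdd.sum_norm_ev_hamY_le {S : Finset (Fin n → ℤ)} {c : Coeffs n} {R S₀ s' σ C : ℝ}
    (hc : FourierBdd D R S₀ C c) (hS : ∀ k ∉ S, c k = 0) (hσ : 0 < σ) (h : s' + σ ≤ S₀)
    {p : Phase n} (hp : p ∈ phaseDomain D R s') :
    ∑ i, ‖ev (AnalyticNormalForm.hamY c i) p‖ ≤ C / (Real.exp 1 * σ) := by
  refine le_trans ?_ (hc.sum_oneNorm_le hσ h hp.1 S)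
  calc _ ≤ ∑ i, ∑ k ∈ S, ‖(k i : ℂ)‖ * (‖c k p.1‖ * Real.exp (oneNorm k * s')) := by
        refine Finset.sum_le_sum fun i _ => ?_
        rw [ev_eq_sum (hamY_eq_zero hS i)]
        refine (norm_sum_le _ _).trans (Finset.sum_le_sum fun k _ => ?_)
        rw [AnalyticNormalForm.hamY, norm_mul, norm_neg, norm_mul, norm_mul, Complex.norm_I,
          one_mul, mul_assoc]
        gcongr
        exact norm_exp_intDot_le fun i => (hp.2 i).le
    _ = _ := by
        rw [Finset.sum_comm]
        refine Finset.sum_congr rfl fun k _ => ?_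
        rw [← Finset.sum_mul, sum_norm_intVec]

theorem clm_apply_eq_sum (L : (Fin n → ℂ) →L[ℂ] ℂ) (v : Fin n → ℂ) :
    L v = ∑ i, v i * L (Pi.single i 1) := by
  conv_lhs => rw [← Finset.univ_sum_single v, map_sum]
  refine Finset.sum_congr rfl fun i _ => ?_
  rw [← smul_eq_mul, ← map_smul, ← Pi.single_smul, smul_eq_mul, mul_one]

/-- Justifies the formula for `lie`: the field is a finite combination of exponentials, and the
product of the modes k and l contributes to the mode m = k + l. -/
theorem fderiv_ev_hamVec {S : Finset (Fin n → ℤ)} {c b : Coeffs n} {rb sb B : ℝ}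
    (hS : ∀ k ∉ S, c k = 0) (hb : FourierBdd D rb sb B b) (hsb : 0 < sb) {p : Phase n}
    (hp : p ∈ phaseDomain D rb sb) :
    fderiv ℂ (ev b) p (hamVec c p) = ev (lie S c b) p := by
  obtain ⟨-, hsum⟩ := hb.hasFDerivAt_ev hsb hp
  set w : (Fin n → ℤ) → Phase n := fun k =>
    (fun i => -(Complex.I * (k i : ℂ) * c k p.1), fun i => fderiv ℂ (c k) p.1 (Pi.single i 1))
    with hw
  have hX : hamVec c p = ∑ k ∈ S, Complex.exp (Complex.I * intDot k p.2) • w k := by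
    refine Prod.ext (funext fun i => ?_) (funext fun i => ?_)
    · rw [Prod.fst_sum, Finset.sum_apply, hamVec]
      dsimp only
      rw [ev_eq_sum (hamY_eq_zero hS i)]
      exact Finset.sum_congr rfl fun k _ => by simp [hw, hamY]; ring
    · rw [Prod.snd_sum, Finset.sum_apply, hamVec]
      dsimp only
      rw [ev_eq_sum (hamX_eq_zero hS i)]
      exact Finset.sum_congr rfl fun k _ => by simp [hw, hamX]; ring
  have h1 : ∀ k ∈ S, HasSum (fun m => Complex.I * (fderiv ℂ (c k) p.1 (intVec (m - k)) *
      b (m - k) p.1 - c k p.1 * fderiv ℂ (b (m - k)) p.1 (intVec k)) *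
        Complex.exp (Complex.I * intDot m p.2))
      (Complex.exp (Complex.I * intDot k p.2) * fderiv ℂ (ev b) p (w k)) := by
    intro k _
    have h2 := (hsum (w k)).mul_left (Complex.exp (Complex.I * intDot k p.2))
    rw [← (Equiv.subRight k).hasSum_iff] at h2
    refine h2.congr_fun fun m => ?_
    simp only [Function.comp_apply, Equiv.subRight_apply]
    have e1 : fderiv ℂ (b (m - k)) p.1 (w k).1 =
        -(Complex.I * c k p.1) * fderiv ℂ (b (m - k)) p.1 (intVec k) := by
      rw [← smul_eq_mul, ← map_smul]
      congr 1
      ext i; simp [hw, intVec]; ring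
    have e2 : intDot (m - k) (w k).2 = fderiv ℂ (c k) p.1 (intVec (m - k)) := by
      rw [clm_apply_eq_sum]; rfl
    have e3 : Complex.exp (Complex.I * intDot m p.2) = Complex.exp (Complex.I * intDot k p.2) *
        Complex.exp (Complex.I * intDot (m - k) p.2) := by
      rw [← Complex.exp_add, ← mul_add, ← intDot_add_left, add_sub_cancel]
    rw [e1, e2, e3]
    ring
  rw [hX, map_sum]
  simp only [map_smul, smul_eq_mul]
  rw [← (hasSum_sum h1).tsum_eq, ev]
  refine tsum_congr fun m => ?_
  rw [lie, Finset.sum_mul]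

/-- The Hamiltonian relation ι_X (dy ∧ dx) = -dχ, in the sign convention y' = -∂χ/∂x, x' = ∂χ/∂y. -/
theorem symplForm_hamVec {S : Finset (Fin n → ℤ)} {c : Coeffs n} {R S₀ C : ℝ}
    (hS : ∀ k ∉ S, c k = 0) (hc : FourierBdd D R S₀ C c) (hS₀ : 0 < S₀) {p : Phase n}
    (hp : p ∈ phaseDomain D R S₀) (v : Phase n) :
    symplForm (hamVec c p) v = -fderiv ℂ (ev c) p v := by
  obtain ⟨-, hsum⟩ := hc.hasFDerivAt_ev hS₀ hp
  rw [← (hsum v).tsum_eq, tsum_eq_sum (s := S) fun k hk => by simp [hS k hk]]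
  simp only [symplForm, hamVec, ev_eq_sum (hamY_eq_zero hS _), ev_eq_sum (hamX_eq_zero hS _)]
  simp only [Finset.sum_mul, ← Finset.sum_sub_distrib]
  rw [Finset.sum_comm, ← Finset.sum_neg_distrib]
  refine Finset.sum_congr rfl fun k _ => ?_
  generalize Complex.exp (Complex.I * intDot k p.2) = e
  rw [clm_apply_eq_sum, intDot, add_mul, Finset.sum_mul, Finset.mul_sum, Finset.sum_mul,
    Finset.sum_mul, ← Finset.sum_add_distrib, ← Finset.sum_neg_distrib]
  exact Finset.sum_congr rfl fun i _ => by simp only [hamY, hamX]; ring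

/-! ### Reality -/

theorem isRealVec_intVec (k : Fin n → ℤ) : IsRealVec (intVec k) := fun i => by simp [intVec]

/-- The conjugation symmetry holds along the real line through `y` in the real direction `v`; both
sides are differentiated along it. -/
theorem ConjSymm.conj_fderiv {r : ℝ} {a : Coeffs n} (ha : ConjSymm D r a)
    (hd : ∀ k, DifferentiableOn ℂ (a k) (actionDomain D r)) {y v : Fin n → ℂ}
    (hy : y ∈ actionDomain D r) (hyr : IsRealVec y) (hv : IsRealVec v) (k : Fin n → ℤ) :
    (starRingEnd ℂ) (fderiv ℂ (a k) y v) = fderiv ℂ (a (-k)) y v := by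
  have hpath : HasDerivAt (fun t : ℝ => y + (t : ℂ) • v) v 0 := by
    have h1 : HasDerivAt (fun t : ℝ => (t : ℂ)) 1 0 := Complex.ofRealCLM.hasDerivAt
    simpa using (h1.smul_const v).const_add y
  have hder : ∀ l, HasDerivAt (fun t : ℝ => a l (y + (t : ℂ) • v)) (fderiv ℂ (a l) y v) 0 := by
    intro l
    have h2 : HasFDerivAt (a l) (fderiv ℂ (a l) y) (y + ((0 : ℝ) : ℂ) • v) := by
      simpa using ((hd l).differentiableAt
        ((isOpen_actionDomain D r).mem_nhds hy)).hasFDerivAt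
    exact (h2.restrictScalars ℝ).comp_hasDerivAt (0 : ℝ) hpath
  have h3 : HasDerivAt (fun t : ℝ => (starRingEnd ℂ) (a k (y + (t : ℂ) • v)))
      ((starRingEnd ℂ) (_root_.fderiv ℂ (a k) y v)) 0 :=
    (Complex.conjCLE : ℂ →L[ℝ] ℂ).hasFDerivAt.comp_hasDerivAt (0 : ℝ) (hder k)
  refine h3.unique ((hder (-k)).congr_of_eventuallyEq ?_)
  have hmem : ∀ᶠ t : ℝ in 𝓝 0, y + (t : ℂ) • v ∈ actionDomain D r := by
    have := hpath.continuousAt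
    refine this.eventually_mem ((isOpen_actionDomain D r).mem_nhds (by simpa using hy))
  filter_upwards [hmem] with t ht
  refine ha _ ht (fun i => ?_) k
  simp [hyr i, hv i]

theorem ConjSymm.lie {R r' rb : ℝ} {S : Finset (Fin n → ℤ)} {c b : Coeffs n}
    (hc : ConjSymm D R c) (hcd : ∀ k, DifferentiableOn ℂ (c k) (actionDomain D R))
    (hb : ConjSymm D rb b) (hbd : ∀ k, DifferentiableOn ℂ (b k) (actionDomain D rb))
    (hS : ∀ k, -k ∈ S ↔ k ∈ S) (h1 : r' ≤ R) (h2 : r' ≤ rb) : ConjSymm D r' (lie S c b) := by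
  intro y hy hr m
  have hyR := actionDomain_mono h1 hy
  have hyb := actionDomain_mono h2 hy
  rw [AnalyticNormalForm.lie, map_sum, AnalyticNormalForm.lie]
  refine Finset.sum_bij' (fun k _ => -k) (fun k _ => -k) (fun k hk => (hS k).2 hk)
    (fun k hk => (hS k).2 hk) (fun k _ => neg_neg k) (fun k _ => neg_neg k) fun k _ => ?_
  have e : ∀ l : Fin n → ℤ, intVec (-l) = -intVec l := fun l => by ext i; simp [intVec]
  rw [map_mul, map_sub, map_mul, map_mul, Complex.conj_I,
    ConjSymm.conj_fderiv hc hcd hyR hr (isRealVec_intVec _),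
    ConjSymm.conj_fderiv hb hbd hyb hr (isRealVec_intVec _), hc y hyR hr, hb y hyb hr]
  have e2 : -m - -k = -(m - k) := by abel
  rw [e2, e, e, map_neg, map_neg]
  ring

theorem ConjSymm.hamX {R : ℝ} {c : Coeffs n} (hc : ConjSymm D R c)
    (hcd : ∀ k, DifferentiableOn ℂ (c k) (actionDomain D R)) (i : Fin n) :
    ConjSymm D R (hamX c i) := fun y hy hr k =>
  ConjSymm.conj_fderiv hc hcd hy hr (fun j => by
    by_cases h : j = i
    · subst h; simp
    · simp [h]) k

theorem ConjSymm.hamY {R : ℝ} {c : Coeffs n} (hc : ConjSymm D R c) (i : Fin n) :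
    ConjSymm D R (hamY c i) := fun y hy hr k => by
  simp [AnalyticNormalForm.hamY, hc y hy hr k]

end LieDerivative

/-! ### Taylor series along curves, and integral curves of holomorphic fields. -/

section Flows

/-- Taylor's formula for a chain of successive derivatives, with sum index starting at the first
derivative. The bound j! m_j with m summable forces the remainder to 0 at every time τ ≤ 1. -/
theorem hasSum_taylor {F : Type*} [NormedAddCommGroup F] [NormedSpace ℝ F] [CompleteSpace F]
    {u : ℕ → ℝ → F} {m : ℕ → ℝ} (hm : Summable m)
    (hu : ∀ j, ∀ t ∈ Icc (0 : ℝ) 1, HasDerivWithinAt (u j) (u (j + 1) t) (Icc 0 1) t)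
    (hb : ∀ j, ∀ t ∈ Icc (0 : ℝ) 1, ‖u (j + 1) t‖ ≤ (j.factorial : ℝ) * m j) {τ : ℝ}
    (hτ : τ ∈ Icc (0 : ℝ) 1) :
    HasSum (fun j => (τ ^ (j + 1) / ((j + 1).factorial : ℝ)) • u (j + 1) 0) (u 0 τ - u 0 0) := by
  -- Taylor polynomial at τ with moving centre t. Its derivative in t telescopes to the single top
  -- term, so the remainder follows from the mean value inequality.
  set v : ℕ → ℝ → F := fun k t =>
    ∑ j ∈ Finset.range (k + 1), ((τ - t) ^ j / (j.factorial : ℝ)) • u j t with hv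
  have hsub : Icc (0 : ℝ) τ ⊆ Icc 0 1 := Icc_subset_Icc le_rfl hτ.2
  have hfac : ∀ j : ℕ, (0 : ℝ) < j.factorial := fun j => by exact_mod_cast j.factorial_pos
  have hm0 : ∀ j, 0 ≤ m j := fun j => by
    have := (norm_nonneg _).trans (hb j 0 (by simp))
    exact nonneg_of_mul_nonneg_right this (hfac j)
  have hder : ∀ k, ∀ t ∈ Icc (0 : ℝ) τ, HasDerivWithinAt (v k)
      (((τ - t) ^ k / (k.factorial : ℝ)) • u (k + 1) t) (Icc 0 τ) t := by
    intro k t ht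
    induction k with
    | zero => simpa [hv] using (hu 0 t (hsub ht)).mono hsub
    | succ k ih =>
      have e : v (k + 1) = fun t => v k t +
          ((τ - t) ^ (k + 1) / ((k + 1).factorial : ℝ)) • u (k + 1) t := by
        ext t; simp only [hv]; rw [Finset.sum_range_succ]
      rw [e]
      have h1 : HasDerivWithinAt (fun t : ℝ => (τ - t) ^ (k + 1) / ((k + 1).factorial : ℝ))
          (-((τ - t) ^ k / (k.factorial : ℝ))) (Icc 0 τ) t := by
        have h2 := ((((hasDerivAt_id t).const_sub τ).pow (k + 1)).div_const
          ((k + 1).factorial : ℝ)).hasDerivWithinAt (s := Icc 0 τ)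
        convert! h2 using 1
        rw [Nat.factorial_succ]
        have := (hfac k).ne'
        push_cast
        simp
        field_simp
      convert! ih.add (h1.smul ((hu (k + 1) t (hsub ht)).mono hsub)) using 1
      module
  have hrem : ∀ k, ‖v k τ - v k 0‖ ≤ m k := by
    intro k
    have := norm_image_sub_le_of_norm_deriv_le_segment' (hder k) (C := m k) (fun t ht => ?_) τ
      ⟨hτ.1, le_rfl⟩
    · refine this.trans ?_
      have := hτ.2
      nlinarith [hm0 k]
    · rw [norm_smul, norm_div, norm_pow, Real.norm_of_nonneg (sub_nonneg.2 ht.2.le),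
        Real.norm_of_nonneg (hfac k).le]
      have h1 : (τ - t) ^ k ≤ 1 := pow_le_one₀ (sub_nonneg.2 ht.2.le) (by linarith [hτ.2, ht.1])
      have h2 := hb k t (hsub ⟨ht.1, ht.2.le⟩)
      calc _ ≤ 1 / (k.factorial : ℝ) * ((k.factorial : ℝ) * m k) := by gcongr
        _ = m k := by field_simp
  have hvτ : ∀ k, v k τ = u 0 τ := by
    intro k
    simp only [hv]
    rw [Finset.sum_range_succ']
    simp
  have hv0 : ∀ k, ∑ j ∈ Finset.range k, (τ ^ (j + 1) / ((j + 1).factorial : ℝ)) • u (j + 1) 0 =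
      v k 0 - u 0 0 := by
    intro k
    simp only [hv]
    rw [Finset.sum_range_succ']
    simp
  have hsum : Summable fun j => ‖(τ ^ (j + 1) / ((j + 1).factorial : ℝ)) • u (j + 1) 0‖ := by
    refine Summable.of_nonneg_of_le (fun _ => norm_nonneg _) (fun j => ?_) hm
    rw [norm_smul, norm_div, norm_pow, Real.norm_of_nonneg hτ.1, Real.norm_of_nonneg (hfac _).le]
    have h1 : τ ^ (j + 1) ≤ 1 := pow_le_one₀ hτ.1 hτ.2
    have h3 : (j.factorial : ℝ) ≤ (j + 1).factorial := by
      exact_mod_cast Nat.factorial_le (Nat.le_succ j)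
    have := hfac j
    calc _ ≤ 1 / (j.factorial : ℝ) * ((j.factorial : ℝ) * m j) := by
          gcongr
          exact hb j 0 (by simp)
      _ = m j := by field_simp
  refine (hasSum_iff_tendsto_nat_of_summable_norm hsum).2 ?_
  rw [tendsto_iff_norm_sub_tendsto_zero]
  refine squeeze_zero (fun _ => norm_nonneg _) (fun k => ?_) hm.tendsto_atTop_zero
  rw [hv0, ← hvτ k, sub_sub_sub_cancel_right, norm_sub_rev]
  exact hrem k

/-- The derivative of an exponential-type series. -/
theorem hasDerivAt_exp_series {F : Type*} [NormedAddCommGroup F] [NormedSpace ℝ F]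
    [CompleteSpace F] {A : ℕ → F} {C q : ℝ} (hq0 : 0 ≤ q) (hq : q < 1)
    (hA : ∀ j, ‖A j‖ ≤ (j.factorial : ℝ) * (C * q ^ j)) :
    ContinuousOn (fun τ : ℝ => ∑' j, (τ ^ (j + 1) / ((j + 1).factorial : ℝ)) • A j) (Icc 0 1) ∧
    ∀ τ ∈ Ico (0 : ℝ) 1,
      HasDerivAt (fun τ : ℝ => ∑' j, (τ ^ (j + 1) / ((j + 1).factorial : ℝ)) • A j)
        (∑' j, (τ ^ j / (j.factorial : ℝ)) • A j) τ := by
  have hfac : ∀ j : ℕ, (0 : ℝ) < j.factorial := fun j => by exact_mod_cast j.factorial_pos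
  have hs : Summable fun j : ℕ => C * q ^ j := (summable_geometric_of_lt_one hq0 hq).mul_left C
  have hb0 : ∀ j, ∀ τ : ℝ, |τ| ≤ 1 → ‖(τ ^ j / (j.factorial : ℝ)) • A j‖ ≤ C * q ^ j := by
    intro j τ hτ
    rw [norm_smul, norm_div, norm_pow, Real.norm_of_nonneg (hfac _).le, Real.norm_eq_abs]
    have h1 : |τ| ^ j ≤ 1 := pow_le_one₀ (abs_nonneg _) hτ
    have := hfac j
    calc _ ≤ 1 / (j.factorial : ℝ) * ((j.factorial : ℝ) * (C * q ^ j)) := by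
          gcongr
          exact hA j
      _ = _ := by field_simp
  have hb1 : ∀ j, ∀ τ : ℝ, |τ| ≤ 1 →
      ‖(τ ^ (j + 1) / ((j + 1).factorial : ℝ)) • A j‖ ≤ C * q ^ j := by
    intro j τ hτ
    rw [norm_smul, norm_div, norm_pow, Real.norm_of_nonneg (hfac _).le, Real.norm_eq_abs]
    have h1 : |τ| ^ (j + 1) ≤ 1 := pow_le_one₀ (abs_nonneg _) hτ
    have h3 : (j.factorial : ℝ) ≤ (j + 1).factorial := by
      exact_mod_cast Nat.factorial_le (Nat.le_succ j)
    have := hfac j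
    calc _ ≤ 1 / (j.factorial : ℝ) * ((j.factorial : ℝ) * (C * q ^ j)) := by
          gcongr
          exact hA j
      _ = _ := by field_simp
  constructor
  · refine continuousOn_tsum (fun j => ?_) hs fun j τ hτ => hb1 j τ ?_
    · fun_prop
    · rw [abs_of_nonneg hτ.1]; exact hτ.2
  · intro τ hτ
    have hmem : ∀ t ∈ Ioo (-1 : ℝ) 1, |t| ≤ 1 := fun t ht => (abs_lt.2 ht).le
    refine hasDerivAt_tsum_of_isPreconnected (t := Ioo (-1) 1) (y₀ := 0) hs isOpen_Ioo
      isPreconnected_Ioo (fun j t _ => ?_) (fun j t ht => hb0 j t (hmem t ht)) (by simp) ?_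
      ⟨by linarith [hτ.1], hτ.2⟩
    · refine HasDerivAt.smul_const ?_ (A j)
      have h2 := ((hasDerivAt_id t).pow (j + 1)).div_const ((j + 1).factorial : ℝ)
      convert! h2 using 1
      rw [Nat.factorial_succ]
      have := (hfac j).ne'
      push_cast
      simp
      field_simp
    · exact Summable.of_norm_bounded hs fun j => hb1 j 0 (by simp)

variable {n : ℕ}

theorem locallyLipschitzOn_of_differentiableOn {E F : Type*} [NormedAddCommGroup E]
    [NormedSpace ℂ E] [NormedAddCommGroup F] [NormedSpace ℂ F] [FiniteDimensional ℂ E]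
    [CompleteSpace F] {X : E → F} {U s : Set E} (hU : IsOpen U) (hX : DifferentiableOn ℂ X U)
    (hs : s ⊆ U) : LocallyLipschitzOn s X := by
  intro x hx
  have h1 : ContDiffAt ℂ 1 X x := (contDiffOn_one_of_differentiableOn hU hX).contDiffAt
    (hU.mem_nhds (hs hx))
  obtain ⟨K, t, ht, hl⟩ := h1.exists_lipschitzOnWith
  exact ⟨K, t, mem_nhdsWithin_of_mem_nhds ht, hl⟩

/-- Backward uniqueness, the source of injectivity of the flow. The two trajectories form a compact
set, on which the locally Lipschitz field is Lipschitz. -/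
theorem integralCurve_initial_eq {X : Phase n → Phase n} {U : Set (Phase n)} (hU : IsOpen U)
    (hX : DifferentiableOn ℂ X U) {γ₁ γ₂ : ℝ → Phase n}
    (h1 : ∀ t ∈ Icc (0 : ℝ) 1, HasDerivWithinAt γ₁ (X (γ₁ t)) (Icc 0 1) t)
    (h2 : ∀ t ∈ Icc (0 : ℝ) 1, HasDerivWithinAt γ₂ (X (γ₂ t)) (Icc 0 1) t)
    (m1 : ∀ t ∈ Icc (0 : ℝ) 1, γ₁ t ∈ U) (m2 : ∀ t ∈ Icc (0 : ℝ) 1, γ₂ t ∈ U)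
    (he : γ₁ 1 = γ₂ 1) : γ₁ 0 = γ₂ 0 := by
  have c1 : ContinuousOn γ₁ (Icc 0 1) := fun t ht => (h1 t ht).continuousWithinAt
  have c2 : ContinuousOn γ₂ (Icc 0 1) := fun t ht => (h2 t ht).continuousWithinAt
  set s := γ₁ '' Icc 0 1 ∪ γ₂ '' Icc 0 1 with hs
  have hsc : IsCompact s := (isCompact_Icc.image_of_continuousOn c1).union
    (isCompact_Icc.image_of_continuousOn c2)
  have hsU : s ⊆ U := by
    rintro _ (⟨t, ht, rfl⟩ | ⟨t, ht, rfl⟩)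
    exacts [m1 t ht, m2 t ht]
  obtain ⟨K, hK⟩ := (locallyLipschitzOn_of_differentiableOn hU hX hsU).exists_lipschitzOnWith_of_compact
    hsc
  have hnb : ∀ t ∈ Ioc (0 : ℝ) 1, Icc (0 : ℝ) 1 ∈ 𝓝[≤] t := fun t ht =>
    mem_of_superset (Icc_mem_nhdsLE ht.1) (Icc_subset_Icc le_rfl ht.2)
  exact ODE_solution_unique_of_mem_Icc_left (v := fun _ => X) (s := fun _ => s) (K := K)
    (fun _ _ => hK) c1
    (fun t ht => (h1 t ⟨ht.1.le, ht.2⟩).mono_of_mem_nhdsWithin (hnb t ht))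
    (fun t ht => Or.inl ⟨t, ⟨ht.1.le, ht.2⟩, rfl⟩) c2
    (fun t ht => (h2 t ⟨ht.1.le, ht.2⟩).mono_of_mem_nhdsWithin (hnb t ht))
    (fun t ht => Or.inr ⟨t, ⟨ht.1.le, ht.2⟩, rfl⟩) he ⟨le_rfl, zero_le_one⟩

/-- Integral curves in a polydisc whose polyradii dominate the two components of the field. -/
theorem exists_integralCurve {X : Phase n → Phase n} {U : Set (Phase n)} (hU : IsOpen U)
    (hX : DifferentiableOn ℂ X U) {p : Phase n} {ρ σ : ℝ} (hρ : 0 < ρ) (hσ : 0 < σ)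
    (hsub : ∀ v : Phase n, ‖WithLp.toLp 2 v.1‖ ≤ ρ → (∀ i, ‖v.2 i‖ ≤ σ) → p + v ∈ U)
    (hb1 : ∀ q ∈ U, ‖WithLp.toLp 2 (X q).1‖ ≤ ρ) (hb2 : ∀ q ∈ U, ∀ i, ‖(X q).2 i‖ ≤ σ) :
    ∃ γ : ℝ → Phase n, γ 0 = p ∧ ∀ t ∈ Icc (0 : ℝ) 1, γ t ∈ U ∧
      HasDerivWithinAt γ (X (γ t)) (Icc 0 1) t := by
  -- In the max of the Euclidean norm on actions and the sup norm on angles, scaled by ρ and σ, the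
  -- polydisc becomes the unit ball and the field has speed at most 1.
  set E := EuclideanSpace ℂ (Fin n) × (Fin n → ℂ)
  set T : E →L[ℂ] Phase n := ((ρ : ℂ) • ((EuclideanSpace.equiv (Fin n) ℂ).toContinuousLinearMap.comp
    (ContinuousLinearMap.fst ℂ _ _))).prod ((σ : ℂ) • ContinuousLinearMap.snd ℂ _ _) with hT
  set T' : Phase n →L[ℂ] E := ((ρ : ℂ)⁻¹ • ((EuclideanSpace.equiv (Fin n) ℂ).symm.toContinuousLinearMap.comp
    (ContinuousLinearMap.fst ℂ _ _))).prod ((σ : ℂ)⁻¹ • ContinuousLinearMap.snd ℂ _ _) with hT'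
  have hT1 : ∀ w i, (T w).1 i = ρ * w.1 i := fun _ _ => rfl
  have hT2 : ∀ w i, (T w).2 i = σ * w.2 i := fun _ _ => rfl
  have hT'1 : ∀ v i, (T' v).1 i = (ρ : ℂ)⁻¹ * v.1 i := fun _ _ => rfl
  have hT'2 : ∀ v i, (T' v).2 i = (σ : ℂ)⁻¹ * v.2 i := fun _ _ => rfl
  have hρ' : (ρ : ℂ) ≠ 0 := by exact_mod_cast hρ.ne'
  have hσ' : (σ : ℂ) ≠ 0 := by exact_mod_cast hσ.ne'
  have hTT : ∀ v, T (T' v) = v := by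
    intro v
    refine Prod.ext ?_ ?_
    · ext i; rw [hT1, hT'1, mul_inv_cancel_left₀ hρ']
    · ext i; rw [hT2, hT'2, mul_inv_cancel_left₀ hσ']
  have hTn : ∀ w : E, ‖w‖ ≤ 1 → p + T w ∈ U := by
    intro w hw
    have hw1 : ‖w.1‖ ≤ 1 := (norm_fst_le w).trans hw
    have hw2 : ‖w.2‖ ≤ 1 := (norm_snd_le w).trans hw
    refine hsub _ ?_ fun i => ?_
    · have : WithLp.toLp 2 (T w).1 = (ρ : ℂ) • w.1 := by ext i; exact hT1 w i
      rw [this, norm_smul, Complex.norm_real, Real.norm_of_nonneg hρ.le]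
      nlinarith
    · rw [hT2, norm_mul, Complex.norm_real, Real.norm_of_nonneg hσ.le]
      have := (norm_le_pi_norm w.2 i).trans hw2
      nlinarith
  have hT'n : ∀ q ∈ U, ‖T' (X q)‖ ≤ 1 := by
    intro q hq
    refine (Prod.norm_def _).trans_le (max_le ?_ ?_)
    · have : (T' (X q)).1 = (ρ : ℂ)⁻¹ • WithLp.toLp 2 (X q).1 := by ext i; exact hT'1 _ i
      rw [this, norm_smul, norm_inv, Complex.norm_real, Real.norm_of_nonneg hρ.le,
        inv_mul_le_iff₀ hρ, mul_one]
      exact hb1 q hq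
    · refine (pi_norm_le_iff_of_nonneg zero_le_one).2 fun i => ?_
      rw [hT'2, norm_mul, norm_inv, Complex.norm_real, Real.norm_of_nonneg hσ.le,
        inv_mul_le_iff₀ hσ, mul_one]
      exact hb2 q hq i
  set Y : E → E := fun w => T' (X (p + T w)) with hY
  set W : Set E := (fun w => p + T w) ⁻¹' U with hW
  have hWo : IsOpen W := hU.preimage (by fun_prop)
  have hYd : DifferentiableOn ℂ Y W :=
    T'.differentiable.comp_differentiableOn (hX.comp (by fun_prop) fun w hw => hw)
  have hball : closedBall (0 : E) 1 ⊆ W := fun w hw => hTn w (by simpa using hw)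
  have : ProperSpace E := FiniteDimensional.proper ℂ E
  obtain ⟨K, hK⟩ := (locallyLipschitzOn_of_differentiableOn hWo hYd hball).exists_lipschitzOnWith_of_compact
    (isCompact_closedBall 0 1)
  -- Radius 1, speed 1 and time 1 satisfy the Picard–Lindelöf condition with equality.
  have hPL : IsPicardLindelof (fun _ => Y) (tmin := 0) (tmax := 1) ⟨0, by simp⟩ (0 : E) 1 0 1 K :=
    { lipschitzOnWith := fun _ _ => by simpa using hK
      continuousOn := fun _ _ => continuousOn_const
      norm_le := fun _ _ w hw => by simpa using hT'n _ (hball (by simpa using hw))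
      mul_max_le := by simp }
  -- Working with the fixed point itself keeps the information that the curve never leaves the ball.
  obtain ⟨α, hα⟩ := ODE.FunSpace.exists_isFixedPt_next hPL (mem_closedBall_self le_rfl)
  have hαmem : ∀ t, α.compProj t ∈ closedBall (0 : E) 1 := fun t => by
    have := α.compProj_mem_closedBall hPL.mul_max_le (t := t)
    simpa using this
  have hα0 : α.compProj 0 = 0 := by
    have := ODE.FunSpace.compProj_val (t := ⟨0, by simp⟩) (α := α)
    rw [this, ← hα, ODE.FunSpace.next_apply₀]
  have hαd : ∀ t ∈ Icc (0 : ℝ) 1, HasDerivWithinAt α.compProj (Y (α.compProj t)) (Icc 0 1) t := by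
    intro t ht
    apply ODE.hasDerivWithinAt_picard_Icc (by simp : (0 : ℝ) ∈ Icc (0 : ℝ) 1) hPL.continuousOn_uncurry
      α.continuous_compProj.continuousOn (fun _ _ ↦ α.compProj_mem_closedBall hPL.mul_max_le)
      0 ht |>.congr_of_mem _ ht
    intro t' ht'
    nth_rw 1 [← hα]
    rw [ODE.FunSpace.compProj_of_mem ht', ODE.FunSpace.next_apply]
  refine ⟨fun t => p + T (α.compProj t), by
    change p + T (α.compProj 0) = p
    rw [hα0, map_zero, add_zero], fun t ht => ⟨hball (hαmem t), ?_⟩⟩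
  have := (T.restrictScalars ℝ).hasFDerivAt.comp_hasDerivWithinAt t (hαd t ht)
  have h2 := this.const_add p
  convert! h2 using 1
  simp [hY, hTT]

end Flows

/-! ### The time-one flow as a convergent Lie series, and its symplecticity. -/

section LieSeries

variable {n : ℕ} {D : Set (Fin n → ℝ)}

/-! ### The symplectic form -/

theorem symplForm_comm (u v : Phase n) : symplForm u v = -symplForm v u := by
  rw [symplForm, symplForm, ← Finset.sum_neg_distrib]
  exact Finset.sum_congr rfl fun i _ => by ring

theorem hasDerivAt_symplForm {a b : ℝ → Phase n} {a' b' : Phase n} {t : ℝ}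
    (ha : HasDerivAt a a' t) (hb : HasDerivAt b b' t) :
    HasDerivAt (fun t => symplForm (a t) (b t)) (symplForm a' (b t) + symplForm (a t) b') t := by
  have h1 : ∀ {c : ℝ → Phase n} {c' : Phase n}, HasDerivAt c c' t → ∀ i,
      HasDerivAt (fun t => (c t).1 i) (c'.1 i) t ∧ HasDerivAt (fun t => (c t).2 i) (c'.2 i) t :=
    fun hc i => ⟨hasDerivAt_pi.1 hc.fst i, hasDerivAt_pi.1 hc.snd i⟩
  have h2 : HasDerivAt (fun t => symplForm (a t) (b t))
      (∑ i, ((a'.1 i * (b t).2 i + (a t).1 i * b'.2 i) -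
        (a'.2 i * (b t).1 i + (a t).2 i * b'.1 i))) t := by
    unfold symplForm
    exact HasDerivAt.fun_sum fun i _ =>
      ((h1 ha i).1.mul (h1 hb i).2).sub ((h1 ha i).2.mul (h1 hb i).1)
  convert! h2 using 1
  rw [symplForm, symplForm, ← Finset.sum_add_distrib]
  exact Finset.sum_congr rfl fun i _ => by ring

theorem continuousOn_symplForm {a b : ℝ → Phase n} {s : Set ℝ}
    (ha : ContinuousOn a s) (hb : ContinuousOn b s) :
    ContinuousOn (fun t => symplForm (a t) (b t)) s := by
  unfold symplForm
  fun_prop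

theorem fderiv_symplForm_left {X : Phase n → Phase n} {q : Phase n} (hX : DifferentiableAt ℂ X q)
    (w a : Phase n) :
    fderiv ℂ (fun q => symplForm (X q) w) q a = symplForm (fderiv ℂ X q a) w := by
  have hpath : HasDerivAt (fun t : ℂ => q + t • a) a 0 := by
    simpa using ((hasDerivAt_id (0 : ℂ)).smul_const a).const_add q
  have h1 : HasDerivAt (fun t : ℂ => X (q + t • a)) (fderiv ℂ X q a) 0 := by
    have h2 : HasFDerivAt X (fderiv ℂ X q) (q + (0 : ℂ) • a) := by simpa using hX.hasFDerivAt
    exact h2.comp_hasDerivAt (0 : ℂ) hpath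
  have h3 : DifferentiableAt ℂ (fun q => symplForm (X q) w) q := by
    unfold symplForm
    fun_prop
  have h4 : HasDerivAt (fun t : ℂ => symplForm (X (q + t • a)) w)
      (fderiv ℂ (fun q => symplForm (X q) w) q a) 0 := by
    have h2 : HasFDerivAt (fun q => symplForm (X q) w) (fderiv ℂ (fun q => symplForm (X q) w) q)
      (q + (0 : ℂ) • a) := by simpa using h3.hasFDerivAt
    exact h2.comp_hasDerivAt (0 : ℂ) hpath
  refine h4.unique ?_
  unfold symplForm
  refine HasDerivAt.fun_sum fun i _ => HasDerivAt.sub ?_ ?_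
  · exact (hasDerivAt_pi.1 h1.fst i).mul_const _
  · exact (hasDerivAt_pi.1 h1.snd i).mul_const _

/-! ### Lie series and the flow of a trigonometric Hamiltonian -/

/-- A generating Hamiltonian `ev c` on `D_R × 𝕋ⁿ_{S₀}`, with margins `ρ` and `σ` for which its
Lie series converges. -/
structure Generator (D : Set (Fin n → ℝ)) (R S₀ C ρ σ : ℝ) (S : Finset (Fin n → ℤ))
    (c : Coeffs n) : Prop where
  modes : ∀ k ∉ S, c k = 0
  symm : ∀ k, -k ∈ S ↔ k ∈ S
  bdd : FourierBdd D R S₀ C c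
  conj : ConjSymm D R c
  rho_pos : 0 < ρ
  sigma_pos : 0 < σ
  width : 3 * σ < S₀
  small : 2 * C / (ρ * σ) < 1

/-- Iterated Lie derivatives of the Hamiltonian vector field. -/
def hamIter (S : Finset (Fin n → ℤ)) (c : Coeffs n) (j : ℕ) (p : Phase n) : Phase n :=
  (fun i => ev ((lie S c)^[j] (hamY c i)) p, fun i => ev ((lie S c)^[j] (hamX c i)) p)

/-- The Lie series of the time-`τ` flow. -/
def lieFlow (S : Finset (Fin n → ℤ)) (c : Coeffs n) (τ : ℝ) (p : Phase n) : Phase n :=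
  p + ∑' j, (τ ^ (j + 1) / ((j + 1).factorial : ℝ)) • hamIter S c j p

/-- The weighted Lie series `∑_j L^j b / (j+m)!`. -/
def lieSum (S : Finset (Fin n → ℤ)) (c : Coeffs n) (m : ℕ) (b : Coeffs n) : Coeffs n :=
  sumFamily fun j => (((j + m).factorial : ℝ)⁻¹ : ℂ) • (lie S c)^[j] b

theorem FourierBdd.smul {r s M : ℝ} {a : Coeffs n} (ha : FourierBdd D r s M a) (x : ℂ) :
    FourierBdd D r s (‖x‖ * M) (x • a) where
  nonneg := mul_nonneg (norm_nonneg _) ha.nonneg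
  holo k := (ha.holo k).const_smul x
  bound y hy F := by
    have := mul_le_mul_of_nonneg_left (ha.bound y hy F) (norm_nonneg x)
    rw [Finset.mul_sum] at this
    refine le_trans (le_of_eq (Finset.sum_congr rfl fun k _ => ?_)) this
    simp [mul_assoc]

theorem ev_smul (x : ℂ) (a : Coeffs n) (p : Phase n) : ev (x • a) p = x * ev a p := by
  simp only [ev, ← tsum_mul_left]
  exact tsum_congr fun k => by simp [mul_assoc]

theorem differentiableOn_phase {f g : Fin n → Phase n → ℂ} {U : Set (Phase n)}
    (hf : ∀ i, DifferentiableOn ℂ (f i) U) (hg : ∀ i, DifferentiableOn ℂ (g i) U) :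
    DifferentiableOn ℂ (fun p => ((fun i => f i p, fun i => g i p) : Phase n)) U :=
  (differentiableOn_pi.2 hf).prodMk (differentiableOn_pi.2 hg)

namespace Generator

variable {R S₀ C ρ σ : ℝ} {S : Finset (Fin n → ℤ)} {c : Coeffs n}

theorem q_nonneg (g : Generator D R S₀ C ρ σ S c) : 0 ≤ 2 * C / (ρ * σ) := by
  have := g.bdd.nonneg
  have := g.rho_pos
  have := g.sigma_pos
  positivity

theorem bdd_iterate (g : Generator D R S₀ C ρ σ S c) {b : Coeffs n} {B : ℝ}
    (hb : FourierBdd D (R - ρ) (S₀ - σ) B b) (j : ℕ) :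
    FourierBdd D (R - 2 * ρ) (S₀ - 2 * σ) (B * (2 * C / (ρ * σ)) ^ j * (j.factorial : ℝ))
      ((lie S c)^[j] b) :=
  g.bdd.lie_iterate hb g.rho_pos g.sigma_pos (by linarith [g.width, g.sigma_pos]) j

theorem bdd_hamY (g : Generator D R S₀ C ρ σ S c) (i : Fin n) :
    FourierBdd D (R - ρ) (S₀ - σ) (C / (Real.exp 1 * σ)) (hamY c i) :=
  (g.bdd.hamY g.sigma_pos (by linarith) i).mono (by linarith [g.rho_pos]) le_rfl le_rfl

theorem bdd_hamX (g : Generator D R S₀ C ρ σ S c) (i : Fin n) :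
    FourierBdd D (R - ρ) (S₀ - σ) (C / ρ) (hamX c i) :=
  (g.bdd.hamX g.rho_pos (by linarith) i).mono le_rfl (by linarith [g.sigma_pos]) le_rfl

theorem norm_hamIter_le (g : Generator D R S₀ C ρ σ S c) (j : ℕ) {p : Phase n}
    (hp : p ∈ phaseDomain D (R - 2 * ρ) (S₀ - 2 * σ)) :
    ‖hamIter S c j p‖ ≤ (j.factorial : ℝ) *
      ((C / (Real.exp 1 * σ) + C / ρ) * (2 * C / (ρ * σ)) ^ j) := by
  have hC := g.bdd.nonneg
  have hρ := g.rho_pos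
  have hσ := g.sigma_pos
  have h1 : 0 ≤ C / (Real.exp 1 * σ) := by positivity
  have h2 : 0 ≤ C / ρ := by positivity
  have hq := g.q_nonneg
  refine (Prod.norm_def _).trans_le (max_le ?_ ?_)
  · refine (pi_norm_le_iff_of_nonneg (by positivity)).2 fun i => ?_
    refine ((g.bdd_iterate (g.bdd_hamY i) j).norm_ev_le hp).trans ?_
    rw [mul_comm]
    gcongr
    linarith
  · refine (pi_norm_le_iff_of_nonneg (by positivity)).2 fun i => ?_
    refine ((g.bdd_iterate (g.bdd_hamX i) j).norm_ev_le hp).trans ?_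
    rw [mul_comm]
    gcongr
    linarith

theorem width_pos (g : Generator D R S₀ C ρ σ S c) : 0 < S₀ - 2 * σ := by
  linarith [g.width, g.sigma_pos]

theorem differentiableOn_hamIter (g : Generator D R S₀ C ρ σ S c) (j : ℕ) :
    DifferentiableOn ℂ (hamIter S c j) (phaseDomain D (R - 2 * ρ) (S₀ - 2 * σ)) :=
  differentiableOn_phase
    (fun i => (g.bdd_iterate (g.bdd_hamY i) j).differentiableOn_ev g.width_pos)
    (fun i => (g.bdd_iterate (g.bdd_hamX i) j).differentiableOn_ev g.width_pos)

theorem fderiv_ev_iterate (g : Generator D R S₀ C ρ σ S c) {b : Coeffs n} {B : ℝ}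
    (hb : FourierBdd D (R - ρ) (S₀ - σ) B b) (j : ℕ) {p : Phase n}
    (hp : p ∈ phaseDomain D (R - 2 * ρ) (S₀ - 2 * σ)) :
    fderiv ℂ (ev ((lie S c)^[j] b)) p (hamVec c p) = ev ((lie S c)^[j + 1] b) p := by
  rw [fderiv_ev_hamVec g.modes (g.bdd_iterate hb j) g.width_pos hp, Function.iterate_succ_apply']

theorem hasDerivWithinAt_ev_iterate (g : Generator D R S₀ C ρ σ S c) {b : Coeffs n} {B : ℝ}
    (hb : FourierBdd D (R - ρ) (S₀ - σ) B b) (j : ℕ) {γ : ℝ → Phase n} {t : ℝ} {s : Set ℝ}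
    (hp : γ t ∈ phaseDomain D (R - 2 * ρ) (S₀ - 2 * σ))
    (hγ : HasDerivWithinAt γ (hamVec c (γ t)) s t) :
    HasDerivWithinAt (fun t => ev ((lie S c)^[j] b) (γ t)) (ev ((lie S c)^[j + 1] b) (γ t))
      s t := by
  have h1 := ((g.bdd_iterate hb j).hasFDerivAt_ev g.width_pos hp).1.hasFDerivAt
  have h2 := (h1.restrictScalars ℝ).comp_hasDerivWithinAt t hγ
  rw [← g.fderiv_ev_iterate hb j hp]
  exact h2

theorem hasDerivWithinAt_hamIter (g : Generator D R S₀ C ρ σ S c) (j : ℕ) {γ : ℝ → Phase n}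
    {t : ℝ} {s : Set ℝ} (hp : γ t ∈ phaseDomain D (R - 2 * ρ) (S₀ - 2 * σ))
    (hγ : HasDerivWithinAt γ (hamVec c (γ t)) s t) :
    HasDerivWithinAt (fun t => hamIter S c j (γ t)) (hamIter S c (j + 1) (γ t)) s t :=
  (hasDerivWithinAt_pi.2 fun i => g.hasDerivWithinAt_ev_iterate (g.bdd_hamY i) j hp hγ).prodMk
    (hasDerivWithinAt_pi.2 fun i => g.hasDerivWithinAt_ev_iterate (g.bdd_hamX i) j hp hγ)

theorem sum_norm_hamVec_le (g : Generator D R S₀ C ρ σ S c) {p : Phase n}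
    (hp : p ∈ phaseDomain D (R - 2 * ρ) (S₀ - 2 * σ)) :
    ∑ i, ‖(hamVec c p).1 i‖ ≤ C / (Real.exp 1 * σ) :=
  g.bdd.sum_norm_ev_hamY_le g.modes g.sigma_pos (s' := S₀ - σ) (by linarith)
    (phaseDomain_mono (by linarith [g.rho_pos]) (by linarith [g.sigma_pos]) hp)

theorem norm_hamVec_snd_le (g : Generator D R S₀ C ρ σ S c) {p : Phase n}
    (hp : p ∈ phaseDomain D (R - 2 * ρ) (S₀ - 2 * σ)) (i : Fin n) :
    ‖(hamVec c p).2 i‖ ≤ C / ρ :=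
  (g.bdd_hamX i).norm_ev_le
    (phaseDomain_mono (by linarith [g.rho_pos]) (by linarith [g.sigma_pos]) hp)

/-- From 2C < ρσ the speeds are at most ρ in the actions and σ in the angles, so in unit time a
curve crosses at most the third layer of the margin. -/
theorem exists_curve (g : Generator D R S₀ C ρ σ S c) {p : Phase n}
    (hp : p ∈ phaseDomain D (R - 3 * ρ) (S₀ - 3 * σ)) :
    ∃ γ : ℝ → Phase n, γ 0 = p ∧ ∀ t ∈ Icc (0 : ℝ) 1,
      γ t ∈ phaseDomain D (R - 2 * ρ) (S₀ - 2 * σ) ∧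
      HasDerivWithinAt γ (hamVec c (γ t)) (Icc 0 1) t := by
  have hC := g.bdd.nonneg
  have hρ := g.rho_pos
  have hσ := g.sigma_pos
  have hq := g.small
  rw [div_lt_one (by positivity)] at hq
  refine exists_integralCurve (isOpen_phaseDomain _ _ _) (g.differentiableOn_hamIter 0) hρ hσ
    (fun v hv1 hv2 => ⟨add_mem_actionDomain hp.1 hv1 (by linarith),
      add_mem_angleStrip hp.2 hv2 (by linarith)⟩) (fun q hq' => ?_) fun q hq' i => ?_
  · refine (norm_toLp_le_sum _).trans ((g.sum_norm_hamVec_le hq').trans ?_)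
    have h1 : (1 : ℝ) ≤ Real.exp 1 := Real.one_le_exp zero_le_one
    rw [div_le_iff₀ (by positivity)]
    have : ρ * σ ≤ ρ * (Real.exp 1 * σ) := by nlinarith [mul_pos hρ hσ]
    linarith
  · refine (g.norm_hamVec_snd_le hq' i).trans ?_
    rw [div_le_iff₀ hρ]
    linarith

/-- The successive time derivatives of the curve are the values of `hamIter` along it, and
`norm_hamIter_le` makes the Taylor series converge up to time 1. The second identity, the same
expansion for the field, later gives the variational equation. -/
theorem lieFlow_eq_curve (g : Generator D R S₀ C ρ σ S c) {γ : ℝ → Phase n}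
    (hγ : ∀ t ∈ Icc (0 : ℝ) 1, γ t ∈ phaseDomain D (R - 2 * ρ) (S₀ - 2 * σ) ∧
      HasDerivWithinAt γ (hamVec c (γ t)) (Icc 0 1) t) {τ : ℝ} (hτ : τ ∈ Icc (0 : ℝ) 1) :
    lieFlow S c τ (γ 0) = γ τ ∧
      hamVec c (γ τ) = ∑' j, (τ ^ j / (j.factorial : ℝ)) • hamIter S c j (γ 0) := by
  set B := C / (Real.exp 1 * σ) + C / ρ
  set q := 2 * C / (ρ * σ)
  have hq0 : 0 ≤ q := g.q_nonneg
  have hs : Summable fun j : ℕ => B * q ^ j :=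
    (summable_geometric_of_lt_one hq0 g.small).mul_left B
  constructor
  · set u : ℕ → ℝ → Phase n := fun j => Nat.casesOn j γ fun j t => hamIter S c j (γ t) with hu
    have := hasSum_taylor (u := u) hs (fun j t ht => ?_)
      (fun j t ht => g.norm_hamIter_le j (hγ t ht).1) hτ
    · have h1 := this.tsum_eq
      change γ 0 + ∑' j, (τ ^ (j + 1) / ((j + 1).factorial : ℝ)) • u (j + 1) 0 = u 0 τ
      rw [h1]
      exact add_sub_cancel _ _
    · cases j with
      | zero => exact (hγ t ht).2
      | succ j => exact g.hasDerivWithinAt_hamIter j (hγ t ht).1 (hγ t ht).2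
  -- Starting the chain at the field shifts the factorial by one, which costs the factor j + 1.
  · have hs2 : Summable fun j : ℕ => ((j : ℝ) + 1) * (B * q ^ (j + 1)) := by
      have h1 := summable_pow_mul_geometric_of_norm_lt_one 1 (r := q)
        (by rw [Real.norm_of_nonneg hq0]; exact g.small)
      have h2 := ((summable_nat_add_iff 1).2 h1).mul_left B
      refine h2.congr fun j => ?_
      push_cast
      ring
    have := hasSum_taylor (u := fun j t => hamIter S c j (γ t)) hs2
      (fun j t ht => g.hasDerivWithinAt_hamIter j (hγ t ht).1 (hγ t ht).2)
      (fun j t ht => ?_) hτ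
    · have h3 := (hasSum_nat_add_iff' (f := fun j => (τ ^ j / (j.factorial : ℝ)) •
        hamIter S c j (γ 0)) (g := hamVec c (γ τ)) 1).1 (by
          rw [Finset.sum_range_one, pow_zero, Nat.factorial_zero, Nat.cast_one, div_one, one_smul]
          exact this)
      exact h3.tsum_eq.symm
    · refine (g.norm_hamIter_le (j + 1) (hγ t ht).1).trans (le_of_eq ?_)
      rw [Nat.factorial_succ]
      push_cast
      ring

theorem norm_lieFlow_term_le (g : Generator D R S₀ C ρ σ S c) {τ : ℝ} (hτ : τ ∈ Icc (0 : ℝ) 1)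
    (j m : ℕ) {p : Phase n} (hp : p ∈ phaseDomain D (R - 2 * ρ) (S₀ - 2 * σ)) :
    ‖(τ ^ (j + m) / ((j + m).factorial : ℝ)) • hamIter S c j p‖ ≤
      (C / (Real.exp 1 * σ) + C / ρ) * (2 * C / (ρ * σ)) ^ j := by
  have hfac : ∀ j : ℕ, (0 : ℝ) < j.factorial := fun j => by exact_mod_cast j.factorial_pos
  rw [norm_smul, norm_div, norm_pow, Real.norm_of_nonneg (hfac _).le, Real.norm_of_nonneg hτ.1]
  have h1 : τ ^ (j + m) ≤ 1 := pow_le_one₀ hτ.1 hτ.2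
  have h3 : (j.factorial : ℝ) ≤ (j + m).factorial := by
    exact_mod_cast Nat.factorial_le (Nat.le_add_right j m)
  have := hfac j
  calc _ ≤ 1 / (j.factorial : ℝ) * ((j.factorial : ℝ) *
      ((C / (Real.exp 1 * σ) + C / ρ) * (2 * C / (ρ * σ)) ^ j)) := by
        gcongr
        exact g.norm_hamIter_le j hp
    _ = _ := by field_simp

theorem summable_bound (g : Generator D R S₀ C ρ σ S c) :
    Summable fun j : ℕ => (C / (Real.exp 1 * σ) + C / ρ) * (2 * C / (ρ * σ)) ^ j :=
  (summable_geometric_of_lt_one g.q_nonneg g.small).mul_left _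

theorem hasFDerivAt_series (g : Generator D R S₀ C ρ σ S c) {τ : ℝ} (hτ : τ ∈ Icc (0 : ℝ) 1)
    (m : ℕ) {p : Phase n} (hp : p ∈ phaseDomain D (R - 2 * ρ) (S₀ - 2 * σ)) :
    DifferentiableAt ℂ (fun p => ∑' j, (τ ^ (j + m) / ((j + m).factorial : ℝ)) •
      hamIter S c j p) p ∧ ∀ u : Phase n,
    fderiv ℂ (fun p => ∑' j, (τ ^ (j + m) / ((j + m).factorial : ℝ)) • hamIter S c j p) p u =
      ∑' j, (τ ^ (j + m) / ((j + m).factorial : ℝ)) • fderiv ℂ (hamIter S c j) p u := by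
  have hd : ∀ j, DifferentiableAt ℂ (hamIter S c j) p := fun j =>
    (g.differentiableOn_hamIter j).differentiableAt ((isOpen_phaseDomain _ _ _).mem_nhds hp)
  obtain ⟨h1, h2⟩ := hasFDerivAt_tsum_of_bound (isOpen_phaseDomain D (R - 2 * ρ) (S₀ - 2 * σ))
    (f := fun j p => (τ ^ (j + m) / ((j + m).factorial : ℝ)) • hamIter S c j p)
    g.summable_bound (fun j => (g.differentiableOn_hamIter j).fun_const_smul _)
    (fun j x hx => g.norm_lieFlow_term_le hτ j m hx) hp
  refine ⟨h2.differentiableAt, fun u => ?_⟩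
  rw [h2.fderiv]
  have h3 := (h1.hasSum.mapL (ContinuousLinearMap.apply ℂ (Phase n) u)).tsum_eq
  rw [ContinuousLinearMap.apply_apply] at h3
  rw [← h3]
  refine tsum_congr fun j => ?_
  rw [ContinuousLinearMap.apply_apply, fderiv_fun_const_smul (hd j)]
  rfl

theorem fderiv_lieFlow (g : Generator D R S₀ C ρ σ S c) {τ : ℝ} (hτ : τ ∈ Icc (0 : ℝ) 1)
    {p : Phase n} (hp : p ∈ phaseDomain D (R - 2 * ρ) (S₀ - 2 * σ)) :
    DifferentiableAt ℂ (lieFlow S c τ) p ∧ ∀ u : Phase n, fderiv ℂ (lieFlow S c τ) p u =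
      u + ∑' j, (τ ^ (j + 1) / ((j + 1).factorial : ℝ)) • fderiv ℂ (hamIter S c j) p u := by
  obtain ⟨h1, h2⟩ := g.hasFDerivAt_series hτ 1 hp
  refine ⟨differentiableAt_fun_id.add h1, fun u => ?_⟩
  rw [← h2 u]
  have := ((hasFDerivAt_id (𝕜 := ℂ) p).add h1.hasFDerivAt).fderiv
  exact congrArg (fun L => L u) this

theorem norm_fderiv_hamIter_le (g : Generator D R S₀ C ρ σ S c) {p : Phase n}
    (hp : p ∈ phaseDomain D (R - 2 * ρ) (S₀ - 2 * σ)) (u : Phase n) :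
    ∃ A, 0 ≤ A ∧ ∀ j, ‖fderiv ℂ (hamIter S c j) p u‖ ≤
      (j.factorial : ℝ) * (A * (2 * C / (ρ * σ)) ^ j) := by
  obtain ⟨δ, hδ, hsub⟩ := Metric.isOpen_iff.1 (isOpen_phaseDomain D (R - 2 * ρ) (S₀ - 2 * σ)) p hp
  have hC := g.bdd.nonneg
  have hρ := g.rho_pos
  have hσ := g.sigma_pos
  refine ⟨2 * (C / (Real.exp 1 * σ) + C / ρ) / δ * ‖u‖, by positivity, fun j => ?_⟩
  have h1 := norm_fderiv_le_of_bound hδ ((g.differentiableOn_hamIter j).mono hsub)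
    fun z hz => g.norm_hamIter_le j (hsub hz)
  refine (ContinuousLinearMap.le_opNorm _ _).trans ?_
  calc _ ≤ _ * ‖u‖ := mul_le_mul_of_nonneg_right h1 (norm_nonneg u)
    _ = _ := by ring

/-- The derivative of the flow solves the variational equation J' = DX(flow) J, and DX is skew for
the symplectic form, so the form is constant in time. -/
theorem symplForm_fderiv_lieFlow (g : Generator D R S₀ C ρ σ S c) {p : Phase n}
    (hp : p ∈ phaseDomain D (R - 3 * ρ) (S₀ - 3 * σ)) (u v : Phase n) :
    symplForm (fderiv ℂ (lieFlow S c 1) p u) (fderiv ℂ (lieFlow S c 1) p v) = symplForm u v := by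
  have hρ := g.rho_pos
  have hσ := g.sigma_pos
  have hsub : phaseDomain D (R - 3 * ρ) (S₀ - 3 * σ) ⊆ phaseDomain D (R - 2 * ρ) (S₀ - 2 * σ) :=
    phaseDomain_mono (by linarith) (by linarith)
  have hp2 := hsub hp
  have hop := isOpen_phaseDomain D (R - 2 * ρ) (S₀ - 2 * σ)
  -- The derivative of the flow written as a power series in time, which can be differentiated in τ
  -- directly.
  set J : Phase n → ℝ → Phase n := fun w τ =>
    w + ∑' j, (τ ^ (j + 1) / ((j + 1).factorial : ℝ)) • fderiv ℂ (hamIter S c j) p w with hJ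
  have hJfd : ∀ w, ∀ τ ∈ Icc (0 : ℝ) 1, J w τ = fderiv ℂ (lieFlow S c τ) p w := fun w τ hτ =>
    ((g.fderiv_lieFlow hτ hp2).2 w).symm
  have hXd : DifferentiableOn ℂ (hamVec c) (phaseDomain D (R - 2 * ρ) (S₀ - 2 * σ)) :=
    g.differentiableOn_hamIter 0
  have hmem : ∀ τ ∈ Icc (0 : ℝ) 1, ∀ q ∈ phaseDomain D (R - 3 * ρ) (S₀ - 3 * σ),
      lieFlow S c τ q ∈ phaseDomain D (R - 2 * ρ) (S₀ - 2 * σ) ∧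
      hamVec c (lieFlow S c τ q) =
        ∑' j, (τ ^ (j + 0) / ((j + 0).factorial : ℝ)) • hamIter S c j q := by
    intro τ hτ q hq
    obtain ⟨γ, h0, hγ⟩ := g.exists_curve hq
    obtain ⟨h1, h2⟩ := g.lieFlow_eq_curve hγ hτ
    rw [h0] at h1 h2
    rw [h1]
    exact ⟨(hγ τ hτ).1, h2⟩
  have hcont : ∀ w, ContinuousOn (J w) (Icc 0 1) := by
    intro w
    obtain ⟨A, -, hA⟩ := g.norm_fderiv_hamIter_le hp2 w
    exact continuousOn_const.add (hasDerivAt_exp_series g.q_nonneg g.small hA).1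
  have hder : ∀ w, ∀ τ ∈ Ico (0 : ℝ) 1,
      HasDerivAt (J w) (fderiv ℂ (hamVec c) (lieFlow S c τ p) (J w τ)) τ := by
    intro w τ hτ
    have hτ' : τ ∈ Icc (0 : ℝ) 1 := ⟨hτ.1, hτ.2.le⟩
    obtain ⟨A, -, hA⟩ := g.norm_fderiv_hamIter_le hp2 w
    have h1 := (hasDerivAt_exp_series g.q_nonneg g.small hA).2 τ hτ
    have h2 : ∑' j, (τ ^ j / (j.factorial : ℝ)) • fderiv ℂ (hamIter S c j) p w =
        fderiv ℂ (hamVec c) (lieFlow S c τ p) (J w τ) := by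
      have h3 := (g.hasFDerivAt_series hτ' 0 hp2).2 w
      simp only [add_zero] at h3
      rw [← h3, hJfd w τ hτ']
      -- The identity between the field along the flow and its series holds in a neighbourhood of p,
      -- so it may be differentiated in the initial point.
      have h4 : (fun q => ∑' j, (τ ^ j / (j.factorial : ℝ)) • hamIter S c j q) =ᶠ[𝓝 p]
          (hamVec c ∘ lieFlow S c τ) := by
        filter_upwards [(isOpen_phaseDomain D (R - 3 * ρ) (S₀ - 3 * σ)).mem_nhds hp] with q hq
        exact ((hmem τ hτ' q hq).2).symm
      rw [h4.fderiv_eq, fderiv_comp p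
        (hXd.differentiableAt (hop.mem_nhds (hmem τ hτ' p hp).1)) (g.fderiv_lieFlow hτ' hp2).1]
      rfl
    rw [← h2]
    exact h1.const_add w
  have hχd : DifferentiableOn ℂ (ev c) (phaseDomain D (R - 2 * ρ) (S₀ - 2 * σ)) :=
    (g.bdd.differentiableOn_ev (by linarith [g.width])).mono
      (phaseDomain_mono (by linarith) (by linarith))
  -- Since ι_X of the form is -dχ, skewness of DX is the symmetry of the second derivative of χ.
  have hskew : ∀ q ∈ phaseDomain D (R - 2 * ρ) (S₀ - 2 * σ), ∀ a b : Phase n,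
      symplForm (fderiv ℂ (hamVec c) q a) b + symplForm a (fderiv ℂ (hamVec c) q b) = 0 := by
    intro q hq a b
    have h1 : ∀ a b : Phase n, symplForm (fderiv ℂ (hamVec c) q a) b =
        -fderiv ℂ (fun q => fderiv ℂ (ev c) q b) q a := by
      intro a b
      rw [← fderiv_symplForm_left (hXd.differentiableAt (hop.mem_nhds hq)) b a]
      have h2 : (fun q => symplForm (hamVec c q) b) =ᶠ[𝓝 q]
          fun q => -fderiv ℂ (ev c) q b := by
        filter_upwards [hop.mem_nhds hq] with z hz
        exact symplForm_hamVec g.modes g.bdd (by linarith [g.width])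
          (phaseDomain_mono (by linarith) (by linarith) hz) b
      rw [h2.fderiv_eq, fderiv_fun_neg]
      rfl
    rw [symplForm_comm a, h1, h1, fderiv_fderiv_apply_comm hop hχd hq a b]
    ring
  have hconst := constant_of_has_deriv_right_zero
    (f := fun τ => symplForm (J u τ) (J v τ)) (a := 0) (b := 1)
    (continuousOn_symplForm (hcont u) (hcont v)) (fun τ hτ => by
      have h1 := hasDerivAt_symplForm (hder u τ hτ) (hder v τ hτ)
      rw [hskew _ (hmem τ ⟨hτ.1, hτ.2.le⟩ p hp).1] at h1
      exact h1.hasDerivWithinAt) 1 ⟨zero_le_one, le_rfl⟩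
  rw [← hJfd u 1 (by simp), ← hJfd v 1 (by simp), hconst]
  simp [hJ]

end Generator

end LieSeries

/-! ### The flow as a symplectic change of variables and its action on observables. -/

section Transformation

variable {n : ℕ} {D : Set (Fin n → ℝ)}

theorem isRealVec_add {z w : Fin n → ℂ} (hz : IsRealVec z) (hw : IsRealVec w) :
    IsRealVec (z + w) := fun i => by simp [hz i, hw i]

theorem SymplecticChange.comp {r s r₁ s₁ r₂ s₂ : ℝ} {Ψ Φ : Phase n → Phase n}
    (hΨ : SymplecticChange D r₁ s₁ r s Ψ) (hΦ : SymplecticChange D r₂ s₂ r₁ s₁ Φ) :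
    SymplecticChange D r₂ s₂ r s (Ψ ∘ Φ) where
  mapsTo := hΨ.mapsTo.comp hΦ.mapsTo
  holomorphic := hΨ.holomorphic.comp hΦ.holomorphic hΦ.mapsTo
  equivariant p hp k := by
    simp only [Function.comp_apply]
    rw [hΦ.equivariant p hp k, hΨ.equivariant _ (hΦ.mapsTo hp) k]
  real p hp h1 h2 := by
    obtain ⟨h3, h4⟩ := hΦ.real p hp h1 h2
    exact hΨ.real _ (hΦ.mapsTo hp) h3 h4
  injective := hΨ.injective.comp hΦ.injective hΦ.mapsTo
  symplectic p hp u v := by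
    have h1 := hΦ.holomorphic.differentiableAt ((isOpen_phaseDomain _ _ _).mem_nhds hp)
    have h2 := hΨ.holomorphic.differentiableAt
      ((isOpen_phaseDomain _ _ _).mem_nhds (hΦ.mapsTo hp))
    rw [fderiv_comp p h2 h1]
    simp only [ContinuousLinearMap.comp_apply]
    rw [hΨ.symplectic _ (hΦ.mapsTo hp), hΦ.symplectic p hp]

theorem SymplecticChange.mono {r s r₁ s₁ r' s' : ℝ} {Φ : Phase n → Phase n}
    (hΦ : SymplecticChange D r₁ s₁ r' s' Φ) (hr : r' ≤ r) (hs : s' ≤ s) :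
    SymplecticChange D r₁ s₁ r s Φ :=
  { hΦ with mapsTo := fun _ hp => phaseDomain_mono hr hs (hΦ.mapsTo hp) }

theorem ConjSymm.smul {r : ℝ} {a : Coeffs n} (ha : ConjSymm D r a) (x : ℝ) :
    ConjSymm D r ((x : ℂ) • a) := fun y hy hr k => by simp [ha y hy hr k]

/-- Duality for the ℓ¹ norm: it reduces the ℓ¹ displacement to the mean value inequality for linear
functionals. -/
theorem sum_norm_le_of_forall_dual {v : Fin n → ℂ} {M : ℝ}
    (h : ∀ w : Fin n → ℂ, (∀ i, ‖w i‖ ≤ 1) → ‖∑ i, w i * v i‖ ≤ M) : ∑ i, ‖v i‖ ≤ M := by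
  have hunit : ∀ z : ℂ, ∃ c : ℂ, ‖c‖ ≤ 1 ∧ c * z = ‖z‖ := by
    intro z
    by_cases hz : z = 0
    · exact ⟨0, by simp, by simp [hz]⟩
    · refine ⟨(‖z‖ : ℂ) / z, ?_, by field_simp⟩
      rw [norm_div, Complex.norm_real, norm_norm, div_self (by simpa using hz)]
  choose c hc1 hc2 using hunit
  have h1 := h (fun i => c (v i)) fun i => hc1 _
  simp only [hc2, ← Complex.ofReal_sum, Complex.norm_real] at h1
  exact (le_abs_self _).trans h1

/-- The new remainder after a step of the normal form algorithm. -/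
def stepRemainder (S : Finset (Fin n → ℤ)) (c a₁ a₂ w : Coeffs n) : Coeffs n :=
  lieSum S c 1 (lie S c a₁) + lieSum S c 1 (lie S c a₂) +
    (lieSum S c 1 (lie S c w) - lieSum S c 2 (lie S c w))

namespace Generator

variable {R S₀ C ρ σ : ℝ} {S : Finset (Fin n → ℤ)} {c : Coeffs n}

theorem conj_iterate (g : Generator D R S₀ C ρ σ S c) {b : Coeffs n} {B : ℝ}
    (hb : FourierBdd D (R - ρ) (S₀ - σ) B b) (hbc : ConjSymm D (R - ρ) b) (j : ℕ) :
    ConjSymm D (R - 2 * ρ) ((lie S c)^[j] b) := by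
  have hρ := g.rho_pos
  induction j with
  | zero => exact hbc.mono (by linarith)
  | succ j ih =>
    rw [Function.iterate_succ_apply']
    exact g.conj.lie g.bdd.holo ih (g.bdd_iterate hb j).holo g.symm (by linarith) le_rfl

theorem isRealVec_hamIter (g : Generator D R S₀ C ρ σ S c) (j : ℕ) {p : Phase n}
    (hp : p.1 ∈ actionDomain D (R - 2 * ρ)) (h1 : IsRealVec p.1) (h2 : IsRealVec p.2) :
    IsRealVec (hamIter S c j p).1 ∧ IsRealVec (hamIter S c j p).2 := by
  have hρ := g.rho_pos
  exact ⟨fun i => (g.conj_iterate (g.bdd_hamY i) ((g.conj.hamY i).mono (by linarith)) j).ev_im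
      hp h1 h2,
    fun i => (g.conj_iterate (g.bdd_hamX i) ((g.conj.hamX g.bdd.holo i).mono
      (by linarith)) j).ev_im hp h1 h2⟩

theorem summable_lieFlow (g : Generator D R S₀ C ρ σ S c) {p : Phase n}
    (hp : p ∈ phaseDomain D (R - 2 * ρ) (S₀ - 2 * σ)) :
    Summable fun j => ((1 : ℝ) ^ (j + 1) / ((j + 1).factorial : ℝ)) • hamIter S c j p :=
  Summable.of_norm_bounded g.summable_bound fun j =>
    g.norm_lieFlow_term_le ⟨zero_le_one, le_rfl⟩ j 1 hp

/-- The series gives holomorphy, equivariance and reality; the integral curve gives the range and,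
through backward uniqueness, injectivity. -/
theorem symplecticChange (g : Generator D R S₀ C ρ σ S c) :
    SymplecticChange D (R - 3 * ρ) (S₀ - 3 * σ) (R - 2 * ρ) (S₀ - 2 * σ) (lieFlow S c 1) := by
  have hρ := g.rho_pos
  have hσ := g.sigma_pos
  have hsub : phaseDomain D (R - 3 * ρ) (S₀ - 3 * σ) ⊆ phaseDomain D (R - 2 * ρ) (S₀ - 2 * σ) :=
    phaseDomain_mono (by linarith) (by linarith)
  have h1 : (1 : ℝ) ∈ Icc (0 : ℝ) 1 := ⟨zero_le_one, le_rfl⟩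
  refine ⟨fun p hp => ?_, fun p hp => ?_, fun p hp k => ?_, fun p hp hr1 hr2 => ?_,
    fun p hp q hq hpq => ?_, fun p hp u v => g.symplForm_fderiv_lieFlow hp u v⟩
  · obtain ⟨γ, h0, hγ⟩ := g.exists_curve hp
    have := (g.lieFlow_eq_curve hγ h1).1
    rw [h0] at this
    rw [this]
    exact (hγ 1 h1).1
  · exact (g.fderiv_lieFlow h1 (hsub hp)).1.differentiableWithinAt
  · have h2 : ∀ j, hamIter S c j (p.1, p.2 + period k) = hamIter S c j p := fun j => by
      simp [hamIter, ev_add_period]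
    simp only [lieFlow, h2]
    refine Prod.ext rfl ?_
    simp only [Prod.snd_add]
    abel
  · have hs := (g.summable_lieFlow (hsub hp)).hasSum
    have key : ∀ L : Phase n →L[ℝ] ℝ, (∀ j, L (hamIter S c j p) = 0) →
        L (∑' j, ((1 : ℝ) ^ (j + 1) / ((j + 1).factorial : ℝ)) • hamIter S c j p) = 0 := by
      intro L hL
      have := (hs.mapL L).tsum_eq
      rw [← this]
      simp [hL]
    have hre := fun j => g.isRealVec_hamIter j (hsub hp).1 hr1 hr2
    refine ⟨isRealVec_add hr1 fun i => ?_, isRealVec_add hr2 fun i => ?_⟩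
    · exact key (Complex.imCLM.comp ((ContinuousLinearMap.proj i).comp
        (ContinuousLinearMap.fst ℝ (Fin n → ℂ) (Fin n → ℂ)))) fun j => (hre j).1 i
    · exact key (Complex.imCLM.comp ((ContinuousLinearMap.proj i).comp
        (ContinuousLinearMap.snd ℝ (Fin n → ℂ) (Fin n → ℂ)))) fun j => (hre j).2 i
  · obtain ⟨γ, h0, hγ⟩ := g.exists_curve hp
    obtain ⟨γ', h0', hγ'⟩ := g.exists_curve hq
    have e1 := (g.lieFlow_eq_curve hγ h1).1
    have e2 := (g.lieFlow_eq_curve hγ' h1).1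
    rw [h0] at e1
    rw [h0'] at e2
    rw [← h0, ← h0']
    exact integralCurve_initial_eq (isOpen_phaseDomain _ _ _) (g.differentiableOn_hamIter 0)
      (fun t ht => (hγ t ht).2) (fun t ht => (hγ' t ht).2) (fun t ht => (hγ t ht).1)
      (fun t ht => (hγ' t ht).1) (by rw [← e1, ← e2]; exact hpq)

theorem displacement (g : Generator D R S₀ C ρ σ S c) {p : Phase n}
    (hp : p ∈ phaseDomain D (R - 3 * ρ) (S₀ - 3 * σ)) :
    ∑ i, ‖(lieFlow S c 1 p).1 i - p.1 i‖ ≤ C / (Real.exp 1 * σ) ∧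
      ∀ i, ‖(lieFlow S c 1 p).2 i - p.2 i‖ ≤ C / ρ := by
  have h1 : (1 : ℝ) ∈ Icc (0 : ℝ) 1 := ⟨zero_le_one, le_rfl⟩
  obtain ⟨γ, h0, hγ⟩ := g.exists_curve hp
  have e1 := (g.lieFlow_eq_curve hγ h1).1
  rw [h0] at e1
  rw [e1]
  have hmv : ∀ (L : Phase n →L[ℝ] ℂ) (M : ℝ), (∀ t ∈ Icc (0 : ℝ) 1, ‖L (hamVec c (γ t))‖ ≤ M) →
      ‖L (γ 1 - p)‖ ≤ M := by
    intro L M hM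
    have := norm_image_sub_le_of_norm_deriv_le_segment' (f := fun t => L (γ t))
      (f' := fun t => L (hamVec c (γ t)))
      (fun t ht => L.hasFDerivAt.comp_hasDerivWithinAt t (hγ t ht).2)
      (fun t ht => hM t ⟨ht.1, ht.2.le⟩) 1 h1
    rw [map_sub, ← h0]
    simpa using this
  constructor
  · refine sum_norm_le_of_forall_dual fun w hw => ?_
    have := hmv (∑ i, (ContinuousLinearMap.mul ℝ ℂ (w i)).comp ((ContinuousLinearMap.proj i).comp
      (ContinuousLinearMap.fst ℝ (Fin n → ℂ) (Fin n → ℂ)))) (C / (Real.exp 1 * σ)) fun t ht => ?_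
    · simpa using this
    · refine le_trans ?_ (g.sum_norm_hamVec_le (hγ t ht).1)
      simp only [_root_.sum_apply, ContinuousLinearMap.comp_apply,
        ContinuousLinearMap.mul_apply', ContinuousLinearMap.proj_apply]
      refine (norm_sum_le _ _).trans (Finset.sum_le_sum fun i _ => ?_)
      rw [norm_mul]
      exact mul_le_of_le_one_left (norm_nonneg _) (hw i)
  · intro i
    exact hmv ((ContinuousLinearMap.proj i).comp
      (ContinuousLinearMap.snd ℝ (Fin n → ℂ) (Fin n → ℂ))) (C / ρ)
      fun t ht => g.norm_hamVec_snd_le (hγ t ht).1 i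

/-- Division by (j + m)! ≥ j! cancels the factorial of `bdd_iterate` and leaves a geometric series.
-/
theorem bdd_lieSum_term (g : Generator D R S₀ C ρ σ S c) {b : Coeffs n} {B : ℝ}
    (hb : FourierBdd D (R - ρ) (S₀ - σ) B b) (m j : ℕ) :
    FourierBdd D (R - 2 * ρ) (S₀ - 2 * σ) (B * (2 * C / (ρ * σ)) ^ j)
      ((((j + m).factorial : ℝ)⁻¹ : ℂ) • (lie S c)^[j] b) := by
  have hq := g.q_nonneg
  have hB := hb.nonneg
  refine ((g.bdd_iterate hb j).smul _).mono le_rfl le_rfl ?_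
  have h3 : (j.factorial : ℝ) ≤ (j + m).factorial := by
    exact_mod_cast Nat.factorial_le (Nat.le_add_right j m)
  have h4 : (0 : ℝ) < (j + m).factorial := by exact_mod_cast (j + m).factorial_pos
  rw [norm_inv, Complex.norm_real, Real.norm_of_nonneg h4.le, inv_mul_le_iff₀ h4, mul_comm]
  gcongr

theorem summable_lieSum (g : Generator D R S₀ C ρ σ S c) (B : ℝ) :
    Summable fun j : ℕ => B * (2 * C / (ρ * σ)) ^ j :=
  (summable_geometric_of_lt_one g.q_nonneg g.small).mul_left _

theorem bdd_lieSum (g : Generator D R S₀ C ρ σ S c) {b : Coeffs n} {B : ℝ}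
    (hb : FourierBdd D (R - ρ) (S₀ - σ) B b) (m : ℕ) :
    FourierBdd D (R - 2 * ρ) (S₀ - 2 * σ) (B / (1 - 2 * C / (ρ * σ))) (lieSum S c m b) := by
  have := FourierBdd.sumFamily (g.bdd_lieSum_term hb m) (g.summable_lieSum B)
  rwa [tsum_mul_left, tsum_geometric_of_lt_one g.q_nonneg g.small, ← div_eq_mul_inv] at this

theorem hasSum_ev_lieSum (g : Generator D R S₀ C ρ σ S c) {b : Coeffs n} {B : ℝ}
    (hb : FourierBdd D (R - ρ) (S₀ - σ) B b) (m : ℕ) {p : Phase n}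
    (hp : p ∈ phaseDomain D (R - 2 * ρ) (S₀ - 2 * σ)) :
    HasSum (fun j => (((j + m).factorial : ℝ)⁻¹ : ℂ) * ev ((lie S c)^[j] b) p)
      (ev (lieSum S c m b) p) := by
  have := FourierBdd.hasSum_ev_sumFamily (g.bdd_lieSum_term hb m) (g.summable_lieSum B) hp
  simp only [ev_smul] at this
  exact this

theorem conj_lieSum (g : Generator D R S₀ C ρ σ S c) {b : Coeffs n} {B : ℝ}
    (hb : FourierBdd D (R - ρ) (S₀ - σ) B b) (hbc : ConjSymm D (R - ρ) b) (m : ℕ) :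
    ConjSymm D (R - 2 * ρ) (lieSum S c m b) := by
  refine ConjSymm.sumFamily fun j => ?_
  have := (g.conj_iterate hb hbc j).smul ((j + m).factorial : ℝ)⁻¹
  rwa [Complex.ofReal_inv] at this

/-- Taylor expansion of an observable along the flow. -/
theorem comp_lieFlow (g : Generator D R S₀ C ρ σ S c) {b : Coeffs n} {B : ℝ}
    (hb : FourierBdd D (R - ρ) (S₀ - σ) B b) {G : Phase n → ℂ}
    (hG : DifferentiableOn ℂ G (phaseDomain D (R - 2 * ρ) (S₀ - 2 * σ)))
    (hGb : ∀ p ∈ phaseDomain D (R - 2 * ρ) (S₀ - 2 * σ),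
      fderiv ℂ G p (hamVec c p) = ev b p) {p : Phase n}
    (hp : p ∈ phaseDomain D (R - 3 * ρ) (S₀ - 3 * σ)) :
    G (lieFlow S c 1 p) = G p + ev (lieSum S c 1 b) p := by
  have hρ := g.rho_pos
  have hσ := g.sigma_pos
  have h1 : (1 : ℝ) ∈ Icc (0 : ℝ) 1 := ⟨zero_le_one, le_rfl⟩
  obtain ⟨γ, h0, hγ⟩ := g.exists_curve hp
  have e1 := (g.lieFlow_eq_curve hγ h1).1
  rw [h0] at e1
  rw [e1]
  set u : ℕ → ℝ → ℂ := fun j => Nat.casesOn j (fun t => G (γ t))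
    fun j t => ev ((lie S c)^[j] b) (γ t) with hu
  have key := hasSum_taylor (u := u) (g.summable_lieSum B) (fun j t ht => ?_)
    (fun j t ht => ?_) h1
  · have e2 : u 0 1 - u 0 0 = G (γ 1) - G p := by simp [hu, h0]
    have e3 := g.hasSum_ev_lieSum hb 1
      (phaseDomain_mono (by linarith) (by linarith) hp)
    have e4 : (fun j => ((1 : ℝ) ^ (j + 1) / ((j + 1).factorial : ℝ)) • u (j + 1) 0) =
        fun j => (((j + 1).factorial : ℝ)⁻¹ : ℂ) * ev ((lie S c)^[j] b) p := by
      ext j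
      simp [hu, h0]
    rw [e4, e2] at key
    rw [← key.unique e3]
    ring
  · cases j with
    | zero =>
      have h2 := (hG.differentiableAt ((isOpen_phaseDomain _ _ _).mem_nhds
        (hγ t ht).1)).hasFDerivAt
      have h3 := (h2.restrictScalars ℝ).comp_hasDerivWithinAt t (hγ t ht).2
      change HasDerivWithinAt (fun t => G (γ t)) (ev b (γ t)) _ t
      rw [← hGb _ (hγ t ht).1]
      exact h3
    | succ j => exact g.hasDerivWithinAt_ev_iterate hb j (hγ t ht).1 (hγ t ht).2
  · refine ((g.bdd_iterate hb j).norm_ev_le (hγ t ht).1).trans (le_of_eq ?_)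
    ring

/-- The term j = 0 is split off; the others are L^j (L b)/(j + 2)!. -/
theorem ev_lieSum_one (g : Generator D R S₀ C ρ σ S c) {b : Coeffs n} {B B' : ℝ}
    (hb : FourierBdd D (R - ρ) (S₀ - σ) B b) (hb' : FourierBdd D (R - ρ) (S₀ - σ) B' (lie S c b))
    {p : Phase n} (hp : p ∈ phaseDomain D (R - 2 * ρ) (S₀ - 2 * σ)) :
    ev (lieSum S c 1 b) p = ev b p + ev (lieSum S c 2 (lie S c b)) p := by
  have h1 := g.hasSum_ev_lieSum hb 1 hp
  have h2 := g.hasSum_ev_lieSum hb' 2 hp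
  have h3 := (hasSum_nat_add_iff' 1).2 h1
  have h4 := h3.unique (by simpa [Function.iterate_succ_apply, add_assoc] using h2)
  simp only [Finset.sum_range_one, zero_add, Nat.factorial_one, Nat.cast_one, Complex.ofReal_one,
    inv_one, one_mul, Function.iterate_zero, id_eq] at h4
  rw [← h4]
  ring

theorem bdd_stepRemainder (g : Generator D R S₀ C ρ σ S c) {a₁ a₂ w : Coeffs n} {A₁ A₂ W : ℝ}
    (h1 : FourierBdd D (R - ρ) (S₀ - σ) A₁ (lie S c a₁))
    (h2 : FourierBdd D (R - ρ) (S₀ - σ) A₂ (lie S c a₂))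
    (h3 : FourierBdd D (R - ρ) (S₀ - σ) W (lie S c w)) :
    FourierBdd D (R - 2 * ρ) (S₀ - 2 * σ) ((A₁ + A₂ + 2 * W) / (1 - 2 * C / (ρ * σ)))
      (stepRemainder S c a₁ a₂ w) := by
  refine (((g.bdd_lieSum h1 1).add (g.bdd_lieSum h2 1)).add
    ((g.bdd_lieSum h3 1).sub (g.bdd_lieSum h3 2))).mono le_rfl le_rfl (le_of_eq ?_)
  ring

/-- By the homological equation h∘Φ = h - w - ∑ L^j(Lw)/(j+2)!, while w∘Φ = w + ∑ L^j(Lw)/(j+1)!.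
The first-order terms cancel and only brackets remain. -/
theorem comp_step (g : Generator D R S₀ C ρ σ S c) {a₁ a₂ w : Coeffs n}
    {A₁ A₂ W r s A₁' A₂' W' : ℝ} (hr : R ≤ r) (hs : S₀ ≤ s)
    (ha₁ : FourierBdd D r s A₁' a₁) (ha₂ : FourierBdd D R S₀ A₂' a₂) (hw : FourierBdd D R S₀ W' w)
    (h1 : FourierBdd D (R - ρ) (S₀ - σ) A₁ (lie S c a₁))
    (h2 : FourierBdd D (R - ρ) (S₀ - σ) A₂ (lie S c a₂))
    (h3 : FourierBdd D (R - ρ) (S₀ - σ) W (lie S c w)) {h : (Fin n → ℂ) → ℂ}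
    (hh : DifferentiableOn ℂ h (actionDomain D R))
    (hcoh : ∀ p ∈ phaseDomain D R S₀, fderiv ℂ h p.1 (hamVec c p).1 = -ev w p) {p : Phase n}
    (hp : p ∈ phaseDomain D (R - 3 * ρ) (S₀ - 3 * σ)) :
    h (lieFlow S c 1 p).1 + ev a₁ (lieFlow S c 1 p) + ev a₂ (lieFlow S c 1 p) +
      ev w (lieFlow S c 1 p) = h p.1 + ev a₁ p + ev a₂ p + ev (stepRemainder S c a₁ a₂ w) p := by
  have hρ := g.rho_pos
  have hσ := g.sigma_pos
  have hS := g.width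
  have hsub : phaseDomain D (R - 2 * ρ) (S₀ - 2 * σ) ⊆ phaseDomain D R S₀ :=
    phaseDomain_mono (by linarith) (by linarith)
  have hp2 : p ∈ phaseDomain D (R - 2 * ρ) (S₀ - 2 * σ) :=
    phaseDomain_mono (by linarith) (by linarith) hp
  have hfun : ∀ {a : Coeffs n} {A A' : ℝ}, FourierBdd D R S₀ A' a →
      FourierBdd D (R - ρ) (S₀ - σ) A (lie S c a) →
      ev a (lieFlow S c 1 p) = ev a p + ev (lieSum S c 1 (lie S c a)) p := by
    intro a A A' ha hl
    refine g.comp_lieFlow hl ((ha.differentiableOn_ev (by linarith)).mono hsub) (fun q hq => ?_) hp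
    exact fderiv_ev_hamVec g.modes ha (by linarith) (hsub hq)
  have hwn : FourierBdd D (R - ρ) (S₀ - σ) W' (-w) :=
    hw.neg.mono (by linarith) (by linarith) le_rfl
  -- Since h differentiates to -w along the field, its expansion needs no norm bound on h itself.
  have e0 : h (lieFlow S c 1 p).1 = h p.1 + ev (lieSum S c 1 (-w)) p := by
    refine g.comp_lieFlow (G := fun p => h p.1) hwn
      (hh.comp differentiableOn_fst fun q hq => (hsub hq).1) (fun q hq => ?_) hp
    have hd := hh.differentiableAt ((isOpen_actionDomain D R).mem_nhds (hsub hq).1)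
    have h4 : HasFDerivAt (fun p : Phase n => h p.1) _ q := hd.hasFDerivAt.comp q hasFDerivAt_fst
    rw [h4.fderiv, ev_neg, ← hcoh q (hsub hq)]
    rfl
  have e1 : ev (lieSum S c 1 (-w)) p = -ev w p - ev (lieSum S c 2 (lie S c w)) p := by
    have hneg : lieSum S c 1 (-w) = -lieSum S c 1 w := by
      have h5 : ∀ j, (lie S c)^[j] (-w) = -(lie S c)^[j] w := by
        have h6 : ∀ b : Coeffs n, lie S c (-b) = -lie S c b := by
          intro b
          ext m y
          simp only [lie, Pi.neg_apply, ← Finset.sum_neg_distrib]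
          refine Finset.sum_congr rfl fun k _ => ?_
          rw [fderiv_neg]
          simp
          ring
        intro j
        induction j with
        | zero => rfl
        | succ j ih => rw [Function.iterate_succ_apply', ih, h6, Function.iterate_succ_apply']
      ext k y
      simp [lieSum, sumFamily, h5, tsum_neg]
    rw [hneg, ev_neg, g.ev_lieSum_one (hw.mono (by linarith) (by linarith) le_rfl) h3 hp2]
    ring
  have b1 := g.bdd_lieSum h1 1
  have b2 := g.bdd_lieSum h2 1
  have b3 := g.bdd_lieSum h3 1
  have b4 := g.bdd_lieSum h3 2
  rw [stepRemainder, (b1.add b2).ev_add (b3.sub b4) hp2, b1.ev_add b2 hp2, b3.ev_sub b4 hp2, e0,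
    e1, hfun (ha₁.mono hr hs le_rfl) h1, hfun ha₂ h2, hfun hw h3]
  ring

end Generator

end Transformation

/-! ### The homological equation and one averaging step. -/

section NormalFormStep

variable {n : ℕ} {D : Set (Fin n → ℝ)}

theorem Generator.conj_stepRemainder {R S₀ C ρ σ : ℝ} {S : Finset (Fin n → ℤ)} {c : Coeffs n}
    (g : Generator D R S₀ C ρ σ S c) {a₁ a₂ w : Coeffs n} {A₁ A₂ W : ℝ}
    (h1 : FourierBdd D (R - ρ) (S₀ - σ) A₁ (lie S c a₁)) (k1 : ConjSymm D (R - ρ) (lie S c a₁))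
    (h2 : FourierBdd D (R - ρ) (S₀ - σ) A₂ (lie S c a₂)) (k2 : ConjSymm D (R - ρ) (lie S c a₂))
    (h3 : FourierBdd D (R - ρ) (S₀ - σ) W (lie S c w)) (k3 : ConjSymm D (R - ρ) (lie S c w)) :
    ConjSymm D (R - 2 * ρ) (stepRemainder S c a₁ a₂ w) :=
  ((g.conj_lieSum h1 k1 1).add (g.conj_lieSum h2 k2 1)).add
    ((g.conj_lieSum h3 k3 1).sub (g.conj_lieSum h3 k3 2))

/-! ### Non-resonant modes and the homological equation -/

/-- The integer vectors with `|k|₁ ≤ K`, as a finite set. -/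
def lowModes (n K : ℕ) : Finset (Fin n → ℤ) :=
  (Finset.Icc (fun _ => -(K : ℤ)) (fun _ => (K : ℤ))).filter fun k => oneNorm k ≤ K

theorem mem_lowModes {K : ℕ} {k : Fin n → ℤ} : k ∈ lowModes n K ↔ oneNorm k ≤ K := by
  rw [lowModes, Finset.mem_filter, Finset.mem_Icc, and_iff_right_iff_imp]
  intro h
  have h1 : ∀ i, (k i).natAbs ≤ K := fun i =>
    (Finset.single_le_sum (f := fun i => (k i).natAbs) (fun _ _ => Nat.zero_le _)
      (Finset.mem_univ i)).trans h
  constructor <;> intro i <;> have := h1 i <;> simp only <;> omega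

/-- The modes `k ∉ Λ` with `|k|₁ ≤ K`. -/
def nonresModes (L : AddSubgroup (Fin n → ℤ)) (K : ℕ) : Set (Fin n → ℤ) :=
  {k | k ∉ L ∧ oneNorm k ≤ K}

theorem mem_nonresModes {L : AddSubgroup (Fin n → ℤ)} {K : ℕ} {k : Fin n → ℤ} :
    k ∈ nonresModes L K ↔ k ∉ L ∧ oneNorm k ≤ K := Iff.rfl

theorem neg_mem_nonresModes {L : AddSubgroup (Fin n → ℤ)} {K : ℕ} (k : Fin n → ℤ) :
    -k ∈ nonresModes L K ↔ k ∈ nonresModes L K := by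
  simp [mem_nonresModes, oneNorm_neg]

/-- The solution `c` of `{h, ev c} = ev w` for `w` with non-resonant modes only. -/
def homological (h : (Fin n → ℂ) → ℂ) (w : Coeffs n) : Coeffs n := fun k y =>
  w k y / (Complex.I * fderiv ℂ h y (intVec k))

section Homological

variable {h : (Fin n → ℂ) → ℂ} {α r R S₀ W : ℝ} {K : ℕ} {L : AddSubgroup (Fin n → ℤ)}
  {a : Coeffs n}

theorem homological_restr_eq_zero (h : (Fin n → ℂ) → ℂ) (a : Coeffs n) {k : Fin n → ℤ}
    (hk : k ∉ nonresModes L K) : homological h (restr (nonresModes L K) a) k = 0 := by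
  ext y; simp [homological, restr, hk]

/-- The divisors are at least α on the whole complex domain, so dividing by them costs 1/α and no
analyticity. -/
theorem fourierBdd_homological (hα : 0 < α) (hh : RealAnalyticAction D r h)
    (hres : NonResonant h α K L (actionDomain D r)) (hR : R ≤ r)
    (ha : FourierBdd D R S₀ W (restr (nonresModes L K) a)) :
    FourierBdd D R S₀ (W / α) (homological h (restr (nonresModes L K) a)) where
  nonneg := div_nonneg ha.nonneg hα.le
  holo k := by
    by_cases hk : k ∈ nonresModes L K
    · have h1 : DifferentiableOn ℂ (fun y => Complex.I * fderiv ℂ h y (intVec k))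
          (actionDomain D R) := ((differentiableOn_fderiv_apply (isOpen_actionDomain D r)
        hh.holomorphic _).mono (actionDomain_mono hR)).const_mul _
      have e : homological h (restr (nonresModes L K) a) k = fun y =>
          restr (nonresModes L K) a k y * (Complex.I * fderiv ℂ h y (intVec k))⁻¹ :=
        funext fun y => div_eq_mul_inv _ _
      rw [e]
      refine (ha.holo k).fun_mul (h1.fun_inv fun y hy => ?_)
      refine mul_ne_zero Complex.I_ne_zero (norm_pos_iff.1 (hα.trans_le ?_))
      exact hres y (actionDomain_mono hR hy) k hk.1 hk.2
    · rw [homological_restr_eq_zero h a hk]; exact differentiableOn_const _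
  bound y hy F := by
    rw [le_div_iff₀ hα, Finset.sum_mul]
    refine le_trans (Finset.sum_le_sum fun k _ => ?_) (ha.bound y hy F)
    rw [mul_right_comm]
    gcongr
    by_cases hk : k ∈ nonresModes L K
    · have h1 : α ≤ ‖fderiv ℂ h y (intVec k)‖ := hres y (actionDomain_mono hR hy) k hk.1 hk.2
      rw [homological, norm_div, norm_mul, Complex.norm_I, one_mul,
        div_mul_eq_mul_div, div_le_iff₀ (hα.trans_le h1)]
      exact mul_le_mul_of_nonneg_left h1 (norm_nonneg _)
    · rw [homological_restr_eq_zero h a hk]; simp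

theorem RealAnalyticAction.conj_fderiv (hh : RealAnalyticAction D r h) {y v : Fin n → ℂ}
    (hy : y ∈ actionDomain D r) (hyr : IsRealVec y) (hv : IsRealVec v) :
    (starRingEnd ℂ) (fderiv ℂ h y v) = fderiv ℂ h y v :=
  ConjSymm.conj_fderiv (a := fun _ => h)
    (fun z hz hzr _ => Complex.conj_eq_iff_im.2 (hh.real z hz hzr)) (fun _ => hh.holomorphic)
    hy hyr hv 0

theorem ConjSymm.homological (hh : RealAnalyticAction D r h) (hR : R ≤ r) (ha : ConjSymm D R a) :
    ConjSymm D R (homological h a) := by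
  intro y hy hyr k
  have e : intVec (-k) = -intVec k := by ext i; simp [intVec]
  rw [AnalyticNormalForm.homological, AnalyticNormalForm.homological, map_div₀, map_mul,
    Complex.conj_I, hh.conj_fderiv (actionDomain_mono hR hy) hyr (isRealVec_intVec k), ha y hy hyr,
    e, map_neg]
  congr 1
  ring

theorem fderiv_homological {S : Finset (Fin n → ℤ)} (hα : 0 < α)
    (hres : NonResonant h α K L (actionDomain D r)) (hS : ∀ k, k ∈ nonresModes L K → k ∈ S)
    {p : Phase n} (hp : p.1 ∈ actionDomain D r) :
    fderiv ℂ h p.1 (hamVec (homological h (restr (nonresModes L K) a)) p).1 =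
      -ev (restr (nonresModes L K) a) p := by
  set c := homological h (restr (nonresModes L K) a) with hc
  have hcS : ∀ k ∉ S, c k = 0 := fun k hk => homological_restr_eq_zero h a fun h' => hk (hS k h')
  have haS : ∀ k ∉ S, restr (nonresModes L K) a k = 0 := fun k hk => by
    have h' : k ∉ nonresModes L K := fun h' => hk (hS k h')
    ext y; simp [restr, h']
  have e : (hamVec c p).1 = ∑ k ∈ S,
      (-(Complex.I * c k p.1 * Complex.exp (Complex.I * intDot k p.2))) • intVec k := by
    ext i
    have : (hamVec c p).1 i = ev (hamY c i) p := rfl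
    rw [this, ev_eq_sum (hamY_eq_zero hcS i), Finset.sum_apply]
    refine Finset.sum_congr rfl fun k _ => ?_
    simp only [hamY, Pi.smul_apply, intVec, smul_eq_mul]
    ring
  rw [e, map_sum, ev_eq_sum haS, ← Finset.sum_neg_distrib]
  refine Finset.sum_congr rfl fun k _ => ?_
  rw [map_smul, smul_eq_mul, hc]
  by_cases hk : k ∈ nonresModes L K
  · have h1 : fderiv ℂ h p.1 (intVec k) ≠ 0 :=
      norm_pos_iff.1 (hα.trans_le (hres p.1 hp k hk.1 hk.2))
    rw [homological]
    have := Complex.I_ne_zero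
    field_simp
  · rw [homological_restr_eq_zero h a hk]
    simp [restr, hk]

end Homological

/-! ### One step of the normal form algorithm -/

/-- `F` is kept apart from `a` because it is bounded on the original domain: its bracket uses the
margins ρ', σ', which may be much larger than the margins ρ, σ lost in the step. Only the part of
`a` with modes in `nonresModes L K` is averaged out. -/
theorem normal_form_step {h : (Fin n → ℂ) → ℂ} {α r s R S₀ B A W ρ σ ρ' σ' : ℝ} {K : ℕ}
    {L : AddSubgroup (Fin n → ℤ)} {F a : Coeffs n} (hα : 0 < α) (hh : RealAnalyticAction D r h)
    (hres : NonResonant h α K L (actionDomain D r)) (hR : R ≤ r) (hS₀ : S₀ ≤ s)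
    (hF : FourierBdd D r s B F) (hFc : ConjSymm D r F)
    (ha : FourierBdd D R S₀ A (restr (nonresModes L K)ᶜ a)) (hac : ConjSymm D R a)
    (hw : FourierBdd D R S₀ W (restr (nonresModes L K) a))
    (hρ : 0 < ρ) (hσ : 0 < σ) (hρ' : 0 < ρ') (hσ' : 0 < σ') (hR' : R - ρ + ρ' ≤ r)
    (hS' : S₀ - σ + σ' ≤ s) (hwidth : 3 * σ < S₀) (hsmall : 2 * (W / α) / (ρ * σ) < 1) :
    ∃ (Φ : Phase n → Phase n) (b : Coeffs n),
      SymplecticChange D (R - 3 * ρ) (S₀ - 3 * σ) R S₀ Φ ∧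
      (∀ p ∈ phaseDomain D (R - 3 * ρ) (S₀ - 3 * σ),
        ∑ i, ‖(Φ p).1 i - p.1 i‖ ≤ W / α / (Real.exp 1 * σ) ∧
        ∀ i, ‖(Φ p).2 i - p.2 i‖ ≤ W / α / ρ) ∧
      FourierBdd D (R - 3 * ρ) (S₀ - 3 * σ)
        (((W / α / ρ * (B / (Real.exp 1 * σ')) + B / ρ' * (W / α / (Real.exp 1 * σ))) +
          (W / α / ρ * (A / (Real.exp 1 * σ)) + A / ρ * (W / α / (Real.exp 1 * σ))) +
          2 * (W / α / ρ * (W / (Real.exp 1 * σ)) + W / ρ * (W / α / (Real.exp 1 * σ)))) /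
          (1 - 2 * (W / α) / (ρ * σ))) b ∧
      ConjSymm D (R - 3 * ρ) b ∧
      ∀ p ∈ phaseDomain D (R - 3 * ρ) (S₀ - 3 * σ),
        h (Φ p).1 + ev F (Φ p) + ev a (Φ p) =
          h p.1 + ev F p + ev (restr (nonresModes L K)ᶜ a + b) p := by
  set N := nonresModes L K
  set w := restr N a
  set a₂ := restr Nᶜ a
  set c := homological h w
  have hN : ∀ k, -k ∈ N ↔ k ∈ N := neg_mem_nonresModes
  have hNS : ∀ k, k ∈ N → k ∈ lowModes n K := fun k hk => mem_lowModes.2 hk.2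
  have hwc : ConjSymm D R w := hac.restr hN
  have ha₂c : ConjSymm D R a₂ := hac.restr fun k => not_congr (hN k)
  have hc : FourierBdd D R S₀ (W / α) c := fourierBdd_homological hα hh hres hR hw
  have g : Generator D R S₀ (W / α) ρ σ (lowModes n K) c :=
    { modes := fun k hk => homological_restr_eq_zero h a fun h' => hk (hNS k h')
      symm := fun k => by rw [mem_lowModes, mem_lowModes, oneNorm_neg]
      bdd := hc
      conj := hwc.homological hh hR
      rho_pos := hρ
      sigma_pos := hσ
      width := hwidth
      small := hsmall }
  have b1 := hc.lie (S := lowModes n K) hF hρ hσ hρ' hσ' (r' := R - ρ) (s' := S₀ - σ) (by linarith)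
    (by linarith) (by linarith) hR' hS'
  have b2 := hc.lie (S := lowModes n K) ha hρ hσ hρ hσ (r' := R - ρ) (s' := S₀ - σ) (by linarith)
    (by linarith) (by linarith) (by linarith) (by linarith)
  have b3 := hc.lie (S := lowModes n K) hw hρ hσ hρ hσ (r' := R - ρ) (s' := S₀ - σ) (by linarith)
    (by linarith) (by linarith) (by linarith) (by linarith)
  have k1 := g.conj.lie hc.holo hFc hF.holo g.symm (r' := R - ρ) (by linarith) (by linarith)
  have k2 := g.conj.lie hc.holo ha₂c ha.holo g.symm (r' := R - ρ) (by linarith) (by linarith)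
  have k3 := g.conj.lie hc.holo hwc hw.holo g.symm (r' := R - ρ) (by linarith) (by linarith)
  have hbR := g.bdd_stepRemainder b1 b2 b3
  have hΦ := g.symplecticChange.mono (r := R) (s := S₀) (by linarith) (by linarith)
  refine ⟨lieFlow (lowModes n K) c 1, stepRemainder (lowModes n K) c F a₂ w, hΦ,
    fun p hp => g.displacement hp, hbR.mono (by linarith) (by linarith) le_rfl,
    (g.conj_stepRemainder b1 k1 b2 k2 b3 k3).mono (by linarith), fun p hp => ?_⟩
  have hp2 : p ∈ phaseDomain D (R - 2 * ρ) (S₀ - 2 * σ) :=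
    phaseDomain_mono (by linarith) (by linarith) hp
  have key := g.comp_step hR hS₀ hF ha hw b1 b2 b3
    (hh.holomorphic.mono (actionDomain_mono hR))
    (fun q hq => fderiv_homological hα hres hNS (actionDomain_mono hR hq.1)) hp
  have hsplit : ev a (lieFlow (lowModes n K) c 1 p) = ev w (lieFlow (lowModes n K) c 1 p) +
      ev a₂ (lieFlow (lowModes n K) c 1 p) := by
    rw [← hw.ev_add ha (hΦ.mapsTo hp), restr_add_restr_compl]
  rw [hsplit, (ha.mono (by linarith) (by linarith) le_rfl).ev_add hbR hp2]
  linear_combination key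

end NormalFormStep

/-! ### The preliminary step and the K further steps. -/

section NormalFormIteration

variable {n : ℕ} {D : Set (Fin n → ℝ)}

theorem restr_add (T : Set (Fin n → ℤ)) (a b : Coeffs n) :
    restr T (a + b) = restr T a + restr T b := by
  ext k y
  by_cases h : k ∈ T <;> simp [restr, h]

theorem restr_restr (T U : Set (Fin n → ℤ)) (a : Coeffs n) :
    restr T (restr U a) = restr (T ∩ U) a := by
  ext k y
  by_cases h : k ∈ T <;> by_cases h' : k ∈ U <;> simp [restr, h, h']

theorem restr_empty (a : Coeffs n) : restr ∅ a = 0 := by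
  ext k y
  simp [restr]

theorem FourierBdd.zero (D : Set (Fin n → ℝ)) (r s : ℝ) : FourierBdd D r s 0 (0 : Coeffs n) where
  nonneg := le_rfl
  holo _ := differentiableOn_const _
  bound _ _ _ := by simp

theorem SymplecticChange.id (D : Set (Fin n → ℝ)) (r s : ℝ) :
    SymplecticChange D r s r s (id : Phase n → Phase n) where
  mapsTo := mapsTo_id _
  holomorphic := differentiableOn_id
  equivariant _ _ _ := rfl
  real _ _ h1 h2 := ⟨h1, h2⟩
  injective := injOn_id _
  symplectic _ _ _ _ := by simp

/-! ### Iteration of the normal form step -/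

/-- `Ψ` conjugates `h + f` on `D_{r'} × 𝕋ⁿ_{s'}` to `h + ev F + ev a`; the bounds `W` and `A` are on
the parts of `a` with modes inside and outside `N`, and `X`, `Y` bound the displacements. -/
structure IsNormalForm (D : Set (Fin n → ℝ)) (r s : ℝ) (h : (Fin n → ℂ) → ℂ) (f : Phase n → ℂ)
    (N : Set (Fin n → ℤ)) (F : Coeffs n) (r' s' A W X Y : ℝ) (Ψ : Phase n → Phase n)
    (a : Coeffs n) : Prop where
  change : SymplecticChange D r' s' r s Ψ
  displacement : ∀ p ∈ phaseDomain D r' s',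
    ∑ i, ‖(Ψ p).1 i - p.1 i‖ ≤ X ∧ ∀ i, ‖(Ψ p).2 i - p.2 i‖ ≤ Y
  high : FourierBdd D r' s' A (restr Nᶜ a)
  low : FourierBdd D r' s' W (restr N a)
  conj : ConjSymm D r' a
  conjugates : ∀ p ∈ phaseDomain D r' s',
    h (Ψ p).1 + f (Ψ p) = h p.1 + ev F p + ev a p

section Iteration

variable {h : (Fin n → ℂ) → ℂ} {f : Phase n → ℂ} {α r s : ℝ} {K : ℕ}
  {L : AddSubgroup (Fin n → ℤ)} {F a : Coeffs n}

theorem IsNormalForm.mono {N : Set (Fin n → ℤ)} {r' s' A W X Y A' W' X' Y' : ℝ}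
    {Ψ : Phase n → Phase n} (H : IsNormalForm D r s h f N F r' s' A W X Y Ψ a) (hA : A ≤ A')
    (hW : W ≤ W') (hX : X ≤ X') (hY : Y ≤ Y') :
    IsNormalForm D r s h f N F r' s' A' W' X' Y' Ψ a where
  change := H.change
  displacement p hp := ⟨(H.displacement p hp).1.trans hX,
    fun i => ((H.displacement p hp).2 i).trans hY⟩
  high := H.high.mono le_rfl le_rfl hA
  low := H.low.mono le_rfl le_rfl hW
  conj := H.conj
  conjugates := H.conjugates

/-- The starting point: f♭ goes into `F` once and for all, and the perturbation consists only of the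
non-resonant low modes, so its other part is 0. -/
theorem isNormalForm_id {N : Set (Fin n → ℤ)} {M : ℝ} (ha : FourierBdd D r s M a)
    (hac : ConjSymm D r a) (hN : ∀ k, -k ∈ N ↔ k ∈ N) :
    IsNormalForm D r s h (ev a) N (restr Nᶜ a) r s 0 M 0 0 id (restr N a) where
  change := SymplecticChange.id D r s
  displacement p _ := by simp
  high := by
    rw [restr_restr, compl_inter_self, restr_empty]
    exact FourierBdd.zero D r s
  low := by
    rw [restr_restr, inter_self]
    exact ha.restr N
  conj := hac.restr hN
  conjugates p hp := by
    have := (ha.restr Nᶜ).ev_add (ha.restr N) hp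
    rw [add_comm (restr Nᶜ a), restr_add_restr_compl] at this
    rw [id, this]
    ring

/-- Everything is expressed through u, the smallness with the margins of the step, and v, its
analogue for brackets with `F`; 1/e is replaced by 1/2. -/
theorem remainder_bound_le {e C B A W ρ σ ρ' σ' u v : ℝ} (he : 2 ≤ e) (hB : 0 ≤ B) (hA : 0 ≤ A)
    (hW : 0 ≤ W) (hC : 0 ≤ C) (hρ : 0 < ρ) (hσ : 0 < σ) (hu : C / (ρ * σ) = u)
    (hv : C / (ρ * σ') + C / (ρ' * σ) = v) (hv0 : 0 ≤ v) (hu1 : 2 * u < 1) :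
    ((C / ρ * (B / (e * σ')) + B / ρ' * (C / (e * σ))) +
      (C / ρ * (A / (e * σ)) + A / ρ * (C / (e * σ))) +
      2 * (C / ρ * (W / (e * σ)) + W / ρ * (C / (e * σ)))) / (1 - 2 * C / (ρ * σ)) ≤
    (v * B + 2 * u * A + 4 * u * W) / 2 / (1 - 2 * u) := by
  have hu0 : 0 ≤ u := by rw [← hu]; positivity
  have e1 : 1 - 2 * C / (ρ * σ) = 1 - 2 * u := by rw [← hu]; ring
  have e2 : (C / ρ * (B / (e * σ')) + B / ρ' * (C / (e * σ))) +
      (C / ρ * (A / (e * σ)) + A / ρ * (C / (e * σ))) +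
      2 * (C / ρ * (W / (e * σ)) + W / ρ * (C / (e * σ))) =
      (v * B + 2 * u * A + 4 * u * W) / e := by
    rw [← hu, ← hv]
    simp only [div_eq_mul_inv, mul_inv]
    ring
  rw [e1, e2]
  have h3 : 0 ≤ v * B + 2 * u * A + 4 * u * W := by positivity
  have h4 : 0 < 1 - 2 * u := by linarith
  gcongr

theorem two_le_exp_one : (2 : ℝ) ≤ Real.exp 1 := by
  have := Real.add_one_le_exp (1 : ℝ)
  linarith

theorem IsNormalForm.step {R S₀ B A W X Y ρ σ ρ' σ' u v : ℝ}
    {Ψ : Phase n → Phase n} (hα : 0 < α) (hh : RealAnalyticAction D r h)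
    (hres : NonResonant h α K L (actionDomain D r)) (hF : FourierBdd D r s B F)
    (hFc : ConjSymm D r F)
    (H : IsNormalForm D r s h f (nonresModes L K) F R S₀ A W X Y Ψ a) (hR : R ≤ r) (hS₀ : S₀ ≤ s)
    (hρ : 0 < ρ) (hσ : 0 < σ) (hρ' : 0 < ρ') (hσ' : 0 < σ') (hR' : R - ρ + ρ' ≤ r)
    (hS' : S₀ - σ + σ' ≤ s) (hwidth : 3 * σ < S₀) (hu : W / α / (ρ * σ) = u)
    (hv : W / α / (ρ * σ') + W / α / (ρ' * σ) = v) (hu1 : 2 * u < 1) :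
    ∃ (Ψ' : Phase n → Phase n) (a' : Coeffs n),
      IsNormalForm D r s h f (nonresModes L K) F (R - 3 * ρ) (S₀ - 3 * σ)
        (A + (v * B + 2 * u * A + 4 * u * W) / 2 / (1 - 2 * u))
        ((v * B + 2 * u * A + 4 * u * W) / 2 / (1 - 2 * u))
        (X + W / α / (2 * σ)) (Y + W / α / ρ) Ψ' a' := by
  have hC : 0 ≤ W / α := div_nonneg H.low.nonneg hα.le
  have hu2 : 2 * (W / α) / (ρ * σ) < 1 := by rw [mul_div_assoc, hu]; exact hu1
  obtain ⟨Φ, b, c1, c2, c3, c4, c5⟩ := normal_form_step hα hh hres hR hS₀ hF hFc H.high H.conj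
    H.low hρ hσ hρ' hσ' hR' hS' hwidth hu2
  set N := nonresModes L K
  have c3' := c3.mono le_rfl le_rfl (remainder_bound_le two_le_exp_one hF.nonneg H.high.nonneg
    H.low.nonneg hC hρ hσ hu hv (by rw [← hv]; positivity) hu1)
  have hN : ∀ k, -k ∈ Nᶜ ↔ k ∈ Nᶜ := fun k => not_congr (neg_mem_nonresModes k)
  have e1 : restr Nᶜ (restr Nᶜ a + b) = restr Nᶜ a + restr Nᶜ b := by
    rw [restr_add, restr_restr, inter_self]
  have e2 : restr N (restr Nᶜ a + b) = restr N b := by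
    rw [restr_add, restr_restr, inter_compl_self, restr_empty, zero_add]
  refine ⟨Ψ ∘ Φ, restr Nᶜ a + b, H.change.comp c1, fun p hp => ?_, ?_, ?_, ?_, fun p hp => ?_⟩
  · obtain ⟨d1, d2⟩ := H.displacement _ (c1.mapsTo hp)
    obtain ⟨d3, d4⟩ := c2 p hp
    constructor
    · have d5 : W / α / (Real.exp 1 * σ) ≤ W / α / (2 * σ) := by
        gcongr
        exact two_le_exp_one
      refine le_trans ?_ (add_le_add d1 (d3.trans d5))
      rw [← Finset.sum_add_distrib]
      exact Finset.sum_le_sum fun i _ => norm_sub_le_norm_sub_add_norm_sub _ _ _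
    · intro i
      exact (norm_sub_le_norm_sub_add_norm_sub _ _ _).trans (add_le_add (d2 i) (d4 i))
  · rw [e1]
    exact (H.high.mono (by linarith) (by linarith) le_rfl).add (c3'.restr _)
  · rw [e2]
    exact c3'.restr _
  · exact ((H.conj.restr hN).mono (by linarith)).add c4
  · rw [← c5 p hp, ← H.conjugates _ (c1.mapsTo hp)]
    rfl

-- Index j stands for j + 1 flows, since j = 0 already contains the preliminary one. The high part
-- grows by at most half the previous increment each time, and so do the displacement budgets; this
-- explains the factors 2 - 2⁻ʲ and 1 - 2⁻⁽ʲ⁺¹⁾.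
set_option maxHeartbeats 800000 in
theorem exists_isNormalForm {ε θ : ℝ} (hr : 0 < r) (hs : 0 < s) (hα : 0 < α) (hK : 2 ≤ K)
    (hh : RealAnalyticAction D r h) (hres : NonResonant h α K L (actionDomain D r))
    (ha : FourierBdd D r s ε a) (hac : ConjSymm D r a)
    (hθ : θ = 2 ^ 11 * (K : ℝ) ^ 2 / (α * r * s) * ε) (hθ1 : θ < 1) (j : ℕ) (hj : j ≤ K) :
    ∃ (Ψ : Phase n → Phase n) (b : Coeffs n),
      IsNormalForm D r s h (ev a) (nonresModes L K) (restr (nonresModes L K)ᶜ a)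
        (3 * r / 4 - j * (3 * (r / (12 * K)))) (s - s / (2 * K) - j * (3 * (s / (6 * K ^ 2))))
        ((2 - (1 / 2) ^ j) * (θ / (8 * K) * ε)) ((θ / 8) ^ j * (θ / (8 * K) * ε))
        (θ / (2 ^ 7 * K) * r * (1 - (1 / 2) ^ (j + 1)))
        (θ / (16 * K ^ 2) * s * (1 - (1 / 2) ^ (j + 1))) Ψ b := by
  have hε := ha.nonneg
  have hK0 : (2 : ℝ) ≤ K := by exact_mod_cast hK
  have hKp : (0 : ℝ) < K := by linarith
  have hθ0 : 0 ≤ θ := by rw [hθ]; positivity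
  have hN : ∀ k, -k ∈ nonresModes L K ↔ k ∈ nonresModes L K := neg_mem_nonresModes
  have hFc : ConjSymm D r (restr (nonresModes L K)ᶜ a) := hac.restr fun k => not_congr (hN k)
  -- Solving the definition of θ for ε/α makes every smallness parameter below an explicit multiple
  -- of θ.
  have hεα : ε / α = θ * r * s / (2 ^ 11 * K ^ 2) := by
    rw [hθ]; field_simp
  induction j with
  | zero =>
    set x := θ / (8 * K) with hx
    have hx0 : 0 ≤ x := by positivity
    have hx3 : x ≤ 1 / 16 := by
      rw [hx, div_le_iff₀ (by positivity)]; linarith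
    have hx1 : 9 * θ / (256 * K) = 9 / 32 * x := by rw [hx]; field_simp; ring
    have hx2 : 9 * θ / (128 * K) = 9 / 16 * x := by rw [hx]; field_simp; ring
    have w1 : 3 * (s / (6 * K)) < s := by
      have e : 3 * (s / (6 * K)) = s / (2 * K) := by field_simp; ring
      rw [e]
      exact div_lt_self hs (by linarith)
    have w2 : ε / α / (r / 12 * (s / (6 * K))) = 9 * θ / (256 * K) := by
      rw [hεα]; field_simp; ring
    have w3 : ε / α / (r / 12 * (s / (6 * K))) + ε / α / (r / 12 * (s / (6 * K))) =
        9 * θ / (128 * K) := by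
      rw [w2]; field_simp; ring
    have w4 : 2 * (9 * θ / (256 * K)) < 1 := by rw [hx1]; linarith
    -- The preliminary flow loses 3·r/12 = r/4 and 3·s/(6K) = s/(2K), the margins later reserved for
    -- `F`.
    obtain ⟨Ψ, b, H⟩ := (isNormalForm_id (h := h) ha hac hN).step (ρ := r / 12) (ρ' := r / 12)
      (σ := s / (6 * K)) (σ' := s / (6 * K)) (u := 9 * θ / (256 * K)) (v := 9 * θ / (128 * K))
      hα hh hres (ha.restr _) hFc le_rfl le_rfl (by positivity) (by positivity) (by positivity)
      (by positivity) (by linarith) (by linarith) w1 w2 w3 w4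
    · have hd : (9 * θ / (128 * K) * ε + 2 * (9 * θ / (256 * K)) * 0 +
          4 * (9 * θ / (256 * K)) * ε) / 2 / (1 - 2 * (9 * θ / (256 * K))) ≤ θ / (8 * K) * ε := by
        rw [hx1, hx2, div_le_iff₀ (by linarith)]
        have := mul_nonneg hx0 hε
        nlinarith
      have e1 : 3 * r / 4 - (0 : ℕ) * (3 * (r / (12 * K))) = r - 3 * (r / 12) := by
        push_cast; ring
      have e2 : s - s / (2 * K) - (0 : ℕ) * (3 * (s / (6 * K ^ 2))) = s - 3 * (s / (6 * K)) := by
        push_cast; field_simp; ring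
      rw [e1, e2]
      refine ⟨Ψ, b, H.mono ?_ ?_ ?_ ?_⟩
      · simp only [pow_zero, zero_add]
        linarith
      · simp only [pow_zero, one_mul]
        exact hd
      · rw [hεα]
        have i1 : θ * r * s / (2 ^ 11 * K ^ 2) / (2 * (s / (6 * K))) = θ * r / K * (3 / 2048) := by
          field_simp; ring
        have i2 : θ / (2 ^ 7 * K) * r * (1 - (1 / 2) ^ (0 + 1)) = θ * r / K * (1 / 256) := by
          field_simp; ring
        rw [i1, i2, zero_add]
        exact mul_le_mul_of_nonneg_left (by norm_num) (by positivity)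
      · rw [hεα]
        have i1 : θ * r * s / (2 ^ 11 * K ^ 2) / (r / 12) = θ * s / K ^ 2 * (12 / 2048) := by
          field_simp; ring
        have i2 : θ / (16 * K ^ 2) * s * (1 - (1 / 2) ^ (0 + 1)) = θ * s / K ^ 2 * (1 / 32) := by
          field_simp; ring
        rw [i1, i2, zero_add]
        exact mul_le_mul_of_nonneg_left (by norm_num) (by positivity)
  | succ j ih =>
    obtain ⟨Ψ, b, H⟩ := ih (by omega)
    have hjK : (j : ℝ) + 1 ≤ K := by exact_mod_cast hj
    have hr0 : 0 ≤ j * (3 * (r / (12 * K))) := by positivity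
    have hr1 : 0 ≤ r / (12 * K) := by positivity
    have hs0 : 0 ≤ j * (3 * (s / (6 * K ^ 2))) := by positivity
    have hs1 : 0 ≤ s / (6 * K ^ 2) := by positivity
    have hs2 : 0 ≤ s / (2 * K) := by positivity
    -- `T` is (θ/8)^(j+1), so the present non-resonant part is bounded by Tε/K.
    set T : ℝ := (θ / 8) ^ j * (θ / 8) with hT
    have hT0 : 0 ≤ T := by positivity
    have hTθ : T ≤ θ / 8 :=
      mul_le_of_le_one_left (by positivity) (pow_le_one₀ (by positivity) (by linarith))
    have hp0 : (0 : ℝ) < (1 / 2) ^ j := by positivity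
    have hTj : T ≤ (1 / 2) ^ j / 8 := by
      have : (θ / 8) ^ j ≤ (1 / 2) ^ j := by gcongr; linarith
      calc T ≤ (1 / 2) ^ j * (1 / 8) := by rw [hT]; gcongr
        _ = _ := by ring
    have hTT : T * θ ≤ 1 / 8 := by nlinarith
    have hWα : (θ / 8) ^ j * (θ / (8 * K) * ε) / α = T / K * (θ * r * s / (2 ^ 11 * K ^ 2)) := by
      rw [← hεα, hT]; field_simp
    have w1 : 3 * (s / (6 * K ^ 2)) < s - s / (2 * K) - j * (3 * (s / (6 * K ^ 2))) := by
      have j1 : (j + 1 : ℝ) * (3 * (s / (6 * K ^ 2))) ≤ K * (3 * (s / (6 * K ^ 2))) := by gcongr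
      have j2 : K * (3 * (s / (6 * K ^ 2))) = s / (2 * K) := by field_simp; ring
      have j3 : s / (2 * K) < s / 2 := div_lt_div_of_pos_left hs (by norm_num) (by linarith)
      linarith
    have w2 : (θ / 8) ^ j * (θ / (8 * K) * ε) / α / (r / (12 * K) * (s / (6 * K ^ 2))) =
        9 / 256 * T * θ := by
      rw [hWα]; field_simp; ring
    have w3 : (θ / 8) ^ j * (θ / (8 * K) * ε) / α / (r / (12 * K) * (s / (2 * K))) +
        (θ / 8) ^ j * (θ / (8 * K) * ε) / α / (r / 4 * (s / (6 * K ^ 2))) =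
        3 / 128 * (T / K) * θ := by
      rw [hWα]; field_simp; ring
    -- The margins ρ' = r/4 and σ' = s/(2K) fit because the preliminary flow has already moved that
    -- far inside the domain of `F`. They give v an additional 1/K, which compensates for `F` being
    -- of size ε instead of θε/K.
    obtain ⟨Ψ', b', H'⟩ := H.step (ρ := r / (12 * K)) (ρ' := r / 4)
      (σ := s / (6 * K ^ 2)) (σ' := s / (2 * K)) (u := 9 / 256 * T * θ)
      (v := 3 / 128 * (T / K) * θ)
      hα hh hres (ha.restr _) hFc (by linarith) (by linarith) (by positivity) (by positivity)
      (by positivity) (by positivity) (by linarith) (by linarith) w1 w2 w3 (by linarith)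
    · set E := (3 / 128 * (T / K) * θ * ε +
        2 * (9 / 256 * T * θ) * ((2 - (1 / 2) ^ j) * (θ / (8 * K) * ε)) +
        4 * (9 / 256 * T * θ) * ((θ / 8) ^ j * (θ / (8 * K) * ε))) / 2 /
          (1 - 2 * (9 / 256 * T * θ)) with hE
      -- In units of y = Tεθ/K the target is y/8. The three brackets contribute at most (3 + 9/4 +
      -- 9/4) y/128, to be halved and then divided by 1 - 2u ≥ 1/2.
      have hd : E ≤ (θ / 8) ^ (j + 1) * (θ / (8 * K) * ε) := by
        set y := T / K * ε * θ with hy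
        have hy0 : 0 ≤ y := by positivity
        have f1 : (θ / 8) ^ (j + 1) * (θ / (8 * K) * ε) = y / 8 := by
          rw [hy, hT, pow_succ]; field_simp
        have f2 : 3 / 128 * (T / K) * θ * ε = 3 / 128 * y := by rw [hy]; ring
        have f3 : 2 * (9 / 256 * T * θ) * ((2 - (1 / 2) ^ j) * (θ / (8 * K) * ε)) =
            9 / 1024 * y * (θ * (2 - (1 / 2) ^ j)) := by rw [hy]; field_simp; ring
        have f4 : 4 * (9 / 256 * T * θ) * ((θ / 8) ^ j * (θ / (8 * K) * ε)) =
            9 / 64 * y * T := by rw [hy, hT]; field_simp; ring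
        have f5 : θ * (2 - (1 / 2) ^ j) ≤ 2 := by nlinarith
        have f6 : 9 / 1024 * y * (θ * (2 - (1 / 2) ^ j)) ≤ 9 / 1024 * y * 2 := by gcongr
        have f7 : 9 / 64 * y * T ≤ 9 / 64 * y * (1 / 8) := by gcongr; linarith
        rw [hE, f1, f2, f3, f4, div_le_iff₀ (by linarith)]
        have f8 : y / 8 * (1 / 2) ≤ y / 8 * (1 - 2 * (9 / 256 * T * θ)) := by gcongr; linarith
        linarith
      have e1 : 3 * r / 4 - (j + 1 : ℕ) * (3 * (r / (12 * K))) =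
          3 * r / 4 - j * (3 * (r / (12 * K))) - 3 * (r / (12 * K)) := by
        push_cast; ring
      have e2 : s - s / (2 * K) - (j + 1 : ℕ) * (3 * (s / (6 * K ^ 2))) =
          s - s / (2 * K) - j * (3 * (s / (6 * K ^ 2))) - 3 * (s / (6 * K ^ 2)) := by
        push_cast; ring
      rw [e1, e2]
      refine ⟨Ψ', b', H'.mono ?_ hd ?_ ?_⟩
      · have f1 : (θ / 8) ^ (j + 1) * (θ / (8 * K) * ε) ≤
            (1 / 2) ^ j / 8 * (θ / (8 * K) * ε) := by
          rw [pow_succ]; gcongr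
        have f2 : 0 ≤ (1 / 2) ^ j * (θ / (8 * K) * ε) := by positivity
        rw [pow_succ (1 / 2 : ℝ)]
        linarith
      · rw [hWα]
        have i1 : T / K * (θ * r * s / (2 ^ 11 * K ^ 2)) / (2 * (s / (6 * K ^ 2))) =
          θ / (2 ^ 7 * K) * r * (T * (3 / 16)) := by field_simp; ring
        have i2 : θ / (2 ^ 7 * K) * r * (T * (3 / 16)) ≤
            θ / (2 ^ 7 * K) * r * ((1 / 2) ^ j / 4) := by gcongr; linarith
        rw [i1, pow_succ (1 / 2 : ℝ) (j + 1), pow_succ (1 / 2 : ℝ) j]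
        linarith
      · rw [hWα]
        have i1 : T / K * (θ * r * s / (2 ^ 11 * K ^ 2)) / (r / (12 * K)) =
          θ / (16 * K ^ 2) * s * (T * (3 / 32)) := by field_simp; ring
        have i2 : θ / (16 * K ^ 2) * s * (T * (3 / 32)) ≤
            θ / (16 * K ^ 2) * s * ((1 / 2) ^ j / 4) := by gcongr; linarith
        rw [i1, pow_succ (1 / 2 : ℝ) (j + 1), pow_succ (1 / 2 : ℝ) j]
        linarith

end Iteration

end NormalFormIteration

/-! ### Mode projections and the exponentially small part. -/

section FinalEstimates

variable {n : ℕ} {D : Set (Fin n → ℝ)} {r s M : ℝ} {a b : Coeffs n}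

theorem FourierBdd.modeProj_eq (hb : FourierBdd D r s M b) (hs : 0 < s) {G : Phase n → ℂ}
    (hG : ∀ p ∈ phaseDomain D r s, G p = ev b p) (T : Set (Fin n → ℤ)) {p : Phase n}
    (hp : p.1 ∈ actionDomain D r) : modeProj T G p = ev (AnalyticNormalForm.restr T b) p := by
  rw [modeProj_eq_ev, ev, ev]
  refine tsum_congr fun k => ?_
  congr 1
  by_cases h : k ∈ T <;> simp [AnalyticNormalForm.restr, h, hb.coeff_eq_of_eqOn hs hG hp]

theorem FourierBdd.fourierNorm_le (hb : FourierBdd D r s M b) (hs : 0 < s) {G : Phase n → ℂ}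
    (hG : ∀ p ∈ phaseDomain D r s, G p = ev b p) :
    fourierNorm D r s G ≤ ENNReal.ofReal M :=
  AnalyticNormalForm.fourierNorm_le hb fun _ hy k => hb.coeff_eq_of_eqOn hs hG hy k

/-- High modes are exponentially small on a narrower strip. -/
theorem FourierBdd.restr_high (ha : FourierBdd D r s M a) {s' : ℝ} (hs : s' ≤ s)
    {T : Set (Fin n → ℤ)} {m : ℝ} (hT : ∀ k ∈ T, m ≤ oneNorm k) :
    FourierBdd D r s' (Real.exp (-(m * (s - s'))) * M) (AnalyticNormalForm.restr T a) where
  nonneg := mul_nonneg (Real.exp_pos _).le ha.nonneg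
  holo := (ha.restr T).holo
  bound y hy F := by
    refine le_trans ?_ (mul_le_mul_of_nonneg_left ((ha.restr T).bound y hy F) (Real.exp_pos _).le)
    rw [Finset.mul_sum]
    refine Finset.sum_le_sum fun k _ => ?_
    by_cases h : k ∈ T
    · rw [mul_left_comm, ← Real.exp_add]
      refine mul_le_mul_of_nonneg_left (Real.exp_le_exp.2 ?_) (norm_nonneg _)
      nlinarith [hT k h]
    · simp [AnalyticNormalForm.restr, h]

/-- The three terms are the high modes of f♭, the low non-resonant modes and the high modes of the
remainder. They are at most 1, 1/16 and 1/8 times Xε, whose sum is below 2Xε. -/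
theorem high_mode_estimate {s θ ε K A B E₁ : ℝ} (hK : 2 ≤ K) (hs : 0 < s) (hθ0 : 0 ≤ θ)
    (hθ1 : θ < 1) (hε : 0 ≤ ε) {N : ℕ} (hN : (N : ℝ) = K) (hE₁ : E₁ = θ / (8 * K) * ε)
    (hA : A = (θ / 8) ^ N * E₁) (hB : B ≤ 2 * E₁) :
    Real.exp (-((K + 1) * (s - s / 2))) * ε +
      (A + Real.exp (-((K + 1) * (s * (1 - 1 / K) - s / 2))) * B) ≤
      2 * Real.exp (-((K - 2) * min (s / 2) (Real.log (8 / θ)))) * ε := by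
  set m := min (s / 2) (Real.log (8 / θ)) with hm
  set X := Real.exp (-((K - 2) * m)) with hX
  have hm1 : m ≤ s / 2 := min_le_left _ _
  have hK2 : 0 ≤ K - 2 := by linarith
  have hX0 : 0 < X := Real.exp_pos _
  have hmul : (K - 2) * m ≤ (K - 2) * (s / 2) := mul_le_mul_of_nonneg_left hm1 hK2
  have hcoef : θ / (8 * K) ≤ 1 / 16 := by
    rw [div_le_iff₀ (by linarith)]; linarith
  have hE1 : E₁ ≤ 1 / 16 * ε := by rw [hE₁]; gcongr
  have hE0 : 0 ≤ E₁ := by rw [hE₁]; positivity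
  have t1 : Real.exp (-((K + 1) * (s - s / 2))) * ε ≤ X * ε := by
    refine mul_le_mul_of_nonneg_right (Real.exp_le_exp.2 ?_) hε
    nlinarith
  have t3 : Real.exp (-((K + 1) * (s * (1 - 1 / K) - s / 2))) * B ≤ X * (1 / 8 * ε) := by
    -- Going from width s(1 - 1/K) to s/2 leaves s(K-2)/(2K), hence the exponent K - 2; the
    -- frequency bound K + 1 more than pays for the 1/K.
    have h1 : (K + 1) * (s * (1 - 1 / K) - s / 2) = (K - 2) * (s / 2) * ((K + 1) / K) := by
      have : K ≠ 0 := by linarith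
      field_simp; ring
    have h2 : (K - 2) * (s / 2) * 1 ≤ (K - 2) * (s / 2) * ((K + 1) / K) := by
      gcongr
      rw [le_div_iff₀ (by linarith)]; linarith
    calc _ ≤ Real.exp (-((K + 1) * (s * (1 - 1 / K) - s / 2))) * (1 / 8 * ε) := by
          gcongr; linarith
      _ ≤ _ := by
          rw [h1]
          exact mul_le_mul_of_nonneg_right (Real.exp_le_exp.2 (by linarith)) (by positivity)
  have t2 : A ≤ X * (1 / 16 * ε) := by
    -- For θ = 0 the logarithm takes the value 0 and carries no information, but then E₁, and with
    -- it A, vanishes.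
    rcases hθ0.eq_or_lt with h0 | h0
    · have : A = 0 := by rw [hA, hE₁, ← h0]; simp
      rw [this]; positivity
    · rw [hA]
      have h1 : θ / 8 = Real.exp (-Real.log (8 / θ)) := by
        rw [Real.exp_neg, Real.exp_log (by positivity), inv_div]
      have h2 : 0 ≤ Real.log (8 / θ) := by
        refine Real.log_nonneg ?_
        rw [le_div_iff₀ h0]; linarith
      have h3 : m ≤ Real.log (8 / θ) := min_le_right _ _
      -- θ/8 is e^(-log(8/θ)), and both N = K ≥ K - 2 and log(8/θ) ≥ m go in the right direction.
      have h4 : (θ / 8) ^ N ≤ X := by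
        rw [h1, ← Real.exp_nat_mul, hN]
        refine Real.exp_le_exp.2 ?_
        nlinarith [mul_le_mul_of_nonneg_left h3 hK2]
      gcongr
  nlinarith [mul_nonneg hX0.le hε]

end FinalEstimates

end AnalyticNormalForm

end

/-! ### The normal form theorem. -/

theorem proposition4p1 (n : ℕ) (r s α : ℝ) (hr : 0 < r) (hs : 0 < s) (hα : 0 < α)
    (K : ℕ) (hK : 2 ≤ K) (D : Set (Fin n → ℝ)) (L : AddSubgroup (Fin n → ℤ))
    (h : (Fin n → ℂ) → ℂ) (f : Phase n → ℂ)
    (hh : RealAnalyticAction D r h) (hf : RealAnalyticPhase D r s f)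
    (hfin : fourierNorm D r s f ≠ ⊤)
    (hres : NonResonant h α K L (actionDomain D r))
    (ε θ : ℝ) (hε : ε = (fourierNorm D r s f).toReal)
    (hθ : θ = 2 ^ 11 * (K : ℝ) ^ 2 / (α * r * s) * ε) (hsmall : θ < 1) :
    ∃ Ψ : Phase n → Phase n,
      SymplecticChange D (r / 2) (s * (1 - 1 / (K : ℝ))) r s Ψ ∧
      (∀ p ∈ phaseDomain D (r / 2) (s * (1 - 1 / (K : ℝ))),
        ∑ i, ‖(Ψ p).1 i - p.1 i‖ ≤ θ / (2 ^ 7 * (K : ℝ)) * r ∧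
        ∀ i, ‖(Ψ p).2 i - p.2 i‖ ≤ θ / (16 * (K : ℝ) ^ 2) * s) ∧
      (∃ fs : Phase n → ℂ,
        RealAnalyticPhase D (r / 2) (s * (1 - 1 / (K : ℝ))) fs ∧
        (∀ p ∈ phaseDomain D (r / 2) (s * (1 - 1 / (K : ℝ))),
          h (Ψ p).1 + f (Ψ p) =
            h p.1 + (latticeProj L f p + truncPerp K (latticeProjPerp L f) p) + fs p) ∧
        fourierNorm D (r / 2) (s * (1 - 1 / (K : ℝ))) fs ≤ ENNReal.ofReal (1 / (K : ℝ) * θ * ε) ∧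
        fourierNorm D (r / 2) (s * (1 - 1 / (K : ℝ))) (trunc K (latticeProjPerp L fs)) ≤
          ENNReal.ofReal ((θ / 8) ^ K * (8 / (Real.exp 1 * (K : ℝ))) * ε)) ∧
      (∃ g fss : Phase n → ℂ,
        RealAnalyticPhase D (r / 2) (s * (1 - 1 / (K : ℝ))) g ∧
        RealAnalyticPhase D (r / 2) (s * (1 - 1 / (K : ℝ))) fss ∧
        (∀ p ∈ phaseDomain D (r / 2) (s * (1 - 1 / (K : ℝ))),
          h (Ψ p).1 + f (Ψ p) = h p.1 + g p + fss p ∧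
          latticeProj L g p = g p ∧ latticeProj L fss p = 0) ∧
        fourierNorm D (r / 2) (s * (1 - 1 / (K : ℝ))) (g - latticeProj L f) ≤
          ENNReal.ofReal (1 / (K : ℝ) * θ * ε) ∧
        fourierNorm D (r / 2) (s / 2) fss ≤
          ENNReal.ofReal
            (2 * Real.exp (-(((K : ℝ) - 2) * min (s / 2) (Real.log (8 / θ)))) * ε)) := by
  have hK0 : (2 : ℝ) ≤ K := by exact_mod_cast hK
  have hKp : (0 : ℝ) < K := by linarith
  set a := coeff f
  have ha : FourierBdd D r s ε a := by rw [hε]; exact fourierBdd_coeff hf hs hfin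
  have hac : ConjSymm D r a := conjSymm_coeff hf hs
  have hfa : ∀ p ∈ phaseDomain D r s, f p = ev a p := fun p hp => (ev_coeff hf hs ha hp).symm
  have hε0 : 0 ≤ ε := ha.nonneg
  have hθ0 : 0 ≤ θ := by rw [hθ]; positivity
  obtain ⟨Ψ, b, H⟩ := exists_isNormalForm hr hs hα hK hh hres ha hac hθ hsmall K le_rfl
  have er : 3 * r / 4 - K * (3 * (r / (12 * K))) = r / 2 := by field_simp; ring
  have es : s - s / (2 * K) - K * (3 * (s / (6 * K ^ 2))) = s * (1 - 1 / K) := by field_simp; ring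
  rw [er, es] at H
  have hr' : r / 2 ≤ r := by linarith
  have hKi : 1 / (K : ℝ) ≤ 1 / 2 := one_div_le_one_div_of_le (by norm_num) hK0
  have hKi0 : 0 < 1 / (K : ℝ) := by positivity
  have hs'h : s / 2 ≤ s * (1 - 1 / (K : ℝ)) := by nlinarith
  have hs' : s * (1 - 1 / (K : ℝ)) ≤ s := by nlinarith
  set r' := r / 2
  set s' := s * (1 - 1 / (K : ℝ)) with hs'def
  have hs'0 : 0 < s' := by linarith
  set E₁ := θ / (8 * K) * ε with hE₁
  have hE0 : 0 ≤ E₁ := by positivity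
  set N := nonresModes L K
  set Λ : Set (Fin n → ℤ) := {k | k ∈ L}
  set F := restr Nᶜ a
  have hsub : phaseDomain D r' s' ⊆ phaseDomain D r s := phaseDomain_mono hr' hs'
  have hΛ : ∀ k, -k ∈ Λ ↔ k ∈ Λ := fun k => neg_mem_iff (H := L)
  have hp2 : (0 : ℝ) < (1 / 2) ^ K := by positivity
  have hlow : FourierBdd D r' s' ((θ / 8) ^ K * E₁) (restr N b) := H.low
  have hpow : (θ / 8) ^ K ≤ (1 / 2) ^ K := by gcongr; linarith
  -- The low part is at most 2⁻ᴷE₁, exactly the amount by which the bound on the high part falls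
  -- short of 2E₁.
  have hb : FourierBdd D r' s' (2 * E₁) b := by
    have := hlow.add H.high
    rw [restr_add_restr_compl] at this
    refine this.mono le_rfl le_rfl ?_
    nlinarith
  have hF : FourierBdd D r s ε F := ha.restr _
  have hFc : ConjSymm D r F := hac.restr fun k => not_congr (neg_mem_nonresModes k)
  have hF' : FourierBdd D r' s' ε F := hF.mono hr' hs' le_rfl
  have hFb := hF'.add hb
  have hFbc : ConjSymm D r' (F + b) := (hFc.mono hr').add H.conj
  have hbound : 2 * E₁ ≤ 1 / (K : ℝ) * θ * ε := by
    have : 1 / (K : ℝ) * θ * ε = 8 * E₁ := by rw [hE₁]; field_simp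
    linarith
  have hconj : ∀ p ∈ phaseDomain D r' s', h (Ψ p).1 + f (Ψ p) = h p.1 + ev F p + ev b p :=
    fun p hp => by rw [hfa _ (H.change.mapsTo hp)]; exact H.conjugates p hp
  have hlat : ∀ p ∈ phaseDomain D r s, latticeProj L f p = ev (restr Λ a) p :=
    fun p hp => ha.modeProj_eq hs hfa Λ hp.1
  -- Λ lies in the complement of `N`, so f and f♭ have the same projection to Λ.
  have hΛF : restr Λ F = restr Λ a := by
    rw [restr_restr]
    congr 1
    exact Set.inter_eq_left.2 fun k hk hk' => hk'.1 hk
  -- f_* is the final remainder `b`; g and f_** are the parts of f♭ + f_* with modes in Λ and off Λ.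
  refine ⟨Ψ, H.change, fun p hp => ?_, ⟨ev b, hb.realAnalyticPhase hs'0 H.conj, fun p hp => ?_,
    ?_, ?_⟩, ev (restr Λ (F + b)), ev (restr Λᶜ (F + b)),
    (hFb.restr _).realAnalyticPhase hs'0 (hFbc.restr hΛ),
    (hFb.restr _).realAnalyticPhase hs'0 (hFbc.restr fun k => not_congr (hΛ k)),
    fun p hp => ⟨?_, ?_, ?_⟩, ?_, ?_⟩
  · obtain ⟨d1, d2⟩ := H.displacement p hp
    have hq : 1 - (1 / 2 : ℝ) ^ (K + 1) ≤ 1 := by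
      have : (0 : ℝ) < (1 / 2) ^ (K + 1) := by positivity
      linarith
    exact ⟨d1.trans (mul_le_of_le_one_right (by positivity) hq),
      fun i => (d2 i).trans (mul_le_of_le_one_right (by positivity) hq)⟩
  · rw [hconj p hp, hlat p (hsub hp)]
    have h1 : truncPerp K (latticeProjPerp L f) p =
        ev (restr {k | K < oneNorm k} (restr {k | k ∉ L} a)) p :=
      (ha.restr _).modeProj_eq hs (fun q hq => ha.modeProj_eq hs hfa _ hq.1) _ (hsub hp).1
    rw [h1, ← (ha.restr Λ).ev_add ((ha.restr _).restr _) (hsub hp)]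
    congr 3
    ext k y
    by_cases h1 : k ∈ L <;> by_cases h2 : oneNorm k ≤ K <;>
      simp [F, N, Λ, restr, mem_nonresModes, h1, h2, not_lt.2, not_le.1]
  · exact (hb.mono le_rfl le_rfl hbound).fourierNorm_le hs'0 fun _ _ => rfl
  -- T_K P_Λ^⊥ selects precisely the modes `N`, so the bound after K steps applies; its factor
  -- θ/(8K) is smaller than the required 8/(eK).
  · have h1 : ∀ p ∈ phaseDomain D r' s', trunc K (latticeProjPerp L (ev b)) p =
        ev (restr N b) p := fun p hp => by
      have h2 : trunc K (latticeProjPerp L (ev b)) p =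
          ev (restr {k | oneNorm k ≤ K} (restr {k | k ∉ L} b)) p :=
        (hb.restr _).modeProj_eq hs'0
          (fun q hq => hb.modeProj_eq hs'0 (fun _ _ => rfl) _ hq.1) _ hp.1
      rw [h2, restr_restr, Set.inter_comm]
      rfl
    refine (hlow.mono le_rfl le_rfl ?_).fourierNorm_le hs'0 h1
    rw [mul_assoc, hE₁]
    have h3 : Real.exp 1 ≤ 3 := Real.exp_one_lt_three.le
    have h4 : θ / (8 * K) ≤ 8 / (Real.exp 1 * K) := by
      rw [div_le_div_iff₀ (by positivity) (by positivity)]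
      calc θ * (Real.exp 1 * K) ≤ 1 * (3 * K) := by gcongr
        _ ≤ 8 * (8 * K) := by linarith
    exact mul_le_mul_of_nonneg_left (mul_le_mul_of_nonneg_right h4 hε0) (by positivity)
  · rw [hconj p hp, add_assoc, ← hF'.ev_add hb hp, add_assoc,
      ← (hFb.restr Λ).ev_add (hFb.restr Λᶜ) hp, restr_add_restr_compl]
  · refine ((hFb.restr Λ).modeProj_eq hs'0 (fun _ _ => rfl) Λ hp.1).trans ?_
    rw [restr_restr, Set.inter_self]
  · refine ((hFb.restr Λᶜ).modeProj_eq hs'0 (fun _ _ => rfl) Λ hp.1).trans ?_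
    rw [restr_restr, Set.inter_compl_self, restr_empty]
    simp [ev]
  · refine ((hb.restr Λ).mono le_rfl le_rfl hbound).fourierNorm_le hs'0 fun p hp => ?_
    rw [Pi.sub_apply, hlat p (hsub hp), restr_add, hΛF,
      ((ha.restr Λ).mono hr' hs' le_rfl).ev_add (hb.restr Λ) hp, add_sub_cancel_left]
  · set T : Set (Fin n → ℤ) := {k | k ∉ L ∧ K < oneNorm k}
    have hT : ∀ k ∈ T, (K : ℝ) + 1 ≤ oneNorm k := fun k hk => by exact_mod_cast hk.2
    have h1 := (hF.restr_high (s' := s / 2) (by linarith) hT).mono hr' le_rfl le_rfl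
    have h2 := hb.restr_high (s' := s / 2) hs'h hT
    have h3 := h1.add ((hlow.mono le_rfl hs'h le_rfl).add h2)
    -- Off Λ, f♭ has only modes with |k|₁ > K, while the remainder has those and the modes in `N`.
    have h4 : restr Λᶜ (F + b) = restr T F + (restr N b + restr T b) := by
      ext k y
      by_cases h1 : k ∈ L <;> by_cases h2 : oneNorm k ≤ K <;>
        simp [F, N, Λ, T, restr, mem_nonresModes, h1, h2, not_lt.2, not_le.1]
    refine (h3.mono le_rfl le_rfl (high_mode_estimate hK0 hs hθ0 hsmall hε0 rfl hE₁ rfl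
      le_rfl)).fourierNorm_le (by linarith) fun p _ => ?_
    rw [h4]
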